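/- **Setting.** Let $B\in\mathbb R^{d\times d}$ be symmetric positive definite, $\|v\|_B=\sqrt{v^\top Bv}$. A $p$ times differentiable $f:\mathbb R^d\to\mathbb R$ is *$L$-smooth of degree $p$* (w.r.t. $\|\cdot\|_B$) if $\max_{\|h\|_B\le1}|\nabla^pf(y)[h]^p-\nabla^pf(x)[h]^p|\le L\|y-x\|_B$ for all $x,y$, and a differentiable $f$ is *$\mu$-uniformly convex of degree $p$* if $f(y)\ge f(x)+\langle\nabla f(x),y-x\rangle+\frac{\mu}{p}\|y-x\|_B^p$ for all $x,y$. **Oracles.** A call to the gradient oracle at $(y,h)$ returns $\nabla f(y)$, $\nabla^2f(y)h$, $\nabla^3f(y)[h]^2$. A call to the linear system solver returns the solution $z$ of $(\nabla^2f(y)+sB)z=b$, or of $Bz=b$. **Method.** The scalar inputs are $L_3$, $\rho^-$, $\rho^+$, $\varepsilon_{fs}$, $\varepsilon_{aam}$, $\Lambda$ and the step numbers $J,K,M,N$. * $\mathsf{ApproxAuxMin}(y)$. Let $\Gamma(h)=\langle\nabla f(y),h\rangle+\frac12\nabla^2f(y)[h]^2+\frac16\nabla^3f(y)[h]^3+\frac{L_3}{4}\|h\|_B^4$,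 $D(h)=\frac12\nabla^2f(y)[h]^2+\frac{L_3}4\|h\|_B^4$ and $\sigma=1+1/\sqrt2$. Starting from $h_0=0$, perform $K$ steps $h_{t+1}\approx\arg\min_h\{\langle c_t,h\rangle+\sigma D(h)\}$ with $c_t=\nabla\Gamma(h_t)-\sigma\nabla D(h_t)$, and return $y+h_K$. Here the minimizer is computed as $h(s)=-\sigma^{-1}(\nabla^2f(y)+sB)^{-1}c_t$, where $s$ is the upper end of the interval obtained from $[0,\Lambda]$ by $J$ bisection steps; a step replaces the upper end by the midpoint $s$ if $L_3\|h(s)\|_B^2\le s$, and the lower end otherwise. * *Trial of $\rho$* at $(x,v,A)$: $a=\frac{1+\sqrt{1+4L_3A\rho}}{2L_3\rho}$, $\tau=\frac a{A+a}$, $y=(1-\tau)x+\tau v$, $x'=\mathsf{ApproxAuxMin}(y)$, $\hat\zeta=\|x'-y\|_B^2$. * $\mathsf{RhoSearch}(x,v,A)$. Let $\delta=6(\varepsilon_{aam}/L_3)^{1/4}(\rho^+)^{1/2}+(12\varepsilon_{aam}/L_3)^{1/2}$. Perform at most $M$ bisection steps on $[\rho^-,\rho^+]$: try the midpoint $\hat\rho$;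 if $\hat\rho>\hat\zeta+\delta$ it becomes the upper end; if $\hat\rho<\hat\zeta-\delta$ it becomes the lower end; otherwise return this trial. After $M$ steps return the trial of the current lower end. * $\mathsf{FastQuartic}(x_0)$. Let $A_0=0$ and $Q=6(\rho^+)^{1/2}/L_3^{1/4}+5/L_3^{1/2}$. For $k=0,\dots,N-1$: let $v_k=\arg\min_x\{\frac12\|x-x_0\|_B^2+\sum_{i=1}^ka_i(f(x_i)+\langle\nabla f(x_i),x-x_i\rangle)\}$, that is $v_k=x_0-B^{-1}\sum_{i=1}^ka_i\nabla f(x_i)$, and try $\rho^-$ at $(x_k,v_k,A_k)$, with result $x',\hat\zeta$. If $\rho^->(1+\varepsilon_{fs})\hat\zeta$ or $\rho^->\hat\zeta-Q\varepsilon_{aam}^{1/4}$, return $x'$. Otherwise let $x_{k+1}$ and $a_{k+1}$ be the point $x'$ and the step $a$ of the trial returned by $\mathsf{RhoSearch}(x_k,v_k,A_k)$, and $A_{k+1}=A_k+a_{k+1}$. If no return occurred, return $x_N$. * *Restarted $\mathsf{FastQuartic}$ with $S$ runs*: starting from $x_0$, run $\mathsf{FastQuartic}$ $S$ times, each time from the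 point returned by the previous run. **Initialization.** For constants $c>0$, $p,q\in\mathbb N$ and numbers $Z,\varepsilon>0$ let $\rho^-=\varepsilon/Z$, $\rho^+=\Lambda=Z$, $\varepsilon_{fs}=(\varepsilon/Z)^p$, $\varepsilon_{aam}=(\varepsilon/Z)^q$, $J=K=M=\lceil c\log(Z/\varepsilon)\rceil$ (read as $0$ if negative), $N=\lceil c\,\kappa_4^{1/5}\rceil$, where $\kappa_4=L_3/\mu_4$. **Theorem.** There are universal constants $c,C>0$ and $p,q,r\in\mathbb N$ such that the following holds for all $d$, $B$, $f$, $L_3$, $\mu_4>0$ and $x_0\in\mathbb R^d$. Suppose $f$ is $L_3$-smooth of degree $3$ and $\mu_4$-uniformly convex of degree $4$ with respect to $\|\cdot\|_B$. Then $f$ has a minimizer $x^*$, and there is a problem-dependent $Z_0>0$ (not depending on $\varepsilon$) such that for all $Z\ge Z_0$ and all $\varepsilon>0$ the restarted $\mathsf{FastQuartic}$ from $x_0$, with the above initialization and $S=\max\{0,\lceil\log_2\frac{f(x_0)-f(x^*)}\varepsilon\rceil\}$ runs ($S=0$ if $f(x_0)=f(x^*)$), returns a point $\hat x$ with $$f(\hat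 x)-f(x^*)\le\varepsilon ,$$ performs in total at most $$C\,\kappa_4^{1/5}\Bigl(1+\log^+\frac{f(x_0)-f(x^*)}{\varepsilon}\Bigr)$$ iterations of $\mathsf{FastQuartic}$, where $\log^+ t=\max\{0,\log t\}$ and $\log^+0=0$, and in each of these iterations makes at most $C\log^r(Z/\varepsilon)$ calls to the gradient oracle and at most $C\log^r(Z/\varepsilon)$ calls to the linear system solver. -/

import Mathlib

open Matrix

noncomputable section

/-- Points of `ℝ^d`. All quantitative statements use the norm `‖·‖_B` below; the (topological) notion
of differentiability does not depend on the norm chosen on `ℝ^d`. -/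
abbrev Vec (d : ℕ) : Type := Fin d → ℝ

/-- `‖v‖_B ^ 2 = vᵀ B v`. -/
def normSqB {d : ℕ} (B : Matrix (Fin d) (Fin d) ℝ) (v : Vec d) : ℝ := v ⬝ᵥ (B *ᵥ v)

/-- `‖v‖_B = √(vᵀ B v)`. -/
def normB {d : ℕ} (B : Matrix (Fin d) (Fin d) ℝ) (v : Vec d) : ℝ := Real.sqrt (normSqB B v)

/-- The gradient `∇f(x)`, as a vector. -/
def gradVec {d : ℕ} (f : Vec d → ℝ) (x : Vec d) : Vec d :=
  fun i => fderiv ℝ f x (Pi.single i 1)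

/-- The Hessian `∇²f(x)`, as a matrix. -/
def hessMat {d : ℕ} (f : Vec d → ℝ) (x : Vec d) : Matrix (Fin d) (Fin d) ℝ :=
  Matrix.of fun i j => iteratedFDeriv ℝ 2 f x ![Pi.single i 1, Pi.single j 1]

/-- The vector `∇³f(x)[h]²`, whose inner product with `u` is `∇³f(x)[h, h, u]`. -/
def thirdVec {d : ℕ} (f : Vec d → ℝ) (x h : Vec d) : Vec d :=
  fun i => iteratedFDeriv ℝ 3 f x ![h, h, Pi.single i 1]

/-- `f` is `L`-smooth of degree `p` with respect to `‖·‖_B`: it is `p` times differentiable and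
`max_{‖h‖_B ≤ 1} |∇^p f(y)[h]^p - ∇^p f(x)[h]^p| ≤ L ‖y - x‖_B`
(this Lipschitz bound makes the `p`-th differential continuous, whence `ContDiff`). -/
def IsSmoothOfDegree {d : ℕ} (p : ℕ) (B : Matrix (Fin d) (Fin d) ℝ) (L : ℝ)
    (f : Vec d → ℝ) : Prop :=
  ContDiff ℝ p f ∧
    ∀ x y h : Vec d, normB B h ≤ 1 →
      |iteratedFDeriv ℝ p f y (fun _ => h) - iteratedFDeriv ℝ p f x (fun _ => h)|
        ≤ L * normB B (y - x)

/-- `f` is `μ`-uniformly convex of degree `p` with respect to `‖·‖_B`. -/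
def IsUniformlyConvexOfDegree {d : ℕ} (p : ℕ) (B : Matrix (Fin d) (Fin d) ℝ) (μ : ℝ)
    (f : Vec d → ℝ) : Prop :=
  Differentiable ℝ f ∧
    ∀ x y : Vec d,
      f x + gradVec f x ⬝ᵥ (y - x) + μ / p * normB B (y - x) ^ p ≤ f y

/-! ### Programs with oracle access to the objective, and their call counts -/

/-- A program returning a value of type `α`, which can access the objective only by
* `queryGrad y h`: a call to the gradient oracle, answered by `∇f(y)`, `∇²f(y) h`, `∇³f(y)[h]²`;
* `querySolve y s b`: a call to the linear system solver, answered by the solution `z` of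
  `(∇²f(y) + s B) z = b`;
* `queryMetric b`: a call to the linear system solver, answered by the solution `z` of `B z = b`. -/
inductive OracleProg (d : ℕ) (α : Type) : Type
  | ret (a : α) : OracleProg d α
  | queryGrad (y h : Vec d) (k : Vec d × Vec d × Vec d → OracleProg d α) : OracleProg d α
  | querySolve (y : Vec d) (s : ℝ) (b : Vec d) (k : Vec d → OracleProg d α) : OracleProg d α
  | queryMetric (b : Vec d) (k : Vec d → OracleProg d α) : OracleProg d α

namespace OracleProg

/-- Sequential composition. -/
def bind {d : ℕ} {α β : Type} : OracleProg d α → (α → OracleProg d β) → OracleProg d β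
  | ret a, g => g a
  | queryGrad y h k, g => queryGrad y h fun r => (k r).bind g
  | querySolve y s b k, g => querySolve y s b fun r => (k r).bind g
  | queryMetric b k, g => queryMetric b fun r => (k r).bind g

instance {d : ℕ} : Monad (OracleProg d) where
  pure := ret
  bind := bind

end OracleProg

/-- Numbers of calls to the gradient oracle and to the linear system solver. -/
structure Calls where
  grad : ℕ
  solver : ℕ

/-- Execution of a program on the objective `f` (and the metric `B`): the value it returns and the
calls it makes. -/
def OracleProg.run {d : ℕ} {α : Type} (f : Vec d → ℝ) (B : Matrix (Fin d) (Fin d) ℝ) :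
    OracleProg d α → α × Calls
  | .ret a => (a, ⟨0, 0⟩)
  | .queryGrad y h k =>
      let r := (k (gradVec f y, hessMat f y *ᵥ h, thirdVec f y h)).run f B
      (r.1, ⟨r.2.grad + 1, r.2.solver⟩)
  | .querySolve y s b k =>
      let r := (k ((hessMat f y + s • B)⁻¹ *ᵥ b)).run f B
      (r.1, ⟨r.2.grad, r.2.solver + 1⟩)
  | .queryMetric b k =>
      let r := (k (B⁻¹ *ᵥ b)).run f B
      (r.1, ⟨r.2.grad, r.2.solver + 1⟩)

/-- One call to the gradient oracle. -/
def askGrad {d : ℕ} (y h : Vec d) : OracleProg d (Vec d × Vec d × Vec d) :=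
  .queryGrad y h .ret

/-- One call to the linear system solver, with matrix `∇²f(y) + s B`. -/
def askSolve {d : ℕ} (y : Vec d) (s : ℝ) (b : Vec d) : OracleProg d (Vec d) :=
  .querySolve y s b .ret

/-- One call to the linear system solver, with matrix `B`. -/
def askMetric {d : ℕ} (b : Vec d) : OracleProg d (Vec d) :=
  .queryMetric b .ret

/-! ### The method -/

/-- The scalar inputs of the method. -/
structure FQParams where
  /-- the smoothness constant `L₃` -/
  L : ℝ
  /-- the lower initial bound `ρ_init⁻` -/
  rhoMinus : ℝ
  /-- the upper initial bound `ρ_init⁺` -/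
  rhoPlus : ℝ
  /-- the tolerance `ε_fs` -/
  epsFs : ℝ
  /-- the accuracy `ε_aam` asked of the auxiliary minimization -/
  epsAam : ℝ
  /-- the upper end of the interval in which the one-dimensional dual variable is searched -/
  lamMax : ℝ
  /-- number of steps of the one-dimensional minimization -/
  dualSteps : ℕ
  /-- number `K` of steps of `ApproxAuxMin` -/
  auxSteps : ℕ
  /-- number `M` of steps of `RhoSearch` -/
  rhoSteps : ℕ
  /-- number of iterations of `FastQuartic` between two restarts -/
  iters : ℕ

/-- The relative smoothness constant `1 + 1/√2` of the auxiliary function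
`Γ(h) = ⟨∇f(y), h⟩ + ½ ∇²f(y)[h]² + ⅙ ∇³f(y)[h]³ + (L/4) ‖h‖_B⁴` with respect to
`D(h) = ½ ∇²f(y)[h]² + (L/4) ‖h‖_B⁴`. -/
def relSmooth : ℝ := 1 + 1 / Real.sqrt 2

/-- The one-dimensional minimization inside an auxiliary step. With `M = relSmooth`, the minimizer of
`⟨c, h⟩ + M D(h)` is `h(s) = -M⁻¹ (∇²f(y) + s B)⁻¹ c`, where `s` minimizes over `s > 0` the convex
function `w(s) = M s² / (4 L) + ⟨(∇²f(y) + s B)⁻¹ c, c⟩ / (2 M)`. Since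
`w'(s) = (M / (2 L)) (s - L ‖h(s)‖_B²)`, the bisection below is a bisection on the sign of `w'`. It
performs the given number of steps from `lo < hi` and returns `h(hi)` for the final `hi`. -/
def dualBisection {d : ℕ} (B : Matrix (Fin d) (Fin d) ℝ) (P : FQParams) (y c : Vec d) :
    ℕ → ℝ → ℝ → OracleProg d (Vec d)
  | 0, _, hi => do
      let z ← askSolve y hi c
      return -(1 / relSmooth) • z
  | n + 1, lo, hi => do
      let s := (lo + hi) / 2
      let z ← askSolve y s c
      if P.L * normSqB B (-(1 / relSmooth) • z) ≤ s then
        dualBisection B P y c n lo s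
      else
        dualBisection B P y c n s hi

/-- One step of `ApproxAuxMin` for the auxiliary function `Γ` at `y`: from `h` it passes to (the
numerical solution of) `argmin_{h'} {⟨∇Γ(h), h' - h⟩ + M (D(h') - D(h) - ⟨∇D(h), h' - h⟩)}`. -/
def auxStep {d : ℕ} (B : Matrix (Fin d) (Fin d) ℝ) (P : FQParams) (y h : Vec d) :
    OracleProg d (Vec d) := do
  let (g, Hh, T) ← askGrad y h
  let gradD := Hh + (P.L * normSqB B h) • (B *ᵥ h)
  let gradGamma := g + Hh + (1 / 2 : ℝ) • T + (P.L * normSqB B h) • (B *ᵥ h)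
  dualBisection B P y (gradGamma - relSmooth • gradD) P.dualSteps 0 P.lamMax

/-- The loop of `ApproxAuxMin`. -/
def auxLoop {d : ℕ} (B : Matrix (Fin d) (Fin d) ℝ) (P : FQParams) (y : Vec d) :
    ℕ → Vec d → OracleProg d (Vec d)
  | 0, h => return h
  | n + 1, h => do
      let h' ← auxStep B P y h
      auxLoop B P y n h'

/-- `ApproxAuxMin`: an approximate minimizer of
`Ω_{y,B}(z) = f(y) + ∑_{i ≤ 3} ∇^i f(y)[z - y]^i / i! + (L/4) ‖z - y‖_B⁴`. -/
def approxAuxMin {d : ℕ} (B : Matrix (Fin d) (Fin d) ℝ) (P : FQParams) (y : Vec d) :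
    OracleProg d (Vec d) := do
  let h ← auxLoop B P y P.auxSteps 0
  return y + h

/-- The outcome of trying a value `ρ`. -/
structure Trial (d : ℕ) where
  /-- the step `a_{k+1}` -/
  a : ℝ
  /-- the candidate `x_{k+1}` -/
  x : Vec d
  /-- the value `‖x_{k+1} - y_k‖_B²` -/
  zeta : ℝ

/-- Try a value `ρ`: `a = (1 + √(1 + 4 L A ρ)) / (2 L ρ)`, `τ = a / (A + a)`,
`y = (1 - τ) x + τ v`, and the candidate is `ApproxAuxMin(y)`. -/
def tryRho {d : ℕ} (B : Matrix (Fin d) (Fin d) ℝ) (P : FQParams) (x v : Vec d) (A ρ : ℝ) :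
    OracleProg d (Trial d) := do
  let a := (1 + Real.sqrt (1 + 4 * P.L * A * ρ)) / (2 * P.L * ρ)
  let τ := a / (A + a)
  let y := (1 - τ) • x + τ • v
  let x' ← approxAuxMin B P y
  return ⟨a, x', normSqB B (x' - y)⟩

/-- The tolerance `δ` of `RhoSearch`. -/
def rhoTol (P : FQParams) : ℝ :=
  6 * (P.epsAam / P.L) ^ (1 / 4 : ℝ) * P.rhoPlus ^ (1 / 2 : ℝ)
    + (12 * P.epsAam / P.L) ^ (1 / 2 : ℝ)

/-- `RhoSearch`, with the given number of bisection steps left and the current bounds `ρ⁻`, `ρ⁺`. -/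
def rhoSearch {d : ℕ} (B : Matrix (Fin d) (Fin d) ℝ) (P : FQParams) (x v : Vec d) (A : ℝ) :
    ℕ → ℝ → ℝ → OracleProg d (Trial d)
  | 0, lo, _ => tryRho B P x v A lo
  | n + 1, lo, hi => do
      let ρ := (lo + hi) / 2
      let t ← tryRho B P x v A ρ
      if t.zeta + rhoTol P < ρ then
        rhoSearch B P x v A n lo ρ
      else if ρ < t.zeta - rhoTol P then
        rhoSearch B P x v A n ρ hi
      else
        return t

/-- The quantity `Q`. -/
def qConst (P : FQParams) : ℝ :=
  6 * P.rhoPlus ^ (1 / 2 : ℝ) / P.L ^ (1 / 4 : ℝ) + 5 / P.L ^ (1 / 2 : ℝ)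

/-- The state of `FastQuartic`: the iterate `x_k`, the number `A_k`, and
`G_k = ∑_{1 ≤ i ≤ k} a_i ∇f(x_i)`. -/
structure FQState (d : ℕ) where
  x : Vec d
  A : ℝ
  G : Vec d

/-- One iteration of `FastQuartic` started at `x₀`. It either ends the method by returning a point
(`Sum.inl`) or passes to the next state (`Sum.inr`). The point
`v_k = x₀ - B⁻¹ G_k` is the minimizer of the estimate function
`ψ_k(x) = ½ ‖x - x₀‖_B² + ∑_{1 ≤ i ≤ k} a_i (f(x_i) + ⟨∇f(x_i), x - x_i⟩)`. -/
def fastQuarticStep {d : ℕ} (B : Matrix (Fin d) (Fin d) ℝ) (P : FQParams) (x₀ : Vec d)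
    (S : FQState d) : OracleProg d (Vec d ⊕ FQState d) := do
  let w ← askMetric S.G
  let v := x₀ - w
  let t ← tryRho B P S.x v S.A P.rhoMinus
  if (1 + P.epsFs) * t.zeta < P.rhoMinus
      ∨ t.zeta - qConst P * P.epsAam ^ (1 / 4 : ℝ) < P.rhoMinus then
    return Sum.inl t.x
  else
    let u ← rhoSearch B P S.x v S.A P.rhoSteps P.rhoMinus P.rhoPlus
    let (g, _, _) ← askGrad u.x 0
    return Sum.inr ⟨u.x, S.A + u.a, S.G + u.a • g⟩

/-- At most the given number of iterations of `FastQuartic` on `f`, from the state `S`: the point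
returned, and the list of the calls made in each of the iterations performed. -/
def fastQuarticLoop {d : ℕ} (f : Vec d → ℝ) (B : Matrix (Fin d) (Fin d) ℝ) (P : FQParams)
    (x₀ : Vec d) : ℕ → FQState d → Vec d × List Calls
  | 0, S => (S.x, [])
  | n + 1, S =>
      match (fastQuarticStep B P x₀ S).run f B with
      | (Sum.inl x, c) => (x, [c])
      | (Sum.inr S', c) =>
          let r := fastQuarticLoop f B P x₀ n S'
          (r.1, c :: r.2)

/-- `FastQuartic` from `x₀`, run for `P.iters` iterations. -/
def fastQuartic {d : ℕ} (f : Vec d → ℝ) (B : Matrix (Fin d) (Fin d) ℝ) (P : FQParams)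
    (x₀ : Vec d) : Vec d × List Calls :=
  fastQuarticLoop f B P x₀ P.iters ⟨x₀, 0, 0⟩

/-- `FastQuartic` run the given number of times, each time from the point returned by the previous
run: the final point, and the calls made in each of all the iterations performed. -/
def restartedFastQuartic {d : ℕ} (f : Vec d → ℝ) (B : Matrix (Fin d) (Fin d) ℝ) (P : FQParams) :
    ℕ → Vec d → Vec d × List Calls
  | 0, x => (x, [])
  | n + 1, x =>
      let r := fastQuartic f B P x
      let r' := restartedFastQuartic f B P n r.1
      (r'.1, r.2 ++ r'.2)

/-- The initialization of the method for the target accuracy `ε`: apart from `L₃` and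
`κ₄ = L₃ / μ₄` it uses only one number `Z`, an upper bound on the scales of the problem. The tolerances
are powers of `ε / Z`, the three inner loops have `O(log (Z / ε))` steps, and
there are `O(κ₄^{1/5})` iterations between two restarts. -/
def initParams (c : ℝ) (p q : ℕ) (L μ Z ε : ℝ) : FQParams where
  L := L
  rhoMinus := ε / Z
  rhoPlus := Z
  epsFs := (ε / Z) ^ p
  epsAam := (ε / Z) ^ q
  lamMax := Z
  dualSteps := ⌈c * Real.log (Z / ε)⌉₊
  auxSteps := ⌈c * Real.log (Z / ε)⌉₊
  rhoSteps := ⌈c * Real.log (Z / ε)⌉₊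
  iters := ⌈c * (L / μ) ^ (1 / 5 : ℝ)⌉₊

end

/-! The method is an accelerated proximal point method whose proximal steps are third-order tensor
steps.

Outer iteration. If `h` is almost stationary for the auxiliary function at `y`, then ∇f(y+h) ≈
-L‖h‖²Bh, so y+h is an inexact proximal point with weight L‖h‖². Once the search has made ρ ≈ ‖h‖²,
the relation Lρa² = A + a and convexity show that the potential A(f(x) - f*) + ½‖v - x*‖² drops by
at least (3/16)A'Lρ², where A' = A + a (`potential_decrease`). This bounds the sum of the quantities
L²A'ρ². The increase of A^{1/4} in one iteration is at least 1/(4X) with X⁴ = L²A'ρ², and a tangent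
line to this convex function of X⁴ converts the bounded sum into A_N^{1/4} ≥ N/(4X₀)
(`le_fourth_root_add`, `LoopInvariant.sub_le`). Hence f(x_N) - f* is of order Lr⁴/N⁵, where r bounds
the initial distance to x*. Uniform convexity gives r⁴ = 4Δ/μ from an initial gap Δ, so N of order
κ₄^{1/5} halves the gap, and S restarts reach ε.

Auxiliary problem. Nonnegativity of the Hessian at y ± √2h bounds ∇³f(y)[h,u,u] by ∇²f(y)[u]² +
L‖h‖²‖u‖², up to the factor 1/√2 (`abs_tri_le`). So Γ is smooth and strongly convex relative to D
with constants 1 ± 1/√2, and the Bregman steps converge linearly. The smoothness hypothesis speaks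
only of ∇³f[h]³; Banach's theorem on symmetric trilinear forms transfers it to [h,u,u] without loss.

Errors. A number P dominates the scales of the problem on a ball containing all iterates, and η =
ε/Z is so small that P²⁰η ≤ 1; each inexactness is a power of η that absorbs the powers of P
multiplying it. The search for ρ succeeds because the displacement depends continuously on ρ. If the
trial of ρ⁻ = η already has a small displacement, the gradient there is so small that the point is
ε-optimal and may be returned. -/

/-! ### The inner product of the metric -/

section Metric

variable {d : ℕ} {B : Matrix (Fin d) (Fin d) ℝ}

/-- The inner product `⟨u, v⟩_B = uᵀ B v`. -/
def ipB (B : Matrix (Fin d) (Fin d) ℝ) (u v : Vec d) : ℝ := u ⬝ᵥ (B *ᵥ v)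

theorem normSqB_eq_ipB (v : Vec d) : normSqB B v = ipB B v v := rfl

theorem ipB_add_left (u v w : Vec d) : ipB B (u + v) w = ipB B u w + ipB B v w := by
  simp [ipB, add_dotProduct]

theorem ipB_add_right (u v w : Vec d) : ipB B u (v + w) = ipB B u v + ipB B u w := by
  simp [ipB, mulVec_add, dotProduct_add]

theorem ipB_smul_left (t : ℝ) (u v : Vec d) : ipB B (t • u) v = t * ipB B u v := by
  simp [ipB]

theorem ipB_smul_right (t : ℝ) (u v : Vec d) : ipB B u (t • v) = t * ipB B u v := by
  simp [ipB, mulVec_smul]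

theorem normSqB_smul (t : ℝ) (v : Vec d) : normSqB B (t • v) = t ^ 2 * normSqB B v := by
  rw [normSqB_eq_ipB, ipB_smul_left, ipB_smul_right, normSqB_eq_ipB]; ring

theorem normSqB_neg (v : Vec d) : normSqB B (-v) = normSqB B v := by
  rw [← neg_one_smul ℝ v, normSqB_smul]; ring

theorem normB_neg (v : Vec d) : normB B (-v) = normB B v := by
  rw [normB, normB, normSqB_neg]

theorem normB_sub_comm (u v : Vec d) : normB B (u - v) = normB B (v - u) := by
  rw [← neg_sub, normB_neg]

theorem normB_nonneg (v : Vec d) : 0 ≤ normB B v := Real.sqrt_nonneg _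

theorem normSqB_zero : normSqB B (0 : Vec d) = 0 := by simp [normSqB]

theorem normB_zero : normB B (0 : Vec d) = 0 := by simp [normB, normSqB]

theorem normB_smul (t : ℝ) (v : Vec d) : normB B (t • v) = |t| * normB B v := by
  rw [normB, normSqB_smul, Real.sqrt_mul (sq_nonneg t), Real.sqrt_sq_eq_abs, normB]

theorem dotProduct_mulVec_comm_of_isHermitian {H : Matrix (Fin d) (Fin d) ℝ}
    (hH : H.IsHermitian) (u v : Vec d) : u ⬝ᵥ (H *ᵥ v) = v ⬝ᵥ (H *ᵥ u) := by
  have hT : Hᵀ = H := by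
    rw [← conjTranspose_eq_transpose_of_trivial]
    exact hH
  rw [dotProduct_mulVec, ← mulVec_transpose, hT, dotProduct_comm]

theorem ipB_comm (hB : B.PosDef) (u v : Vec d) : ipB B u v = ipB B v u :=
  dotProduct_mulVec_comm_of_isHermitian hB.isHermitian u v

theorem normSqB_pos (hB : B.PosDef) {v : Vec d} (hv : v ≠ 0) : 0 < normSqB B v := by
  simpa [normSqB] using hB.dotProduct_mulVec_pos hv

theorem normSqB_nonneg (hB : B.PosDef) (v : Vec d) : 0 ≤ normSqB B v := by
  by_cases hv : v = 0
  · simp [hv, normSqB]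
  · exact (normSqB_pos hB hv).le

theorem normB_sq (hB : B.PosDef) (v : Vec d) : normB B v ^ 2 = normSqB B v :=
  Real.sq_sqrt (normSqB_nonneg hB v)

theorem normB_pos (hB : B.PosDef) {v : Vec d} (hv : v ≠ 0) : 0 < normB B v :=
  Real.sqrt_pos.2 (normSqB_pos hB hv)

theorem normSqB_add (hB : B.PosDef) (u v : Vec d) :
    normSqB B (u + v) = normSqB B u + 2 * ipB B u v + normSqB B v := by
  simp only [normSqB_eq_ipB, ipB_add_left, ipB_add_right]
  rw [ipB_comm hB v u]; ring

theorem ipB_sq_le (hB : B.PosDef) (u v : Vec d) :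
    ipB B u v ^ 2 ≤ normSqB B u * normSqB B v := by
  by_cases hv : v = 0
  · simp [hv, ipB, normSqB]
  have hp := normSqB_pos hB hv
  have h := normSqB_nonneg hB (normSqB B v • u + (-ipB B u v) • v)
  rw [normSqB_add hB, normSqB_smul, normSqB_smul, ipB_smul_left, ipB_smul_right] at h
  nlinarith

theorem abs_ipB_le (hB : B.PosDef) (u v : Vec d) :
    |ipB B u v| ≤ normB B u * normB B v := by
  apply abs_le_of_sq_le_sq _ (mul_nonneg (normB_nonneg _) (normB_nonneg _))
  rw [mul_pow, normB_sq hB, normB_sq hB]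
  exact ipB_sq_le hB u v

theorem normB_add_le (hB : B.PosDef) (u v : Vec d) :
    normB B (u + v) ≤ normB B u + normB B v := by
  apply le_of_sq_le_sq _ (add_nonneg (normB_nonneg _) (normB_nonneg _))
  rw [normB_sq hB, normSqB_add hB, ← normB_sq hB u, ← normB_sq hB v]
  nlinarith [(abs_le.1 (abs_ipB_le hB u v)).2]

theorem normB_sub_le (hB : B.PosDef) (u v : Vec d) :
    normB B (u - v) ≤ normB B u + normB B v := by
  rw [sub_eq_add_neg, ← normB_neg v]
  exact normB_add_le hB u (-v)

theorem normB_sub_le_add (hB : B.PosDef) (u v w : Vec d) :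
    normB B (u - w) ≤ normB B (u - v) + normB B (v - w) := by
  simpa using normB_add_le hB (u - v) (v - w)

/-- The i-th coordinate of v is ⟨v, B⁻¹eᵢ⟩_B, so Cauchy–Schwarz applies. The comparison makes balls
of ‖·‖_B compact and operator norm bounds usable. -/
theorem exists_abs_apply_le_normB (hB : B.PosDef) :
    ∃ C : ℝ, 0 < C ∧ ∀ v : Vec d, ‖v‖ ≤ C * normB B v := by
  have hu : IsUnit B.det := (Matrix.isUnit_iff_isUnit_det B).1 hB.isUnit
  let e : Fin d → Vec d := fun i => B⁻¹ *ᵥ Pi.single i 1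
  refine ⟨∑ i, normB B (e i) + 1,
    add_pos_of_nonneg_of_pos (Finset.sum_nonneg fun i _ => normB_nonneg _) one_pos, fun v => ?_⟩
  refine (pi_norm_le_iff_of_nonneg (mul_nonneg
    (add_nonneg (Finset.sum_nonneg fun i _ => normB_nonneg _) zero_le_one) (normB_nonneg _))).2
    fun i => ?_
  have h1 : v i = ipB B v (e i) := by
    rw [ipB, mulVec_mulVec, Matrix.mul_nonsing_inv B hu, one_mulVec, dotProduct_single_one]
  rw [Real.norm_eq_abs, h1, mul_comm]
  refine (abs_ipB_le hB _ _).trans (mul_le_mul_of_nonneg_left ?_ (normB_nonneg _))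
  have := Finset.single_le_sum (f := fun i => normB B (e i)) (fun i _ => normB_nonneg _)
    (Finset.mem_univ i)
  linarith

theorem continuous_normB : Continuous (normB B) := by
  unfold normB normSqB
  fun_prop

theorem isCompact_normB_sub_le (hB : B.PosDef) (x : Vec d) (R : ℝ) :
    IsCompact {y : Vec d | normB B (y - x) ≤ R} := by
  obtain ⟨C, hC, h⟩ := exists_abs_apply_le_normB hB
  refine Metric.isCompact_of_isClosed_isBounded
    (isClosed_le (continuous_normB.comp (continuous_id.sub continuous_const)) continuous_const)
    ((Metric.isBounded_closedBall (x := x) (r := C * R)).subset fun y hy => ?_)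
  rw [Metric.mem_closedBall, dist_eq_norm]
  exact (h _).trans (mul_le_mul_of_nonneg_left hy hC.le)

/-! ### Banach's bound for symmetric trilinear forms -/

/-- Symmetric trilinear forms. -/
structure IsSymmTrilinear (S : Vec d → Vec d → Vec d → ℝ) : Prop where
  add_left : ∀ a a' b c, S (a + a') b c = S a b c + S a' b c
  smul_left : ∀ (t : ℝ) a b c, S (t • a) b c = t * S a b c
  swap_left : ∀ a b c, S a b c = S b a c
  swap_right : ∀ a b c, S a b c = S a c b

theorem abs_le_of_weighted_sum {a₀ a₁ a₂ W₀ W₁ W₂ X M : ℝ} (h₀ : 0 ≤ a₀) (h₁ : 0 ≤ a₁)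
    (h₂ : 0 ≤ a₂) (ha : a₀ + a₁ + a₂ = 9) (hX : 9 * X = a₀ * W₀ - a₁ * W₁ + a₂ * W₂)
    (w₀ : |W₀| ≤ M) (w₁ : |W₁| ≤ M) (w₂ : |W₂| ≤ M) : |X| ≤ M := by
  obtain rfl : a₂ = 9 - a₀ - a₁ := by linarith
  rw [abs_le] at w₀ w₁ w₂ ⊢
  have := mul_le_mul_of_nonneg_left w₀.1 h₀
  have := mul_le_mul_of_nonneg_left w₀.2 h₀
  have := mul_le_mul_of_nonneg_left w₁.1 h₁
  have := mul_le_mul_of_nonneg_left w₁.2 h₁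
  have := mul_le_mul_of_nonneg_left w₂.1 h₂
  have := mul_le_mul_of_nonneg_left w₂.2 h₂
  constructor <;> linarith

namespace IsSymmTrilinear

variable {S : Vec d → Vec d → Vec d → ℝ} (hS : IsSymmTrilinear S)
include hS

theorem add_mid (a b b' c : Vec d) : S a (b + b') c = S a b c + S a b' c := by
  rw [hS.swap_left, hS.add_left, hS.swap_left b, hS.swap_left b']

theorem smul_mid (t : ℝ) (a b c : Vec d) : S a (t • b) c = t * S a b c := by
  rw [hS.swap_left, hS.smul_left, hS.swap_left b]

theorem add_right (a b c c' : Vec d) : S a b (c + c') = S a b c + S a b c' := by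
  rw [hS.swap_right, hS.add_mid, hS.swap_right a c, hS.swap_right a c']

theorem smul_right (t : ℝ) (a b c : Vec d) : S a b (t • c) = t * S a b c := by
  rw [hS.swap_right, hS.smul_mid, hS.swap_right a c]

theorem sub {S' : Vec d → Vec d → Vec d → ℝ} (hS' : IsSymmTrilinear S') :
    IsSymmTrilinear fun a b c => S a b c - S' a b c where
  add_left a a' b c := by rw [hS.add_left, hS'.add_left]; ring
  smul_left t a b c := by rw [hS.smul_left, hS'.smul_left]; ring
  swap_left a b c := by rw [hS.swap_left, hS'.swap_left]
  swap_right a b c := by rw [hS.swap_right, hS'.swap_right]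

theorem diag_combination (x y : ℝ) (a b : Vec d) :
    S (x • a + y • b) (x • a + y • b) (x • a + y • b)
      = x ^ 3 * S a a a + 3 * x ^ 2 * y * S a a b + 3 * x * y ^ 2 * S a b b + y ^ 3 * S b b b := by
  simp only [hS.add_left, hS.add_mid, hS.add_right, hS.smul_left, hS.smul_mid, hS.smul_right]
  rw [hS.swap_right a b a, hS.swap_left b a a, hS.swap_right a b a, hS.swap_left b a b,
    hS.swap_right b b a, hS.swap_left b a b]
  ring

/-- The case of unit vectors at angle `3 α`. -/
theorem abs_apply_le_of_angle (hB : B.PosDef) {M : ℝ}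
    (hM : ∀ w, normB B w ≤ 1 → |S w w w| ≤ M) {e₁ e₂ : Vec d} (h₁ : normSqB B e₁ = 1)
    (h₂ : normSqB B e₂ ≤ 1) (h₁₂ : ipB B e₁ e₂ = 0) (α : ℝ) :
    |S (Real.cos (3 * α) • e₁ + Real.sin (3 * α) • e₂) e₁ e₁| ≤ M := by
  have hw : ∀ x y : ℝ, x ^ 2 + y ^ 2 = 1 → |S (x • e₁ + y • e₂) (x • e₁ + y • e₂)
      (x • e₁ + y • e₂)| ≤ M := by
    intro x y hxy
    refine hM _ (Real.sqrt_le_one.2 ?_)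
    rw [normSqB_add hB, normSqB_smul, normSqB_smul, ipB_smul_left, ipB_smul_right, h₁, h₁₂]
    nlinarith [sq_nonneg y]
  rw [hS.add_left, hS.smul_left, hS.smul_left, Real.cos_three_mul, Real.sin_three_mul]
  have hcs := Real.cos_sq_add_sin_sq α
  set C := Real.cos α
  set s := Real.sin α
  obtain ⟨k, hk0, hk⟩ : ∃ k : ℝ, 0 ≤ k ∧ k ^ 2 = 3 := ⟨√3, Real.sqrt_nonneg _, by norm_num⟩
  -- The unit vectors at the angles θ = α, α + π/3, α + 2π/3. The weights (4cos²θ - 1)² = (1 + 2cos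
  -- 2θ)² sum to 9, and the alternating weighted sum of the cubic form at these points recovers 9
  -- times the mixed value.
  have w0 := hw C s hcs
  have w1 := hw (C / 2 - k / 2 * s) (s / 2 + k / 2 * C) (by linear_combination hcs * (1 + k ^ 2) / 4 + hk / 4)
  have w2 := hw (-C / 2 - k / 2 * s) (-s / 2 + k / 2 * C)
    (by linear_combination hcs * (1 + k ^ 2) / 4 + hk / 4)
  rw [hS.diag_combination] at w0 w1 w2
  rw [hS.swap_left e₂ e₁ e₁, hS.swap_right e₁ e₂ e₁]
  have hs2 : s ^ 2 = 1 - C ^ 2 := by linarith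
  obtain ⟨x₁, hx₁⟩ : ∃ x, x = C / 2 - k / 2 * s := ⟨_, rfl⟩
  obtain ⟨x₂, hx₂⟩ : ∃ x, x = -C / 2 - k / 2 * s := ⟨_, rfl⟩
  obtain ⟨y₁, hy₁⟩ : ∃ x, x = s / 2 + k / 2 * C := ⟨_, rfl⟩
  obtain ⟨y₂, hy₂⟩ : ∃ x, x = -s / 2 + k / 2 * C := ⟨_, rfl⟩
  rw [← hx₁, ← hy₁] at w1
  rw [← hx₂, ← hy₂] at w2
  have i0 : (4 * C ^ 2 - 1) ^ 2 + (4 * x₁ ^ 2 - 1) ^ 2 + (4 * x₂ ^ 2 - 1) ^ 2 = 9 := by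
    grind
  have i1 : (4 * C ^ 2 - 1) ^ 2 * C ^ 3 - (4 * x₁ ^ 2 - 1) ^ 2 * x₁ ^ 3
      + (4 * x₂ ^ 2 - 1) ^ 2 * x₂ ^ 3 = 9 * (4 * C ^ 3 - 3 * C) := by
    grind
  have i2 : (4 * C ^ 2 - 1) ^ 2 * (3 * C ^ 2 * s) - (4 * x₁ ^ 2 - 1) ^ 2 * (3 * x₁ ^ 2 * y₁)
      + (4 * x₂ ^ 2 - 1) ^ 2 * (3 * x₂ ^ 2 * y₂) = 9 * (3 * s - 4 * s ^ 3) := by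
    grind
  have i3 : (4 * C ^ 2 - 1) ^ 2 * (3 * C * s ^ 2) - (4 * x₁ ^ 2 - 1) ^ 2 * (3 * x₁ * y₁ ^ 2)
      + (4 * x₂ ^ 2 - 1) ^ 2 * (3 * x₂ * y₂ ^ 2) = 0 := by
    grind
  have i4 : (4 * C ^ 2 - 1) ^ 2 * s ^ 3 - (4 * x₁ ^ 2 - 1) ^ 2 * y₁ ^ 3
      + (4 * x₂ ^ 2 - 1) ^ 2 * y₂ ^ 3 = 0 := by
    grind
  set W₀ := C ^ 3 * S e₁ e₁ e₁ + 3 * C ^ 2 * s * S e₁ e₁ e₂ + 3 * C * s ^ 2 * S e₁ e₂ e₂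
    + s ^ 3 * S e₂ e₂ e₂ with hW₀
  set W₁ := x₁ ^ 3 * S e₁ e₁ e₁ + 3 * x₁ ^ 2 * y₁ * S e₁ e₁ e₂ + 3 * x₁ * y₁ ^ 2 * S e₁ e₂ e₂
    + y₁ ^ 3 * S e₂ e₂ e₂ with hW₁
  set W₂ := x₂ ^ 3 * S e₁ e₁ e₁ + 3 * x₂ ^ 2 * y₂ * S e₁ e₁ e₂ + 3 * x₂ * y₂ ^ 2 * S e₁ e₂ e₂
    + y₂ ^ 3 * S e₂ e₂ e₂ with hW₂
  have key : 9 * ((4 * C ^ 3 - 3 * C) * S e₁ e₁ e₁ + (3 * s - 4 * s ^ 3) * S e₁ e₁ e₂)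
      = (4 * C ^ 2 - 1) ^ 2 * W₀ - (4 * x₁ ^ 2 - 1) ^ 2 * W₁ + (4 * x₂ ^ 2 - 1) ^ 2 * W₂ := by
    rw [hW₀, hW₁, hW₂]
    linear_combination -S e₁ e₁ e₁ * i1 - S e₁ e₁ e₂ * i2 - S e₁ e₂ e₂ * i3 - S e₂ e₂ e₂ * i4
  exact abs_le_of_weighted_sum (sq_nonneg _) (sq_nonneg _) (sq_nonneg _) i0 key w0 w1 w2

/-- In the plane of the two vectors, h is u turned by an angle 3α, where cos 3α = ⟨h, u⟩_B. -/
theorem abs_apply_le_of_unit (hB : B.PosDef) {M : ℝ}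
    (hM : ∀ w, normB B w ≤ 1 → |S w w w| ≤ M) {h u : Vec d} (hh : normSqB B h = 1)
    (hu : normSqB B u = 1) : |S h u u| ≤ M := by
  set p := ipB B h u with hp
  have hp1 : p ^ 2 ≤ 1 := by simpa [hh, hu] using ipB_sq_le hB h u
  have hp2 := abs_le.1 (abs_le_one_iff_mul_self_le_one.2 (by nlinarith) : |p| ≤ 1)
  set α := Real.arccos p / 3 with hα
  have hc : Real.cos (3 * α) = p := by
    rw [hα, mul_div_cancel₀ _ (by norm_num : (3 : ℝ) ≠ 0), Real.cos_arccos hp2.1 hp2.2]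
  have hs := Real.sin_sq_add_cos_sq (3 * α)
  set s := Real.sin (3 * α)
  rw [hc] at hs
  have hr : normSqB B (h - p • u) = s ^ 2 := by
    rw [sub_eq_add_neg, ← neg_smul, normSqB_add hB, normSqB_smul, ipB_smul_right, ← hp, hh, hu]
    linarith
  have hru : ipB B u (h - p • u) = 0 := by
    rw [sub_eq_add_neg, ← neg_smul, ipB_add_right, ipB_smul_right, ipB_comm hB u h, ← hp,
      ← normSqB_eq_ipB, hu]
    ring
  -- If h = ±u then s = 0 and the second vector is zero, since `s⁻¹ = 0`. This is why the second
  -- vector was only required to have norm at most 1.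
  have hdec : h = Real.cos (3 * α) • u + Real.sin (3 * α) • (s⁻¹ • (h - p • u)) := by
    rw [hc]
    by_cases h0 : s = 0
    · have : h - p • u = 0 := by
        by_contra hne
        have := normSqB_pos hB hne
        rw [hr, h0] at this
        norm_num at this
      rw [this]
      simpa [sub_eq_zero] using this
    · change h = p • u + s • (s⁻¹ • (h - p • u))
      rw [smul_smul, mul_inv_cancel₀ h0, one_smul]
      abel
  rw [hdec]
  refine hS.abs_apply_le_of_angle hB hM hu ?_ ?_ α
  · rw [normSqB_smul, hr, ← mul_pow]
    by_cases h0 : s = 0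
    · simp [h0]
    · rw [inv_mul_cancel₀ h0]; norm_num
  · rw [ipB_smul_right, hru, mul_zero]

/-- By homogeneity it suffices to treat unit vectors. Plain polarization would cost a constant
factor, whereas here the diagonal bound carries over with the same M. -/
theorem abs_apply_le (hB : B.PosDef) {M : ℝ}
    (hM : ∀ w, normB B w ≤ 1 → |S w w w| ≤ M) (h u : Vec d) :
    |S h u u| ≤ M * normB B h * normB B u ^ 2 := by
  have hz : ∀ a b, S 0 a b = 0 := fun a b => by simpa using hS.smul_left 0 0 a b
  by_cases h0 : h = 0
  · simp [h0, hz, normB_zero]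
  by_cases u0 : u = 0
  · simp [u0, hS.swap_left h, hz, normB_zero]
  have ph := normB_pos hB h0
  have pu := normB_pos hB u0
  have n1 : ∀ {v : Vec d}, 0 < normB B v → normSqB B ((normB B v)⁻¹ • v) = 1 := by
    intro v hv
    rw [normSqB_smul, ← normB_sq hB v, ← mul_pow, inv_mul_cancel₀ hv.ne', one_pow]
  have := hS.abs_apply_le_of_unit hB hM (n1 ph) (n1 pu)
  rw [hS.smul_left, hS.smul_mid, hS.smul_right, abs_mul, abs_mul, abs_mul,
    abs_of_pos (inv_pos.2 ph), abs_of_pos (inv_pos.2 pu)] at this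
  calc |S h u u| = normB B h * normB B u ^ 2 *
        ((normB B h)⁻¹ * ((normB B u)⁻¹ * ((normB B u)⁻¹ * |S h u u|))) := by
        field_simp
    _ ≤ normB B h * normB B u ^ 2 * M := by gcongr
    _ = _ := by ring

end IsSymmTrilinear

end Metric

/-! ### Taylor expansions of functions with Lipschitz third derivative -/

section Calculus

variable {d : ℕ} {B : Matrix (Fin d) (Fin d) ℝ} {f : Vec d → ℝ} {L μ : ℝ}

/-- The second differential. -/
noncomputable def snd (f : Vec d → ℝ) (x a b : Vec d) : ℝ := fderiv ℝ (fderiv ℝ f) x a b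

/-- The third differential. -/
noncomputable def tri (f : Vec d → ℝ) (x a b c : Vec d) : ℝ :=
  fderiv ℝ (fderiv ℝ (fderiv ℝ f)) x a b c

theorem apply_single_dotProduct (φ : Vec d →ₗ[ℝ] ℝ) (u : Vec d) :
    (fun i => φ (Pi.single i 1)) ⬝ᵥ u = φ u := by
  conv_rhs => rw [← Finset.univ_sum_single u, map_sum]
  refine Finset.sum_congr rfl fun i _ => ?_
  rw [show Pi.single i (u i) = u i • (Pi.single i 1 : Vec d) by
    rw [← Pi.single_smul, smul_eq_mul, mul_one], map_smul, smul_eq_mul, mul_comm]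

theorem gradVec_dotProduct (f : Vec d → ℝ) (x u : Vec d) : gradVec f x ⬝ᵥ u = fderiv ℝ f x u :=
  apply_single_dotProduct (fderiv ℝ f x).toLinearMap u

theorem dotProduct_hessMat_mulVec (f : Vec d → ℝ) (x u v : Vec d) :
    u ⬝ᵥ (hessMat f x *ᵥ v) = snd f x u v := by
  have h1 : hessMat f x *ᵥ v = fun i => snd f x (Pi.single i 1) v := by
    ext i
    refine Eq.trans ?_ (apply_single_dotProduct
      (fderiv ℝ (fderiv ℝ f) x (Pi.single i 1)).toLinearMap v)
    simp [mulVec, hessMat, iteratedFDeriv_two_apply, dotProduct]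
  rw [h1, dotProduct_comm]
  exact apply_single_dotProduct
    ((LinearMap.applyₗ v).comp (ContinuousLinearMap.coeLM ℝ |>.comp
      (fderiv ℝ (fderiv ℝ f) x).toLinearMap)) u

theorem iteratedFDeriv_three_apply (f : Vec d → ℝ) (x : Vec d) (m : Fin 3 → Vec d) :
    iteratedFDeriv ℝ 3 f x m = tri f x (m 0) (m 1) (m 2) := by
  rw [iteratedFDeriv_succ_apply_right, iteratedFDeriv_two_apply]
  rfl

theorem thirdVec_dotProduct (f : Vec d → ℝ) (x h u : Vec d) :
    thirdVec f x h ⬝ᵥ u = tri f x h h u := by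
  refine Eq.trans ?_ (apply_single_dotProduct
    (fderiv ℝ (fderiv ℝ (fderiv ℝ f)) x h h).toLinearMap u)
  simp [thirdVec, iteratedFDeriv_three_apply, tri, dotProduct]

/-- Comparison with the antiderivative of the bound by monotonicity. Iterating it produces the
Taylor remainders. -/
theorem abs_le_of_abs_deriv_le_pow {φ φ' : ℝ → ℝ} {K : ℝ} (n : ℕ)
    (hφ : ∀ t, HasDerivAt φ (φ' t) t) (h0 : φ 0 = 0)
    (hK : ∀ t, 0 ≤ t → |φ' t| ≤ K * t ^ n) {t : ℝ} (ht : 0 ≤ t) :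
    |φ t| ≤ K / (n + 1) * t ^ (n + 1) := by
  have hp : ∀ s : ℝ, HasDerivAt (fun s : ℝ => K / (n + 1) * s ^ (n + 1)) (K * s ^ n) s := by
    intro s
    have := (hasDerivAt_pow (n + 1) s).const_mul (K / (n + 1 : ℝ))
    refine this.congr_deriv ?_
    have : (n + 1 : ℝ) ≠ 0 := by positivity
    push_cast
    field_simp
  have main : ∀ (g g' : ℝ → ℝ), (∀ t, HasDerivAt g (g' t) t) → g 0 = 0 →
      (∀ t, 0 ≤ t → g' t ≤ K * t ^ n) → g t ≤ K / (n + 1) * t ^ (n + 1) := by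
    intro g g' hg g0 hle
    have hd : ∀ s, HasDerivAt (fun s => g s - K / (n + 1) * s ^ (n + 1)) (g' s - K * s ^ n) s :=
      fun s => (hg s).sub (hp s)
    have hanti : AntitoneOn (fun s => g s - K / (n + 1) * s ^ (n + 1)) (Set.Ici 0) := by
      apply antitoneOn_of_deriv_nonpos (convex_Ici 0)
      · exact fun s _ => (hd s).continuousAt.continuousWithinAt
      · exact fun s _ => (hd s).differentiableAt.differentiableWithinAt
      · intro s hs
        rw [interior_Ici] at hs
        rw [(hd s).deriv]
        linarith [hle s (le_of_lt hs)]
    have := hanti (Set.mem_Ici.2 le_rfl) ht ht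
    simp only [g0] at this
    simp at this
    linarith
  rw [abs_le']
  refine ⟨main φ φ' hφ h0 fun s hs => (abs_le.1 (hK s hs)).2,
    main (fun s => -φ s) (fun s => -φ' s) (fun s => (hφ s).neg) (by simp [h0]) fun s hs => ?_⟩
  linarith [(abs_le.1 (hK s hs)).1]

namespace IsSmoothOfDegree

variable (hf : IsSmoothOfDegree 3 B L f)
include hf

theorem contDiff_fderiv : ContDiff ℝ 2 (fderiv ℝ f) :=
  hf.1.fderiv_right (by norm_num)

theorem contDiff_fderiv_fderiv : ContDiff ℝ 1 (fderiv ℝ (fderiv ℝ f)) :=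
  (contDiff_fderiv hf).fderiv_right (by norm_num)

theorem snd_comm (x a b : Vec d) : snd f x a b = snd f x b a :=
  (hf.1.contDiffAt.isSymmSndFDerivAt (by simp; norm_num)).eq a b

theorem tri_swap_left (x a b c : Vec d) : tri f x a b c = tri f x b a c :=
  DFunLike.congr_fun
    (((contDiff_fderiv hf).contDiffAt.isSymmSndFDerivAt (by simp)).eq a b) c

theorem hasDerivAt_fderiv_line (y h u : Vec d) (t : ℝ) :
    HasDerivAt (fun t : ℝ => fderiv ℝ f (y + t • h) u) (snd f (y + t • h) h u) t := by
  have h1 : HasDerivAt (fun t : ℝ => y + t • h) h t := by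
    simpa using ((hasDerivAt_id t).smul_const h).const_add y
  have h2 := ((contDiff_fderiv hf).differentiable (by norm_num) (y + t • h)).hasFDerivAt
  have h3 := h2.comp_hasDerivAt t h1
  simpa [snd] using h3.clm_apply (hasDerivAt_const t u)

theorem hasDerivAt_snd_line (y h u v : Vec d) (t : ℝ) :
    HasDerivAt (fun t : ℝ => snd f (y + t • h) u v) (tri f (y + t • h) h u v) t := by
  have h1 : HasDerivAt (fun t : ℝ => y + t • h) h t := by
    simpa using ((hasDerivAt_id t).smul_const h).const_add y
  have h2 := ((contDiff_fderiv_fderiv hf).differentiable (by norm_num) (y + t • h)).hasFDerivAt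
  have h3 := h2.comp_hasDerivAt t h1
  simpa [snd, tri] using (h3.clm_apply (hasDerivAt_const t u)).clm_apply (hasDerivAt_const t v)

/-- Differentiate the symmetry of the Hessian along a line. -/
theorem tri_swap_right (x a b c : Vec d) : tri f x a b c = tri f x a c b := by
  have h1 := hasDerivAt_snd_line hf x a b c 0
  have h2 := hasDerivAt_snd_line hf x a c b 0
  have : (fun t : ℝ => snd f (x + t • a) b c) = fun t : ℝ => snd f (x + t • a) c b :=
    funext fun t => snd_comm hf _ _ _
  rw [this] at h1
  simpa using h1.unique h2

theorem isSymmTrilinear_tri (x : Vec d) : IsSymmTrilinear (tri f x) where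
  add_left a a' b c := by simp [tri]
  smul_left t a b c := by simp [tri]
  swap_left := tri_swap_left hf x
  swap_right := tri_swap_right hf x

theorem abs_tri_sub_le (hB : B.PosDef) (x y h u : Vec d) :
    |tri f y h u u - tri f x h u u| ≤ L * normB B (y - x) * normB B h * normB B u ^ 2 := by
  refine ((isSymmTrilinear_tri hf y).sub (isSymmTrilinear_tri hf x)).abs_apply_le hB
    (fun w hw => ?_) h u
  have := hf.2 x y w hw
  rwa [iteratedFDeriv_three_apply, iteratedFDeriv_three_apply] at this

/-- Taylor expansion of the gradient. -/
theorem abs_fderiv_add_sub_le (hB : B.PosDef) (y h u : Vec d) :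
    |fderiv ℝ f (y + h) u - fderiv ℝ f y u - snd f y h u - tri f y h h u / 2|
      ≤ L / 6 * normB B h ^ 3 * normB B u := by
  have hsnd := fun t (ht : 0 ≤ t) => abs_le_of_abs_deriv_le_pow (φ := fun t : ℝ =>
      snd f (y + t • h) h u - snd f y h u - t * tri f y h h u)
    (φ' := fun t : ℝ => tri f (y + t • h) h h u - tri f y h h u)
    (K := L * normB B h ^ 3 * normB B u) (t := t) 1
    (fun t => by
      simpa [Pi.sub_def] using ((hasDerivAt_snd_line hf y h h u t).sub_const (snd f y h u)).sub
        ((hasDerivAt_id t).mul_const (tri f y h h u)))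
    (by simp)
    (fun t ht => by
      -- The Lipschitz bound is available for [u, h, h]; symmetry brings it to [h, h, u].
      have := abs_tri_sub_le hf hB y (y + t • h) u h
      rw [tri_swap_left hf, tri_swap_right hf, tri_swap_left hf y, tri_swap_right hf y] at this
      rw [add_sub_cancel_left, normB_smul, abs_of_nonneg ht] at this
      linarith) ht
  have := abs_le_of_abs_deriv_le_pow (φ := fun t : ℝ =>
      fderiv ℝ f (y + t • h) u - fderiv ℝ f y u - t * snd f y h u - t ^ 2 / 2 * tri f y h h u)
    (φ' := fun t : ℝ => snd f (y + t • h) h u - snd f y h u - t * tri f y h h u)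
    (K := L * normB B h ^ 3 * normB B u / 2) (t := 1) 2
    (fun t => by
      have h1 := (((hasDerivAt_fderiv_line hf y h u t).sub_const (fderiv ℝ f y u)).sub
        ((hasDerivAt_id t).mul_const (snd f y h u))).sub
        (((hasDerivAt_pow 2 t).div_const 2).mul_const (tri f y h h u))
      simpa [Pi.sub_def] using h1)
    (by simp)
    (fun t ht => by
      have := hsnd t ht
      norm_num at this
      linarith) zero_le_one
  norm_num at this
  calc _ = |fderiv ℝ f (y + h) u - fderiv ℝ f y u - snd f y h u - 1 / 2 * tri f y h h u| := by
        congr 1; ring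
    _ ≤ _ := by linarith

/-- Taylor expansion of the Hessian. -/
theorem abs_snd_add_sub_le (hB : B.PosDef) (y h u : Vec d) :
    |snd f (y + h) u u - snd f y u u - tri f y h u u|
      ≤ L / 2 * normB B h ^ 2 * normB B u ^ 2 := by
  have := abs_le_of_abs_deriv_le_pow (φ := fun t : ℝ =>
      snd f (y + t • h) u u - snd f y u u - t * tri f y h u u)
    (φ' := fun t : ℝ => tri f (y + t • h) h u u - tri f y h u u)
    (K := L * normB B h ^ 2 * normB B u ^ 2) (t := 1) 1
    (fun t => by
      simpa [Pi.sub_def] using ((hasDerivAt_snd_line hf y h u u t).sub_const (snd f y u u)).sub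
        ((hasDerivAt_id t).mul_const (tri f y h u u)))
    (by simp)
    (fun t ht => by
      have := abs_tri_sub_le hf hB y (y + t • h) h u
      rw [add_sub_cancel_left, normB_smul, abs_of_nonneg ht] at this
      linarith) zero_le_one
  norm_num at this
  linarith

theorem isHermitian_hessMat (x : Vec d) : (hessMat f x).IsHermitian := by
  ext i j
  simp only [hessMat, conjTranspose_apply, of_apply, iteratedFDeriv_two_apply, star_trivial]
  exact snd_comm hf x _ _

end IsSmoothOfDegree

end Calculus

/-! ### Consequences of uniform convexity -/

section Convexity

variable {d : ℕ} {B : Matrix (Fin d) (Fin d) ℝ} {f : Vec d → ℝ} {L μ : ℝ}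

namespace IsUniformlyConvexOfDegree

variable (hc : IsUniformlyConvexOfDegree 4 B μ f)
include hc

theorem le_apply (x y : Vec d) :
    f x + fderiv ℝ f x (y - x) + μ / 4 * normB B (y - x) ^ 4 ≤ f y := by
  have := hc.2 x y
  rw [gradVec_dotProduct] at this
  exact_mod_cast this

theorem le_fderiv_sub (y h : Vec d) :
    μ / 2 * normB B h ^ 4 ≤ fderiv ℝ f (y + h) h - fderiv ℝ f y h := by
  have h1 := le_apply hc y (y + h)
  have h2 := le_apply hc (y + h) y
  simp only [add_sub_cancel_left, sub_add_cancel_left, map_neg, normB_neg] at h1 h2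
  linarith

theorem apply_add_fderiv_le (hμ : 0 < μ) (x y : Vec d) : f x + fderiv ℝ f x (y - x) ≤ f y := by
  have := le_apply hc x y
  have h4 : 0 ≤ μ / 4 * normB B (y - x) ^ 4 := by have := normB_nonneg (B := B) (y - x); positivity
  linarith

theorem snd_nonneg (hμ : 0 < μ) (hf : IsSmoothOfDegree 3 B L f) (y u : Vec d) :
    0 ≤ snd f y u u := by
  have hm : Monotone fun t : ℝ => fderiv ℝ f (y + t • u) u := by
    intro s t hst
    rcases hst.eq_or_lt with rfl | hst
    · exact le_rfl
    have h1 := le_fderiv_sub hc (y + s • u) ((t - s) • u)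
    have h2 : 0 ≤ μ / 2 * normB B ((t - s) • u) ^ 4 := by
      have := normB_nonneg (B := B) ((t - s) • u); positivity
    rw [add_assoc, ← add_smul, add_sub_cancel, map_smul, map_smul, smul_eq_mul, smul_eq_mul,
      ← mul_sub] at h1
    have h3 := nonneg_of_mul_nonneg_right (h2.trans h1) (sub_pos.2 hst)
    simpa using h3
  have := hm.deriv_nonneg (x := 0)
  rw [(hf.hasDerivAt_fderiv_line y u u 0).deriv] at this
  simpa using this

/-- Expand the nonnegative number ∇²f(y ± th)[u]² around y: the linear term ±t∇³f(y)[h,u,u] is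
bounded by ∇²f(y)[u]² + (t²/2)L‖h‖²‖u‖². The choice t = √2 gives both terms the coefficient 1. -/
theorem abs_tri_le (hB : B.PosDef) (hμ : 0 < μ) (hf : IsSmoothOfDegree 3 B L f)
    (y h u : Vec d) :
    |tri f y h u u| ≤ 1 / √2 * (snd f y u u + L * normSqB B h * normSqB B u) := by
  have hs : (0 : ℝ) < √2 := by positivity
  have hs2 : √2 ^ 2 = (2 : ℝ) := by norm_num
  have h1 := (abs_le.1 (hf.abs_snd_add_sub_le hB y (√2 • h) u)).2
  have h2 := (abs_le.1 (hf.abs_snd_add_sub_le hB y (-√2 • h) u)).2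
  have h3 := snd_nonneg hc hμ hf (y + √2 • h) u
  have h4 := snd_nonneg hc hμ hf (y + -√2 • h) u
  rw [(hf.isSymmTrilinear_tri y).smul_left, normB_sq hB, normB_sq hB, normSqB_smul, hs2] at h1
  rw [(hf.isSymmTrilinear_tri y).smul_left, normB_sq hB, normB_sq hB, normSqB_smul, neg_sq,
    hs2] at h2
  rw [div_mul_eq_mul_div, one_mul, le_div_iff₀ hs, ← abs_of_pos hs, ← abs_mul, abs_le]
  constructor <;> linarith

/-- Add the uniform convexity bounds for the gradient in the directions ±th: the cubic terms of the
expansions cancel, leaving (μ - L/3)t⁴‖h‖⁴ ≤ 2t²∇²f(0)[h]². As t grows this forces μ ≤ L/3. It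
yields L > 0 and κ₄ ≥ 1 as soon as the space is nonzero. -/
theorem three_mul_le (hB : B.PosDef) (hf : IsSmoothOfDegree 3 B L f) {h : Vec d} (hh : h ≠ 0) :
    3 * μ ≤ L := by
  have hn := normB_pos hB hh
  by_contra! hlt
  have key : ∀ t : ℝ, 0 < t → (μ - L / 3) * normB B h ^ 4 * t ^ 2 ≤ 2 * snd f 0 h h := by
    intro t ht
    have h1 := (le_fderiv_sub hc 0 (t • h)).trans
      (by linarith [(abs_le.1 (hf.abs_fderiv_add_sub_le hB 0 (t • h) (t • h))).2] :
        _ ≤ snd f 0 (t • h) (t • h) + tri f 0 (t • h) (t • h) (t • h) / 2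
          + L / 6 * normB B (t • h) ^ 3 * normB B (t • h))
    have h2 := (le_fderiv_sub hc 0 (-t • h)).trans
      (by linarith [(abs_le.1 (hf.abs_fderiv_add_sub_le hB 0 (-t • h) (-t • h))).2] :
        _ ≤ snd f 0 (-t • h) (-t • h) + tri f 0 (-t • h) (-t • h) (-t • h) / 2
          + L / 6 * normB B (-t • h) ^ 3 * normB B (-t • h))
    simp only [normB_smul, abs_neg, abs_of_pos ht, snd, tri, map_smul,
      _root_.smul_apply, smul_eq_mul] at h1 h2
    change _ ≤ 2 * fderiv ℝ (fderiv ℝ f) 0 h h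
    have h3 : t ^ 2 * ((μ - L / 3) * normB B h ^ 4 * t ^ 2) ≤
        t ^ 2 * (2 * fderiv ℝ (fderiv ℝ f) 0 h h) := by linarith
    exact le_of_mul_le_mul_left h3 (by positivity)
  have hp : 0 < (μ - L / 3) * normB B h ^ 4 := mul_pos (by linarith) (by positivity)
  set q := (μ - L / 3) * normB B h ^ 4
  -- A value of t at which the left side of `key` exceeds its right side.
  have := key (|2 * snd f 0 h h| / q + 1) (by positivity)
  have h5 : q * (|2 * snd f 0 h h| / q + 1) = |2 * snd f 0 h h| + q := by field_simp
  have h6 : 0 ≤ |2 * snd f 0 h h| / q := by positivity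
  have h7 : q * (|2 * snd f 0 h h| / q + 1) ^ 2
      = (|2 * snd f 0 h h| + q) * (|2 * snd f 0 h h| / q + 1) := by rw [← h5]; ring
  have h8 := le_abs_self (2 * snd f 0 h h)
  have h9 := abs_nonneg (2 * snd f 0 h h)
  nlinarith

theorem exists_minimizer (hB : B.PosDef) (hμ : 0 < μ) : ∃ xs, ∀ x, f xs ≤ f x := by
  obtain ⟨C, hC, hCn⟩ := exists_abs_apply_le_normB hB
  set G := ‖fderiv ℝ f 0‖ * C
  have hG : 0 ≤ G := by positivity
  have hcont : Continuous f := hc.1.continuous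
  -- Beyond this radius the quartic lower bound dominates the linear term G‖x‖, so f exceeds f(0)
  -- and only a compact ball matters.
  set R := 4 * G / μ + 1 with hR
  have hRp : 1 ≤ R := by rw [hR]; have : 0 ≤ 4 * G / μ := by positivity
                         linarith
  obtain ⟨xs, -, hxs⟩ := (isCompact_normB_sub_le hB 0 R).exists_isMinOn
    ⟨0, by simp [normB_zero]; linarith⟩ hcont.continuousOn
  refine ⟨xs, fun x => ?_⟩
  by_cases hx : normB B (x - 0) ≤ R
  · exact hxs hx
  have h0 : f xs ≤ f 0 := hxs (by simp [normB_zero]; linarith)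
  refine h0.trans ?_
  have h1 := le_apply hc 0 x
  rw [sub_zero] at h1 hx
  push Not at hx
  have h2 : |fderiv ℝ f 0 x| ≤ G * normB B x := by
    refine ((fderiv ℝ f 0).le_opNorm x).trans ?_
    have := hCn x
    calc _ ≤ ‖fderiv ℝ f 0‖ * (C * normB B x) := by gcongr
      _ = _ := by ring
  have h3 := (abs_le.1 h2).1
  have h4 : G ≤ μ / 4 * normB B x ^ 3 := by
    have : G ≤ μ / 4 * R := by rw [hR]; field_simp; linarith
    have hx1 : normB B x ≤ normB B x ^ 3 := le_self_pow₀ (by linarith) (by norm_num)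
    calc G ≤ μ / 4 * R := this
      _ ≤ _ := by gcongr; linarith
  nlinarith [normB_nonneg (B := B) x]

theorem normB_pow_four_le (hμ : 0 < μ) {xs : Vec d} (hxs : ∀ x, f xs ≤ f x) (x : Vec d) :
    normB B (x - xs) ^ 4 ≤ 4 / μ * (f x - f xs) := by
  have h0 : fderiv ℝ f xs = 0 := IsLocalMin.fderiv_eq_zero (Filter.Eventually.of_forall hxs)
  have := le_apply hc xs x
  rw [h0] at this
  rw [div_mul_eq_mul_div, le_div_iff₀ hμ]
  simp at this
  linarith

end IsUniformlyConvexOfDegree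

theorem normB_lineMap_sub_le (hB : B.PosDef) {x y z : Vec d} {R t : ℝ}
    (hx : normB B (x - z) ≤ R) (hy : normB B (y - z) ≤ R) (h0 : 0 ≤ t) (h1 : t ≤ 1) :
    normB B ((1 - t) • x + t • y - z) ≤ R := by
  have : (1 - t) • x + t • y - z = (1 - t) • (x - z) + t • (y - z) := by module
  rw [this]
  refine (normB_add_le hB _ _).trans ?_
  rw [normB_smul, normB_smul, abs_of_nonneg h0, abs_of_nonneg (sub_nonneg.2 h1)]
  nlinarith

/-- Bounds for the first three differentials of `f` on the ball of radius `R` around `xs`. -/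
structure DiffBounds (f : Vec d → ℝ) (B : Matrix (Fin d) (Fin d) ℝ) (xs : Vec d) (R P : ℝ) :
    Prop where
  fst : ∀ y, normB B (y - xs) ≤ R → ∀ a, |fderiv ℝ f y a| ≤ P * normB B a
  snd : ∀ y, normB B (y - xs) ≤ R → ∀ a b, |snd f y a b| ≤ P * normB B a * normB B b
  tri : ∀ y, normB B (y - xs) ≤ R → ∀ a b c,
    |tri f y a b c| ≤ P * normB B a * normB B b * normB B c

/-- Continuity of the differentials on a compact ball. Admitting every larger P lets one number
dominate the other scales as well. -/
theorem IsSmoothOfDegree.exists_diffBounds (hf : IsSmoothOfDegree 3 B L f) (hB : B.PosDef)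
    (xs : Vec d) (R : ℝ) : ∃ P₀, ∀ P, P₀ ≤ P → DiffBounds f B xs R P := by
  obtain ⟨C, hC, hCn⟩ := exists_abs_apply_le_normB hB
  have hb : ∀ k : ℕ, k ≤ 3 → ∃ K, ∀ y, normB B (y - xs) ≤ R → ∀ m : Fin k → Vec d,
      |iteratedFDeriv ℝ k f y m| ≤ K * ∏ i, normB B (m i) := by
    intro k hk
    obtain ⟨K, hK⟩ := (isCompact_normB_sub_le hB xs R).exists_bound_of_continuousOn
      (hf.1.continuous_iteratedFDeriv (m := k) (by exact_mod_cast hk)).continuousOn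
    refine ⟨|K| * C ^ k, fun y hy m => ?_⟩
    refine ((iteratedFDeriv ℝ k f y).le_opNorm m).trans ?_
    rw [mul_assoc]
    refine mul_le_mul ((hK y hy).trans (le_abs_self K)) ?_
      (Finset.prod_nonneg fun _ _ => norm_nonneg _) (abs_nonneg _)
    calc ∏ i, ‖m i‖ ≤ ∏ i, (C * normB B (m i)) :=
          Finset.prod_le_prod (fun _ _ => norm_nonneg _) fun i _ => hCn _
      _ = _ := by rw [Finset.prod_mul_distrib]; simp
  obtain ⟨K1, h1⟩ := hb 1 (by norm_num)
  obtain ⟨K2, h2⟩ := hb 2 (by norm_num)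
  obtain ⟨K3, h3⟩ := hb 3 (by norm_num)
  refine ⟨max K1 (max K2 K3), fun P hP => ?_⟩
  have p1 : K1 ≤ P := (le_max_left _ _).trans hP
  have p2 : K2 ≤ P := ((le_max_left _ _).trans (le_max_right _ _)).trans hP
  have p3 : K3 ≤ P := ((le_max_right _ _).trans (le_max_right _ _)).trans hP
  refine ⟨fun y hy a => ?_, fun y hy a b => ?_, fun y hy a b c => ?_⟩
  · have := h1 y hy ![a]
    simp at this
    exact this.trans (mul_le_mul_of_nonneg_right p1 (normB_nonneg _))
  · have := h2 y hy ![a, b]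
    rw [iteratedFDeriv_two_apply, Fin.prod_univ_two] at this
    refine (this.trans (mul_le_mul_of_nonneg_right p2
      (mul_nonneg (normB_nonneg _) (normB_nonneg _)))).trans (le_of_eq ?_)
    simp [mul_assoc]
  · have := h3 y hy ![a, b, c]
    rw [iteratedFDeriv_three_apply, Fin.prod_univ_three] at this
    refine (this.trans (mul_le_mul_of_nonneg_right p3 (mul_nonneg
      (mul_nonneg (normB_nonneg _) (normB_nonneg _)) (normB_nonneg _)))).trans (le_of_eq ?_)
    simp [mul_assoc]

namespace DiffBounds

variable {xs : Vec d} {R P : ℝ} (hD : DiffBounds f B xs R P)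
include hD

theorem abs_fderiv_sub_le (hB : B.PosDef) (hf : IsSmoothOfDegree 3 B L f) {y z : Vec d}
    (hy : normB B (y - xs) ≤ R) (hz : normB B (z - xs) ≤ R) (u : Vec d) :
    |fderiv ℝ f z u - fderiv ℝ f y u| ≤ P * normB B (z - y) * normB B u := by
  have := norm_image_sub_le_of_norm_deriv_le_segment_01'
    (f := fun t : ℝ => fderiv ℝ f (y + t • (z - y)) u) (C := P * normB B (z - y) * normB B u)
    (fun t _ => (hf.hasDerivAt_fderiv_line y (z - y) u t).hasDerivWithinAt)
    (fun t ht => hD.snd _ (by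
      have := normB_lineMap_sub_le hB hy hz ht.1 ht.2.le
      rwa [show (1 - t) • y + t • z = y + t • (z - y) by module] at this) _ _)
  simpa using this

theorem abs_snd_sub_le (hB : B.PosDef) (hf : IsSmoothOfDegree 3 B L f) {y z : Vec d}
    (hy : normB B (y - xs) ≤ R) (hz : normB B (z - xs) ≤ R) (u v : Vec d) :
    |_root_.snd f z u v - _root_.snd f y u v| ≤ P * normB B (z - y) * normB B u * normB B v := by
  have := norm_image_sub_le_of_norm_deriv_le_segment_01'
    (f := fun t : ℝ => _root_.snd f (y + t • (z - y)) u v)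
    (C := P * normB B (z - y) * normB B u * normB B v)
    (fun t _ => (hf.hasDerivAt_snd_line y (z - y) u v t).hasDerivWithinAt)
    (fun t ht => hD.tri _ (by
      have := normB_lineMap_sub_le hB hy hz ht.1 ht.2.le
      rwa [show (1 - t) • y + t • z = y + t • (z - y) by module] at this) _ _ _)
  simpa using this

end DiffBounds

end Convexity

/-! ### The auxiliary function and its relative smoothness -/

section Auxiliary

variable {d : ℕ} {B : Matrix (Fin d) (Fin d) ℝ} {f : Vec d → ℝ} {L μ : ℝ}

/-- `Γ(h) = ⟨∇f(y), h⟩ + ½ ∇²f(y)[h]² + ⅙ ∇³f(y)[h]³ + (L/4) ‖h‖_B⁴`. -/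
noncomputable def auxFun (f : Vec d → ℝ) (B : Matrix (Fin d) (Fin d) ℝ) (L : ℝ) (y h : Vec d) : ℝ :=
  fderiv ℝ f y h + snd f y h h / 2 + tri f y h h h / 6 + L / 4 * normSqB B h ^ 2

/-- The differential of `auxFun`. -/
noncomputable def auxDer (f : Vec d → ℝ) (B : Matrix (Fin d) (Fin d) ℝ) (L : ℝ) (y h u : Vec d) :
    ℝ :=
  fderiv ℝ f y u + snd f y h u + tri f y h h u / 2 + L * normSqB B h * ipB B h u

/-- `D(h) = ½ ∇²f(y)[h]² + (L/4) ‖h‖_B⁴`. -/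
noncomputable def refFun (f : Vec d → ℝ) (B : Matrix (Fin d) (Fin d) ℝ) (L : ℝ) (y h : Vec d) : ℝ :=
  snd f y h h / 2 + L / 4 * normSqB B h ^ 2

/-- The differential of `refFun`. -/
noncomputable def refDer (f : Vec d → ℝ) (B : Matrix (Fin d) (Fin d) ℝ) (L : ℝ) (y h u : Vec d) :
    ℝ :=
  snd f y h u + L * normSqB B h * ipB B h u

/-- The Bregman divergence `D(h + u) - D(h) - ⟨∇D(h), u⟩`. -/
noncomputable def refBreg (f : Vec d → ℝ) (B : Matrix (Fin d) (Fin d) ℝ) (L : ℝ) (y h u : Vec d) :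
    ℝ :=
  snd f y u u / 2 + L / 4 * ((2 * ipB B h u + normSqB B u) ^ 2 + 2 * normSqB B h * normSqB B u)

theorem snd_add_left (x a a' b : Vec d) : snd f x (a + a') b = snd f x a b + snd f x a' b := by
  simp [snd]

theorem snd_add_right (x a b b' : Vec d) : snd f x a (b + b') = snd f x a b + snd f x a b' := by
  simp [snd]

theorem snd_smul_left (x a b : Vec d) (t : ℝ) : snd f x (t • a) b = t * snd f x a b := by
  simp [snd]

theorem snd_smul_right (x a b : Vec d) (t : ℝ) : snd f x a (t • b) = t * snd f x a b := by
  simp [snd]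

theorem auxDer_smul (y h u : Vec d) (t : ℝ) :
    auxDer f B L y h (t • u) = t * auxDer f B L y h u := by
  simp [auxDer, snd, tri, ipB_smul_right]; ring

theorem auxDer_add (y h u v : Vec d) :
    auxDer f B L y h (u + v) = auxDer f B L y h u + auxDer f B L y h v := by
  simp [auxDer, snd, tri, ipB_add_right]; ring

theorem auxFun_zero (y : Vec d) : auxFun f B L y 0 = 0 := by
  simp [auxFun, snd, tri, normSqB_zero]

variable (hB : B.PosDef) (hμ : 0 < μ) (hL : 0 < L) (hf : IsSmoothOfDegree 3 B L f)
  (hc : IsUniformlyConvexOfDegree 4 B μ f)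

include hB hf in
theorem refFun_add (y h u : Vec d) :
    refFun f B L y (h + u) = refFun f B L y h + refDer f B L y h u + refBreg f B L y h u := by
  simp only [refFun, refDer, refBreg, snd_add_left, snd_add_right, normSqB_add hB]
  rw [hf.snd_comm y u h]
  ring

-- The cubic part of Γ leaves the exact remainder ½∇³f[h,u,u] + ⅙∇³f[u]³, which is a single
-- trilinear value at h + u/3. `abs_tri_le` then applies to it directly.
include hB hf in
theorem auxFun_add (y h u : Vec d) :
    auxFun f B L y (h + u) = auxFun f B L y h + auxDer f B L y h u + refBreg f B L y h u
      + tri f y (h + (1 / 3 : ℝ) • u) u u / 2 := by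
  have hS := hf.isSymmTrilinear_tri y
  simp only [auxFun, auxDer, refBreg, snd_add_left, snd_add_right, normSqB_add hB, map_add,
    hS.add_left, hS.add_mid, hS.add_right, hS.smul_left]
  rw [hf.snd_comm y u h, hS.swap_right h u h, hS.swap_left u h h, hS.swap_right h u h,
    hS.swap_left u h u, hS.swap_right u u h, hS.swap_left u h u]
  ring

include hB hμ hL hf hc in
theorem abs_tri_le_refBreg (y h u : Vec d) :
    |tri f y (h + (1 / 3 : ℝ) • u) u u / 2| ≤ 1 / √2 * refBreg f B L y h u := by
  have h1 := hc.abs_tri_le hB hμ hf y (h + (1 / 3 : ℝ) • u) u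
  rw [abs_div, abs_two, div_le_iff₀ two_pos]
  have h0 : 0 ≤ 1 / √2 := by positivity
  refine h1.trans ((mul_le_mul_of_nonneg_left ?_ h0).trans
    (mul_assoc _ _ _).symm.le)
  rw [normSqB_add hB, normSqB_smul, ipB_smul_right, refBreg]
  -- Four times the difference of the quartic parts: a nonnegative quadratic form in ⟨h,u⟩_B and
  -- ‖u‖².
  have : 0 ≤ L * (8 * (ipB B h u) ^ 2 + 16 / 3 * ipB B h u * normSqB B u
      + 14 / 9 * normSqB B u ^ 2) :=
    mul_nonneg hL.le (by nlinarith [sq_nonneg (3 * ipB B h u + normSqB B u)])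
  linarith

include hB hμ hL hf hc in
theorem auxFun_add_le (y h u : Vec d) :
    auxFun f B L y (h + u) ≤
      auxFun f B L y h + auxDer f B L y h u + relSmooth * refBreg f B L y h u := by
  rw [auxFun_add hB hf, relSmooth]
  linarith [(abs_le.1 (abs_tri_le_refBreg hB hμ hL hf hc y h u)).2]

include hB hμ hL hf hc in
theorem le_auxFun_add (y h u : Vec d) :
    auxFun f B L y h + auxDer f B L y h u + (2 - relSmooth) * refBreg f B L y h u ≤
      auxFun f B L y (h + u) := by
  rw [auxFun_add hB hf, relSmooth]
  linarith [(abs_le.1 (abs_tri_le_refBreg hB hμ hL hf hc y h u)).1]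

theorem relSmooth_bounds : 17 / 10 < relSmooth ∧ relSmooth < 171 / 100 := by
  have h1 : (1.41 : ℝ) < √2 := Real.lt_sqrt_of_sq_lt (by norm_num)
  have h2 : √2 < (10 / 7 : ℝ) := (Real.sqrt_lt' (by norm_num)).2 (by norm_num)
  have h0 : (0 : ℝ) < √2 := by positivity
  unfold relSmooth
  constructor
  · have : 7 / 10 < 1 / √2 := by rw [lt_div_iff₀ h0]; linarith
    linarith
  · have : 1 / √2 < 71 / 100 := by rw [div_lt_iff₀ h0]; linarith
    linarith

include hB in
theorem normSqB_sq_le (h u : Vec d) :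
    normSqB B u ^ 2 ≤
      4 * ((2 * ipB B h u + normSqB B u) ^ 2 + 2 * normSqB B h * normSqB B u) := by
  nlinarith [ipB_sq_le hB h u, sq_nonneg (4 * ipB B h u + normSqB B u),
    sq_nonneg (3 * ipB B h u + normSqB B u)]

-- The quartic norm alone makes D uniformly convex of degree 4. This converts relative convergence
-- into bounds on displacements.
include hB hμ hL hf hc in
theorem normB_pow_four_le_refBreg (y h u : Vec d) :
    L / 16 * normB B u ^ 4 ≤ refBreg f B L y h u := by
  have h1 := hc.snd_nonneg hμ hf y u
  have h2 := normSqB_sq_le hB h u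
  rw [show normB B u ^ 4 = (normB B u ^ 2) ^ 2 by ring, normB_sq hB, refBreg]
  nlinarith

include hB hμ hL hf hc in
theorem refBreg_nonneg (y h u : Vec d) : 0 ≤ refBreg f B L y h u :=
  le_trans (by have := normB_nonneg (B := B) u; positivity)
    (normB_pow_four_le_refBreg hB hμ hL hf hc y h u)

-- The divergence of D shrinks quadratically along a segment up to a constant. This is what makes a
-- short step towards any target z profitable and gives the linear rate.
include hB hμ hL hf hc in
theorem refBreg_smul_le (y h u : Vec d) {t : ℝ} (h0 : 0 ≤ t) (h1 : t ≤ 1) :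
    refBreg f B L y h (t • u) ≤ 10 * t ^ 2 * refBreg f B L y h u := by
  have h2 := hc.snd_nonneg hμ hf y u
  have h3 := normSqB_sq_le hB h u
  simp only [refBreg, snd_smul_left, snd_smul_right, ipB_smul_right, normSqB_smul]
  have ha := normSqB_nonneg hB h
  have hcc := normSqB_nonneg hB u
  set a := normSqB B h
  set b := ipB B h u
  set c := normSqB B u
  have h4 : (2 * b + t * c) ^ 2 + 2 * a * c ≤ 10 * ((2 * b + c) ^ 2 + 2 * a * c) := by
    have : (2 * b + t * c) ^ 2 ≤ 2 * (2 * b + c) ^ 2 + 2 * c ^ 2 := by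
      nlinarith [sq_nonneg (2 * b + c + (1 - t) * c), mul_nonneg (mul_nonneg h0
        (by linarith : 0 ≤ 2 - t)) (sq_nonneg c)]
    nlinarith [mul_nonneg ha hcc]
  have h5 := mul_le_mul_of_nonneg_left h4 (by positivity : 0 ≤ t ^ 2 * L / 4)
  have h6 : 0 ≤ t ^ 2 * snd f y u u := mul_nonneg (sq_nonneg t) h2
  linarith

end Auxiliary

/-! ### Execution of programs -/

section Programs

variable {d : ℕ} {α β : Type} (f : Vec d → ℝ) (B : Matrix (Fin d) (Fin d) ℝ)

theorem OracleProg.run_pure (a : α) : (pure a : OracleProg d α).run f B = (a, ⟨0, 0⟩) := rfl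

theorem OracleProg.run_bind (p : OracleProg d α) (g : α → OracleProg d β) :
    (p >>= g).run f B = (((g (p.run f B).1).run f B).1,
      ⟨(p.run f B).2.grad + ((g (p.run f B).1).run f B).2.grad,
        (p.run f B).2.solver + ((g (p.run f B).1).run f B).2.solver⟩) := by
  change (p.bind g).run f B = _
  induction p with
  | ret a => simp [OracleProg.bind, OracleProg.run]
  | queryGrad y h k ih => simp [OracleProg.bind, OracleProg.run, ih]; omega
  | querySolve y s b k ih => simp [OracleProg.bind, OracleProg.run, ih]; omega
  | queryMetric b k ih => simp [OracleProg.bind, OracleProg.run, ih]; omega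

theorem run_askGrad (y h : Vec d) :
    (askGrad y h).run f B = ((gradVec f y, hessMat f y *ᵥ h, thirdVec f y h), ⟨1, 0⟩) := rfl

theorem run_askSolve (y : Vec d) (s : ℝ) (b : Vec d) :
    (askSolve y s b).run f B = ((hessMat f y + s • B)⁻¹ *ᵥ b, ⟨0, 1⟩) := rfl

theorem run_askMetric (b : Vec d) : (askMetric b).run f B = (B⁻¹ *ᵥ b, ⟨0, 1⟩) := rfl

end Programs

/-! ### One step of the auxiliary minimization -/

section AuxStep

variable {d : ℕ} {B : Matrix (Fin d) (Fin d) ℝ} {f : Vec d → ℝ} {L μ : ℝ}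

/-- `h(s) = -M⁻¹ (∇²f(y) + s B)⁻¹ c`. -/
noncomputable def dualPoint (f : Vec d → ℝ) (B : Matrix (Fin d) (Fin d) ℝ) (y c : Vec d) (s : ℝ) :
    Vec d :=
  -(1 / relSmooth) • ((hessMat f y + s • B)⁻¹ *ᵥ c)

variable (hB : B.PosDef) (hμ : 0 < μ) (hL : 0 < L) (hf : IsSmoothOfDegree 3 B L f)
  (hc : IsUniformlyConvexOfDegree 4 B μ f)

-- For s > 0 the matrix ∇²f(y) + sB is positive definite, so the inverse in the solver's answer is
-- genuine; this is the linear system tested against u.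
include hB hμ hf hc in
theorem dualPoint_eq (y c u : Vec d) {s : ℝ} (hs : 0 < s) :
    c ⬝ᵥ u = -relSmooth * (snd f y (dualPoint f B y c s) u + s * ipB B (dualPoint f B y c s) u) := by
  have hH : (hessMat f y).PosSemidef := PosSemidef.of_dotProduct_mulVec_nonneg
    (hf.isHermitian_hessMat y) fun x => by
      rw [star_trivial, dotProduct_hessMat_mulVec]; exact hc.snd_nonneg hμ hf y x
  have hP : (hessMat f y + s • B).PosDef := PosDef.posSemidef_add hH (hB.smul hs)
  have hu := (Matrix.isUnit_iff_isUnit_det _).1 hP.isUnit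
  have hr : relSmooth ≠ 0 := by linarith [relSmooth_bounds.1]
  have h1 : (hessMat f y + s • B) *ᵥ dualPoint f B y c s = -(1 / relSmooth) • c := by
    rw [dualPoint, mulVec_smul, mulVec_mulVec, Matrix.mul_nonsing_inv _ hu, one_mulVec]
  have h2 := congrArg (fun w => u ⬝ᵥ w) h1
  simp only [add_mulVec, smul_mulVec, dotProduct_add, dotProduct_smul,
    dotProduct_hessMat_mulVec, smul_eq_mul] at h2
  rw [hf.snd_comm y _ u, ipB_comm hB _ u, ipB, h2, dotProduct_comm]
  field_simp

-- With p = h(s) and q = h(t), subtracting the two systems gives (∇²f(y) + sB)(p - q) = (t - s)Bq.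
-- Testing with p - q yields s‖p - q‖ ≤ (t - s)‖q‖, and the triangle inequality finishes.
include hB hμ hf hc in
theorem dualPoint_normB_le (y c : Vec d) {s t : ℝ} (hs : 0 < s) (hst : s < t) :
    s * normB B (dualPoint f B y c s) ≤ t * normB B (dualPoint f B y c t) := by
  set p := dualPoint f B y c s with hp
  set q := dualPoint f B y c t with hq
  have hr : 0 < relSmooth := by linarith [relSmooth_bounds.1]
  have h1 := dualPoint_eq hB hμ hf hc y c (p - q) hs
  rw [dualPoint_eq hB hμ hf hc y c (p - q) (hs.trans hst), ← hp, ← hq] at h1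
  have h2 := mul_left_cancel₀ (neg_ne_zero.2 hr.ne') h1
  have h3 : p = q + (p - q) := by abel
  have h4 : snd f y p (p - q) = snd f y q (p - q) + snd f y (p - q) (p - q) := by
    rw [← snd_add_left, ← h3]
  have h5 : ipB B p (p - q) = ipB B q (p - q) + normSqB B (p - q) := by
    rw [normSqB_eq_ipB, ← ipB_add_left, ← h3]
  have h6 := hc.snd_nonneg hμ hf y (p - q)
  have h7 := (abs_le.1 (abs_ipB_le hB q (p - q))).2
  have h8 : s * normB B (p - q) ≤ (t - s) * normB B q := by
    rcases (normB_nonneg (B := B) (p - q)).eq_or_lt with h0 | h0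
    · rw [← h0, mul_zero]; exact mul_nonneg (by linarith) (normB_nonneg _)
    · rw [← normB_sq hB] at h5
      refine le_of_mul_le_mul_right ?_ h0
      nlinarith
  have h9 := normB_add_le hB q (p - q)
  rw [← h3] at h9
  nlinarith

-- Monotonicity of s‖h(s)‖ gives L‖h(t)‖² ≥ s³/t², and s³ ≥ t³ - 3t²(t - s). A bracket of the sign
-- change therefore controls the residual at its upper end.
include hB hμ hL hf hc in
theorem le_normSqB_dualPoint (y c : Vec d) {s t : ℝ} (hs : 0 < s) (hst : s < t)
    (h : s < L * normSqB B (dualPoint f B y c s)) :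
    t - 3 * (t - s) ≤ L * normSqB B (dualPoint f B y c t) := by
  have h1 := dualPoint_normB_le hB hμ hf hc y c hs hst
  have h2 := pow_le_pow_left₀ (mul_nonneg hs.le (normB_nonneg _)) h1 2
  rw [mul_pow, mul_pow, normB_sq hB, normB_sq hB] at h2
  have h3 : s ^ 3 ≤ t ^ 2 * (L * normSqB B (dualPoint f B y c t)) := by
    nlinarith [mul_le_mul_of_nonneg_left h.le (sq_nonneg s), mul_le_mul_of_nonneg_left h2 hL.le]
  have h4 : t ^ 2 * (t - 3 * (t - s)) ≤ s ^ 3 := by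
    nlinarith [mul_nonneg (sq_nonneg (t - s)) (by linarith : 0 ≤ 2 * t + s)]
  exact le_of_mul_le_mul_left (h4.trans h3) (by nlinarith)

-- The bisection keeps a sign change of s - L‖h(s)‖² between its ends. The end 0 is exempt, since
-- the Hessian may be singular there; in that case the residual bound is trivial because s ≤ 3s.
include hB hμ hL hf hc in
theorem dualBisection_spec (P : FQParams) (hP : P.L = L) (y c : Vec d) (n : ℕ) :
    ∀ lo hi : ℝ, 0 ≤ lo → lo < hi → (lo = 0 ∨ lo < L * normSqB B (dualPoint f B y c lo)) →
      L * normSqB B (dualPoint f B y c hi) ≤ hi →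
      ∃ s, 0 < s ∧ s ≤ hi ∧ ((dualBisection B P y c n lo hi).run f B).1 = dualPoint f B y c s ∧
        L * normSqB B (dualPoint f B y c s) ≤ s ∧
        s - 3 * ((hi - lo) * (1 / 2) ^ n) ≤ L * normSqB B (dualPoint f B y c s) := by
  induction n with
  | zero =>
    intro lo hi h0 hlt hlo hhi
    refine ⟨hi, by linarith, le_rfl, rfl, hhi, ?_⟩
    rw [pow_zero, mul_one]
    rcases hlo with rfl | hlo
    · have := mul_nonneg hL.le (normSqB_nonneg hB (dualPoint f B y c hi))
      linarith
    · rcases h0.eq_or_lt with rfl | h0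
      · have := mul_nonneg hL.le (normSqB_nonneg hB (dualPoint f B y c hi))
        linarith
      · exact le_normSqB_dualPoint hB hμ hL hf hc y c h0 hlt hlo
  | succ n ih =>
    intro lo hi h0 hlt hlo hhi
    have hrun : ((dualBisection B P y c (n + 1) lo hi).run f B).1 =
        if L * normSqB B (dualPoint f B y c ((lo + hi) / 2)) ≤ (lo + hi) / 2 then
          ((dualBisection B P y c n lo ((lo + hi) / 2)).run f B).1
        else ((dualBisection B P y c n ((lo + hi) / 2) hi).run f B).1 := by
      rw [dualBisection, OracleProg.run_bind, run_askSolve]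
      simp only [hP]
      change (OracleProg.run f B (if L * normSqB B (dualPoint f B y c ((lo + hi) / 2)) ≤
        (lo + hi) / 2 then _ else _)).1 = _
      by_cases h : L * normSqB B (dualPoint f B y c ((lo + hi) / 2)) ≤ (lo + hi) / 2
      · rw [if_pos h, if_pos h]
      · rw [if_neg h, if_neg h]
    rw [hrun]
    split_ifs with h
    · obtain ⟨s, h1, h2, h3, h4, h5⟩ := ih lo ((lo + hi) / 2) h0 (by linarith) hlo h
      refine ⟨s, h1, by linarith, h3, h4, le_trans (le_of_eq ?_) h5⟩
      rw [pow_succ]; ring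
    · push Not at h
      obtain ⟨s, h1, h2, h3, h4, h5⟩ := ih ((lo + hi) / 2) hi (by linarith) (by linarith)
        (Or.inr h) hhi
      refine ⟨s, h1, h2, h3, h4, le_trans (le_of_eq ?_) h5⟩
      rw [pow_succ]; ring

/-- The linear coefficient `c = ∇Γ(h) - M ∇D(h)` of an auxiliary step. -/
noncomputable def auxCoeff (f : Vec d → ℝ) (B : Matrix (Fin d) (Fin d) ℝ) (L : ℝ) (y h : Vec d) :
    Vec d :=
  gradVec f y + hessMat f y *ᵥ h + (1 / 2 : ℝ) • thirdVec f y h + (L * normSqB B h) • (B *ᵥ h)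
    - relSmooth • (hessMat f y *ᵥ h + (L * normSqB B h) • (B *ᵥ h))

include hB hf in
theorem auxCoeff_dotProduct (y h u : Vec d) :
    auxCoeff f B L y h ⬝ᵥ u = auxDer f B L y h u - relSmooth * refDer f B L y h u := by
  have h1 : (hessMat f y *ᵥ h) ⬝ᵥ u = snd f y h u := by
    rw [dotProduct_comm, dotProduct_hessMat_mulVec, hf.snd_comm]
  have h2 : (B *ᵥ h) ⬝ᵥ u = ipB B h u := by rw [dotProduct_comm, ipB_comm hB, ipB]
  simp only [auxCoeff, sub_dotProduct, add_dotProduct, smul_dotProduct, gradVec_dotProduct,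
    thirdVec_dotProduct, h1, h2, auxDer, refDer, smul_eq_mul]
  ring

theorem run_auxStep (P : FQParams) (hP : P.L = L) (y h : Vec d) :
    ((auxStep B P y h).run f B).1 =
      ((dualBisection B P y (auxCoeff f B L y h) P.dualSteps 0 P.lamMax).run f B).1 := by
  rw [auxStep, OracleProg.run_bind, run_askGrad]
  simp only [hP, auxCoeff]

include hB hμ hL hf hc in
/-- Decrease of the auxiliary function in one inexact step. -/
theorem auxFun_dualPoint_sub_le (y h z : Vec d) {s e : ℝ} (hs : 0 < s)
    (h1 : L * normSqB B (dualPoint f B y (auxCoeff f B L y h) s) ≤ s)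
    (h2 : s - e ≤ L * normSqB B (dualPoint f B y (auxCoeff f B L y h) s)) :
    auxFun f B L y (dualPoint f B y (auxCoeff f B L y h) s) - auxFun f B L y z ≤
      99 / 100 * (auxFun f B L y h - auxFun f B L y z)
        + relSmooth * e * normB B (dualPoint f B y (auxCoeff f B L y h) s) *
          normB B (h + (1 / 100 : ℝ) • (z - h) - dualPoint f B y (auxCoeff f B L y h) s) := by
  set c := auxCoeff f B L y h with hcdef
  set p := dualPoint f B y c s with hp
  -- The exact minimizer of the model would be compared with this point, one hundredth of the way to
  -- z.
  set w := h + (1 / 100 : ℝ) • (z - h) with hw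
  obtain ⟨hr1, hr2⟩ := relSmooth_bounds
  have hr : 0 < relSmooth := by linarith
  have hup := auxFun_add_le hB hμ hL hf hc y h (p - h)
  have hlow := le_auxFun_add hB hμ hL hf hc y h (z - h)
  have hbr := refBreg_smul_le hB hμ hL hf hc y h (z - h) (t := 1 / 100) (by norm_num) (by norm_num)
  have hb0 := refBreg_nonneg hB hμ hL hf hc y h (z - h)
  have hD1 := refFun_add hB hf y h (p - h)
  have hD2 := refFun_add hB hf y h ((1 / 100 : ℝ) • (z - h))
  have hD3 := refFun_add hB hf y p (w - p)
  have hb1 := refBreg_nonneg hB hμ hL hf hc y p (w - p)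
  rw [add_sub_cancel] at hup hlow hD1 hD3
  rw [← hw] at hD2
  have hcw := dualPoint_eq hB hμ hf hc y c (w - p) hs
  rw [← hp] at hcw
  have hsplit : w - p = (1 / 100 : ℝ) • (z - h) + (-1 : ℝ) • (p - h) := by rw [hw]; module
  have hcs : c ⬝ᵥ (w - p) = (1 / 100) * auxDer f B L y h (z - h) - auxDer f B L y h (p - h)
      - relSmooth * (refDer f B L y h ((1 / 100 : ℝ) • (z - h)) - refDer f B L y h (p - h)) := by
    rw [hcdef, auxCoeff_dotProduct hB hf, hsplit, auxDer_add, auxDer_smul, auxDer_smul]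
    simp only [refDer, snd_add_right, snd_smul_right, ipB_add_right, ipB_smul_right]
    ring
  have hrd : refDer f B L y p (w - p) = snd f y p (w - p) + L * normSqB B p * ipB B p (w - p) := rfl
  -- At p the model ⟨c,·⟩ + M·D, where M is `relSmooth`, has derivative M(L‖p‖² - s)⟨p,·⟩_B instead
  -- of 0. This bounds the resulting error.
  have hcs2 : (s - L * normSqB B p) * ipB B p (w - p) ≤ e * normB B p * normB B (w - p) := by
    have ha := abs_ipB_le hB p (w - p)
    calc _ ≤ (s - L * normSqB B p) * (normB B p * normB B (w - p)) :=
          mul_le_mul_of_nonneg_left ((le_abs_self _).trans ha) (by linarith)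
      _ ≤ e * (normB B p * normB B (w - p)) := by
          refine mul_le_mul_of_nonneg_right (by linarith) ?_
          exact mul_nonneg (normB_nonneg _) (normB_nonneg _)
      _ = _ := by ring
  have hcs3 := mul_le_mul_of_nonneg_left hcs2 hr.le
  have hcs4 := mul_nonneg hr.le hb1
  have hcs5 := mul_le_mul_of_nonneg_left hbr hr.le
  -- The step 1/100 is small enough: M·10·10⁻⁴ < 0.00171, while (2 - M)/100 > 0.0029.
  have hcs6 : relSmooth * (10 * (1 / 100) ^ 2 * refBreg f B L y h (z - h)) ≤
      1 / 100 * ((2 - relSmooth) * refBreg f B L y h (z - h)) := by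
    nlinarith
  have e1 : refBreg f B L y h (p - h) =
    refFun f B L y p - refFun f B L y h - refDer f B L y h (p - h) := by linarith
  have e2 : refBreg f B L y h ((1 / 100 : ℝ) • (z - h)) =
    refFun f B L y w - refFun f B L y h - refDer f B L y h ((1 / 100 : ℝ) • (z - h)) := by linarith
  have e3 : refBreg f B L y p (w - p) =
    refFun f B L y w - refFun f B L y p - snd f y p (w - p)
      - L * normSqB B p * ipB B p (w - p) := by linarith
  rw [e1] at hup
  rw [e2] at hcs5
  rw [e3] at hcs4
  rw [hcs] at hcw
  linarith

end AuxStep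

/-! ### Accuracy of the auxiliary minimization -/

section AuxMin

/-- Relations between the constant `P`, which bounds all scales of the problem, the ratio
`η = ε / Z` and the number `Z`. -/
structure Scales (L P η Z : ℝ) : Prop where
  le_P : 10 ^ 4 ≤ P
  L_le : L ≤ P
  one_le : 1 ≤ P * L
  η_pos : 0 < η
  η_le : P ^ 20 * η ≤ 1
  le_Z : P ^ 20 ≤ Z
  Z_le : Z * η ≤ P

namespace Scales

variable {L P η Z : ℝ} (hs : Scales L P η Z)
include hs

theorem P_pos : 0 < P := by linarith [hs.le_P]

theorem L_pos : 0 < L := by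
  by_contra! h
  nlinarith [hs.one_le, hs.P_pos]

theorem Z_pos : 0 < Z := lt_of_lt_of_le (pow_pos hs.P_pos 20) hs.le_Z

theorem mul_le_one {a : ℝ} (ha : a ≤ P ^ 20) : a * η ≤ 1 :=
  (mul_le_mul_of_nonneg_right ha hs.η_pos.le).trans hs.η_le

theorem mul_pow_le {C : ℝ} {k : ℕ} (hC : C ≤ P) (hk : k ≤ 19) : C * P ^ k ≤ P ^ 20 := by
  calc C * P ^ k ≤ P * P ^ k := mul_le_mul_of_nonneg_right hC (pow_pos hs.P_pos k).le
    _ = P ^ (k + 1) := by ring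
    _ ≤ P ^ 20 := pow_le_pow_right₀ (by linarith [hs.le_P]) (by omega)

/-- A power of `η` absorbs a bounded power of `P`. -/
theorem absorb {C : ℝ} (k m : ℕ) (hC : C ≤ 10 ^ 4) (hk : k ≤ 19) :
    C * P ^ k * η ^ (m + 1) ≤ η ^ m := by
  have := hs.mul_le_one (hs.mul_pow_le (hC.trans hs.le_P) hk)
  calc C * P ^ k * η ^ (m + 1) = (C * P ^ k * η) * η ^ m := by ring
    _ ≤ 1 * η ^ m := mul_le_mul_of_nonneg_right this (pow_pos hs.η_pos m).le
    _ = η ^ m := one_mul _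

theorem η_le_one : η ≤ 1 := by simpa using hs.absorb (C := 1) 0 0 (by norm_num) (by norm_num)

theorem pow_le_pow {m n : ℕ} (h : m ≤ n) : η ^ n ≤ η ^ m :=
  pow_le_pow_of_le_one hs.η_pos.le hs.η_le_one h

end Scales

variable {d : ℕ} {B : Matrix (Fin d) (Fin d) ℝ} {f : Vec d → ℝ} {L μ : ℝ}
  {xs y : Vec d} {R P η Z : ℝ}
  (hB : B.PosDef) (hμ : 0 < μ) (hf : IsSmoothOfDegree 3 B L f)
  (hc : IsUniformlyConvexOfDegree 4 B μ f) (hs : Scales L P η Z)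
  (hD : DiffBounds f B xs R P) (hy : normB B (y - xs) ≤ R)

include hB hμ hf hc hs hD hy

/-- Relative strong convexity at 0, where Γ has slope ∇f(y). The coefficient comes from (2 - M)/16 >
1/56, with M = `relSmooth`, and L ≥ 1/P. This coercivity confines the sublevel set {Γ ≤ 1} to a ball
of radius 5P. -/
theorem neg_mul_normB_le_auxFun (z : Vec d) :
    -(P * normB B z) + normB B z ^ 4 / (56 * P) ≤ auxFun f B L y z := by
  have h1 := le_auxFun_add hB hμ hs.L_pos hf hc y 0 z
  have h2 := normB_pow_four_le_refBreg hB hμ hs.L_pos hf hc y 0 z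
  have h3 := (abs_le.1 (hD.fst y hy z)).1
  have hP := hs.P_pos
  have h4 : auxDer f B L y 0 z = fderiv ℝ f y z := by
    simp [auxDer, snd, tri, normSqB_zero]
  rw [zero_add, auxFun_zero, h4] at h1
  have h5 : 0 ≤ normB B z ^ 4 := by positivity
  have h6 : normB B z ^ 4 / (56 * P) ≤ L / 56 * normB B z ^ 4 := by
    rw [div_le_iff₀ (by positivity)]
    nlinarith [hs.one_le]
  have h8 : 0 ≤ L / 16 * normB B z ^ 4 := mul_nonneg (by linarith [hs.L_pos]) h5
  nlinarith [relSmooth_bounds.2]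

theorem normB_le_of_auxFun_le {h : Vec d} (hh : auxFun f B L y h ≤ 1) : normB B h ≤ 5 * P := by
  have h1 := (neg_mul_normB_le_auxFun hB hμ hf hc hs hD hy h).trans hh
  by_contra! hlt
  have hP := hs.P_pos
  have hP1 := hs.le_P
  set r := normB B h
  have h2 : r ^ 4 ≤ (1 + P * r) * (56 * P) := by
    rw [← div_le_iff₀ (by positivity)]; linarith
  have hr : 1 ≤ P * r := by nlinarith
  have h3 : r ^ 4 ≤ 112 * P ^ 2 * r := by nlinarith
  have h5 : (5 * P) ^ 3 ≤ r ^ 3 := pow_le_pow_left₀ (by positivity) hlt.le 3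
  have h6 : 112 * P ^ 2 < (5 * P) ^ 3 := by nlinarith [sq_nonneg P, pow_pos hP 2]
  have hr0 : 0 < r := by linarith
  nlinarith

omit hμ hc in
theorem abs_auxCoeff_dotProduct_le {h : Vec d} (hh : normB B h ≤ 5 * P) (u : Vec d) :
    |auxCoeff f B L y h ⬝ᵥ u| ≤ 400 * P ^ 4 * normB B u := by
  rw [auxCoeff_dotProduct hB hf, auxDer, refDer]
  have hP := hs.P_pos
  have hP1 := hs.le_P
  have hL := hs.L_pos
  have hu := normB_nonneg (B := B) u
  have h0 := normB_nonneg (B := B) h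
  set r := normB B u
  have b1 := hD.fst y hy u
  have b2 : |snd f y h u| ≤ 5 * P ^ 2 * r := by
    calc _ ≤ P * normB B h * r := hD.snd y hy h u
      _ ≤ P * (5 * P) * r := by gcongr
      _ = _ := by ring
  have b3 : |tri f y h h u| ≤ 25 * P ^ 3 * r := by
    calc _ ≤ P * normB B h * normB B h * r := hD.tri y hy h h u
      _ ≤ P * (5 * P) * (5 * P) * r := by gcongr
      _ = _ := by ring
  have b4 : |L * normSqB B h * ipB B h u| ≤ 125 * P ^ 4 * r := by
    rw [abs_mul, abs_mul, abs_of_pos hL, abs_of_nonneg (normSqB_nonneg hB h), ← normB_sq hB]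
    calc _ ≤ L * normB B h ^ 2 * (normB B h * r) := by gcongr; exact abs_ipB_le hB h u
      _ ≤ P * (5 * P) ^ 2 * ((5 * P) * r) := by gcongr; exact hs.L_le
      _ = _ := by ring
  have c1 : P * r ≤ P ^ 4 * r := by
    gcongr; exact le_self_pow₀ (by linarith) (by norm_num)
  have c2 : P ^ 2 * r ≤ P ^ 4 * r := by
    refine mul_le_mul_of_nonneg_right (pow_le_pow_right₀ (by linarith) (by norm_num)) hu
  have c3 : P ^ 3 * r ≤ P ^ 4 * r := by
    refine mul_le_mul_of_nonneg_right (pow_le_pow_right₀ (by linarith) (by norm_num)) hu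
  have hr := relSmooth_bounds
  have b5 : |snd f y h u + L * normSqB B h * ipB B h u| ≤ 130 * P ^ 4 * r := by
    refine (abs_add_le _ _).trans ?_; linarith
  have b6 : |relSmooth * (snd f y h u + L * normSqB B h * ipB B h u)|
      ≤ 171 / 100 * (130 * P ^ 4 * r) := by
    rw [abs_mul, abs_of_pos (by linarith)]
    gcongr; exact hr.2.le
  rw [abs_le] at *
  constructor <;> linarith

/-- The initial upper end of the bisection is admissible: the coefficient c has size at most 400P⁴ ≤
Z, so ‖h(Z)‖ ≤ 1 and L‖h(Z)‖² ≤ P ≤ Z. -/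
theorem dualPoint_le {h : Vec d} (hh : normB B h ≤ 5 * P) :
    L * normSqB B (dualPoint f B y (auxCoeff f B L y h) Z) ≤ Z := by
  set p := dualPoint f B y (auxCoeff f B L y h) Z with hp
  have hP := hs.P_pos
  have hP1 := hs.le_P
  have hZ := hs.Z_pos
  have hr := relSmooth_bounds
  have h1 := dualPoint_eq hB hμ hf hc y (auxCoeff f B L y h) p hZ
  rw [← hp] at h1
  have h2 := (abs_le.1 (abs_auxCoeff_dotProduct_le hB hf hs hD hy hh p)).1
  have h3 := hc.snd_nonneg hμ hf y p
  rw [h1, ← normSqB_eq_ipB, ← normB_sq hB] at h2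
  have h0 := normB_nonneg (B := B) p
  have h4 : Z * normB B p ≤ 400 * P ^ 4 := by
    rcases h0.eq_or_lt with h | h
    · rw [← h, mul_zero]; positivity
    · refine le_of_mul_le_mul_right ?_ h
      have : 0 ≤ Z * normB B p ^ 2 := by positivity
      nlinarith
  have hZ2 : 400 * P ^ 4 ≤ Z :=
    (hs.mul_pow_le (by linarith) (by norm_num)).trans hs.le_Z
  have h5 : normB B p ≤ 1 := by
    by_contra! h
    nlinarith
  rw [← normB_sq hB]
  calc L * normB B p ^ 2 ≤ P * 1 ^ 2 := by gcongr; exact hs.L_le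
    _ ≤ Z := by
      have : 1 * P ^ 1 ≤ P ^ 20 := hs.mul_pow_le (by linarith) (by norm_num)
      linarith [hs.le_Z]

/-- One step of the auxiliary minimization. -/
theorem auxStep_spec {Q : FQParams} (hQL : Q.L = L) (hQZ : Q.lamMax = Z)
    (hJ : (1 / 2 : ℝ) ^ Q.dualSteps ≤ η ^ 100) {h : Vec d} (hh : auxFun f B L y h ≤ 1) :
    auxFun f B L y ((auxStep B Q y h).run f B).1 ≤ 1 ∧ ∀ z, normB B z ≤ 6 * P →
      auxFun f B L y ((auxStep B Q y h).run f B).1 - auxFun f B L y z ≤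
        99 / 100 * (auxFun f B L y h - auxFun f B L y z) + η ^ 90 := by
  have hn := normB_le_of_auxFun_le hB hμ hf hc hs hD hy hh
  have hP := hs.P_pos
  have hP1 := hs.le_P
  have hZ := hs.Z_pos
  have hη := hs.η_pos
  have hL := hs.L_pos
  rw [run_auxStep Q hQL, hQZ]
  obtain ⟨s, hs0, hsZ, hrun, hs1, hs2⟩ := dualBisection_spec hB hμ hL hf hc Q hQL y
    (auxCoeff f B L y h) Q.dualSteps 0 Z le_rfl hZ (Or.inl rfl)
    (dualPoint_le hB hμ hf hc hs hD hy hn)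
  rw [hrun, sub_zero] at *
  have hstep := fun z => auxFun_dualPoint_sub_le hB hμ hL hf hc y h z hs0 hs1 hs2
  set p := dualPoint f B y (auxCoeff f B L y h) s
  have hZη : Z ≤ P / η := by rw [le_div_iff₀ hη]; exact hs.Z_le
  -- A crude bound is enough, because the bisection error carries the factor η¹⁰⁰.
  have hpn : normB B p ≤ P / η := by
    apply le_of_sq_le_sq _ (by positivity)
    rw [normB_sq hB]
    have h1 : normSqB B p ≤ P * Z := by
      have : normSqB B p ≤ P * (L * normSqB B p) := by
        nlinarith [hs.one_le, normSqB_nonneg hB p]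
      exact this.trans (mul_le_mul_of_nonneg_left (hs1.trans hsZ) hP.le)
    have h2 : P / η ≤ (P / η) * (1 / η) :=
      le_mul_of_one_le_right (by positivity) ((one_le_div hη).2 hs.η_le_one)
    calc normSqB B p ≤ P * Z := h1
      _ ≤ P * ((P / η) * (1 / η)) := by gcongr; linarith
      _ = (P / η) ^ 2 := by ring
  have herr : ∀ z, normB B z ≤ 6 * P → relSmooth * (3 * (Z * (1 / 2) ^ Q.dualSteps)) *
      normB B p * normB B (h + (1 / 100 : ℝ) • (z - h) - p) ≤ η ^ 90 := by
    intro z hz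
    have h6 : 6 * P ≤ P / η := by
      rw [le_div_iff₀ hη]
      nlinarith [hs.mul_le_one (a := 6) ((by linarith : (6 : ℝ) ≤ 6 * P ^ 0).trans
        (hs.mul_pow_le (by linarith) (by norm_num)))]
    have hw : normB B (h + (1 / 100 : ℝ) • (z - h) - p) ≤ 2 * (P / η) := by
      refine (normB_sub_le hB _ _).trans ?_
      have h7 := normB_add_le hB h ((1 / 100 : ℝ) • (z - h))
      have h8 := normB_sub_le hB z h
      rw [normB_smul, abs_of_pos (by norm_num)] at h7
      linarith
    calc _ ≤ 2 * (3 * (P / η * η ^ 100)) * (P / η) * (2 * (P / η)) := by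
          have hr := relSmooth_bounds
          have := normB_nonneg (B := B) p
          have := normB_nonneg (B := B) (h + (1 / 100 : ℝ) • (z - h) - p)
          gcongr
          linarith
      _ = 12 * P ^ 3 * η ^ (96 + 1) := by field_simp; ring
      _ ≤ η ^ 96 := hs.absorb 3 96 (by norm_num) (by norm_num)
      _ ≤ η ^ 90 := hs.pow_le_pow (by norm_num)
  have hall : ∀ z, normB B z ≤ 6 * P → auxFun f B L y p - auxFun f B L y z ≤
        99 / 100 * (auxFun f B L y h - auxFun f B L y z) + η ^ 90 := fun z hz => by
    linarith [hstep z, herr z hz]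
  refine ⟨?_, hall⟩
  -- Comparison with z = 0, where Γ vanishes, keeps the next iterate in {Γ ≤ 1}.
  have h9 := hall 0 (by rw [normB_zero]; positivity)
  rw [auxFun_zero] at h9
  have h10 : 100 * P ^ 0 * η ^ (0 + 1) ≤ η ^ 0 := hs.absorb 0 0 (by norm_num) (by norm_num)
  have h11 : η ^ 90 ≤ η ^ 1 := hs.pow_le_pow (by norm_num)
  norm_num at h10
  linarith

theorem auxLoop_spec {Q : FQParams} (hQL : Q.L = L) (hQZ : Q.lamMax = Z)
    (hJ : (1 / 2 : ℝ) ^ Q.dualSteps ≤ η ^ 100) (n : ℕ) :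
    ∀ h : Vec d, auxFun f B L y h ≤ 1 →
    auxFun f B L y ((auxLoop B Q y n h).run f B).1 ≤ 1 ∧ ∀ z, normB B z ≤ 6 * P →
      auxFun f B L y ((auxLoop B Q y n h).run f B).1 - auxFun f B L y z ≤
        (99 / 100) ^ n * (auxFun f B L y h - auxFun f B L y z)
          + 100 * (1 - (99 / 100) ^ n) * η ^ 90 := by
  induction n with
  | zero =>
    intro h hh
    rw [auxLoop, OracleProg.run_pure]
    exact ⟨hh, fun z _ => by simp⟩
  | succ n ih =>
    intro h hh
    obtain ⟨h1, h2⟩ := auxStep_spec hB hμ hf hc hs hD hy hQL hQZ hJ hh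
    rw [auxLoop, OracleProg.run_bind]
    set p := ((auxStep B Q y h).run f B).1
    obtain ⟨h3, h4⟩ := ih p h1
    refine ⟨h3, fun z hz => ?_⟩
    have h5 := mul_le_mul_of_nonneg_left (h2 z hz) (by positivity : (0 : ℝ) ≤ (99 / 100) ^ n)
    rw [pow_succ]
    linarith [h4 z hz]

/-- The output of the auxiliary minimization is an almost stationary point of the auxiliary
function. -/
theorem approxAuxMin_spec {Q : FQParams} (hQL : Q.L = L) (hQZ : Q.lamMax = Z)
    (hJ : (1 / 2 : ℝ) ^ Q.dualSteps ≤ η ^ 100) (hK : (99 / 100 : ℝ) ^ Q.auxSteps ≤ η ^ 100) :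
    ∃ h : Vec d, ((approxAuxMin B Q y).run f B).1 = y + h ∧ normB B h ≤ 5 * P ∧
      ∀ u, |auxDer f B L y h u| ≤ η ^ 30 * normB B u := by
  obtain ⟨h1, h2⟩ := auxLoop_spec hB hμ hf hc hs hD hy hQL hQZ hJ Q.auxSteps 0
    (by rw [auxFun_zero]; exact zero_le_one)
  refine ⟨((auxLoop B Q y Q.auxSteps 0).run f B).1, ?_, ?_, ?_⟩
  · rw [approxAuxMin, OracleProg.run_bind, OracleProg.run_pure]
  · exact normB_le_of_auxFun_le hB hμ hf hc hs hD hy h1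
  have hhn := normB_le_of_auxFun_le hB hμ hf hc hs hD hy h1
  set h := ((auxLoop B Q y Q.auxSteps 0).run f B).1
  have hP := hs.P_pos
  have hP1 := hs.le_P
  have hη := hs.η_pos
  have hη1 := hs.η_le_one
  have hL := hs.L_pos
  have hgap : ∀ z, normB B z ≤ 6 * P → auxFun f B L y h - auxFun f B L y z ≤ η ^ 80 := by
    intro z hz
    have h3 := neg_mul_normB_le_auxFun hB hμ hf hc hs hD hy z
    have h4 : 0 ≤ normB B z ^ 4 / (56 * P) := by
      have := normB_nonneg (B := B) z; positivity
    have h5 : P * normB B z ≤ P * (6 * P) := by gcongr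
    have h6 := h2 z hz
    rw [auxFun_zero] at h6
    have h7 : (99 / 100 : ℝ) ^ Q.auxSteps * (0 - auxFun f B L y z) ≤ η ^ 100 * (6 * P ^ 2) :=
      (mul_le_mul_of_nonneg_left (by linarith) (by positivity)).trans
        (mul_le_mul_of_nonneg_right hK (by positivity))
    have h8 : 6 * P ^ 2 * η ^ (99 + 1) ≤ η ^ 99 := hs.absorb 2 99 (by norm_num) (by norm_num)
    have h9 : η ^ 99 ≤ η ^ 90 := hs.pow_le_pow (by norm_num)
    have h10 : 101 * P ^ 0 * η ^ (89 + 1) ≤ η ^ 89 := hs.absorb 0 89 (by norm_num) (by norm_num)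
    have h11 : η ^ 89 ≤ η ^ 80 := hs.pow_le_pow (by norm_num)
    have h12 : 100 * (1 - (99 / 100 : ℝ) ^ Q.auxSteps) * η ^ 90 ≤ 100 * η ^ 90 := by
      have : (0 : ℝ) ≤ (99 / 100) ^ Q.auxSteps := by positivity
      have : 0 ≤ η ^ 90 := by positivity
      nlinarith
    norm_num at h8 h10
    linarith
  -- A nearly minimal value forces a small gradient. A move of length η⁴⁰ along u can gain at most
  -- η⁸⁰, while its second-order cost is at most 1000P³η⁸⁰; dividing by η⁴⁰ leaves a slope of at
  -- most 1001P³η⁴⁰.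
  have hlow : ∀ u, normB B u ≤ 1 → -auxDer f B L y h u ≤ η ^ 30 := by
    intro u hu
    have hu0 := normB_nonneg (B := B) u
    have hh0 := normB_nonneg (B := B) h
    have ht1 : η ^ 40 ≤ 1 := pow_le_one₀ hη.le hη1
    have hz : normB B (h + η ^ 40 • u) ≤ 6 * P := by
      refine (normB_add_le hB _ _).trans ?_
      rw [normB_smul, abs_of_pos (by positivity)]
      nlinarith
    have h3 := hgap _ hz
    have h4 := auxFun_add_le hB hμ hL hf hc y h (η ^ 40 • u)
    have h5 := refBreg_smul_le hB hμ hL hf hc y h u (t := η ^ 40) (by positivity) ht1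
    have h6 : refBreg f B L y h u ≤ 50 * P ^ 3 := by
      have a1 : snd f y u u ≤ P := (le_abs_self _).trans ((hD.snd y hy u u).trans (by
        calc P * normB B u * normB B u ≤ P * 1 * 1 := by gcongr
          _ = P := by ring))
      have a2 : |ipB B h u| ≤ 5 * P := (abs_ipB_le hB h u).trans (by
        calc normB B h * normB B u ≤ 5 * P * 1 := by gcongr
          _ = _ := by ring)
      have a3 : normSqB B u ≤ 1 := by rw [← normB_sq hB]; exact pow_le_one₀ hu0 hu
      have a4 : normSqB B h ≤ (5 * P) ^ 2 := by rw [← normB_sq hB]; gcongr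
      have a5 := normSqB_nonneg hB u
      have a6 := normSqB_nonneg hB h
      have a7 : (2 * ipB B h u + normSqB B u) ^ 2 ≤ (11 * P) ^ 2 := by
        have := abs_le.1 a2
        apply sq_le_sq'
        all_goals linarith
      have a8 : 2 * normSqB B h * normSqB B u ≤ 50 * P ^ 2 := by
        calc 2 * normSqB B h * normSqB B u ≤ 2 * (5 * P) ^ 2 * 1 := by gcongr
          _ = _ := by ring
      have a9 : L / 4 * ((2 * ipB B h u + normSqB B u) ^ 2 + 2 * normSqB B h * normSqB B u) ≤
          P / 4 * ((11 * P) ^ 2 + 50 * P ^ 2) := by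
        gcongr; exact hs.L_le
      have a10 : P ≤ P ^ 3 := le_self_pow₀ (by linarith) (by norm_num)
      rw [refBreg]
      have : 0 < P ^ 3 := by positivity
      linarith
    rw [auxDer_smul] at h4
    have hr := relSmooth_bounds
    have h7 : relSmooth * refBreg f B L y h (η ^ 40 • u) ≤
        2 * (10 * (η ^ 40) ^ 2 * (50 * P ^ 3)) := by
      calc relSmooth * refBreg f B L y h (η ^ 40 • u)
          ≤ 2 * refBreg f B L y h (η ^ 40 • u) :=
            mul_le_mul_of_nonneg_right (by linarith) (refBreg_nonneg hB hμ hL hf hc y h _)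
        _ ≤ 2 * (10 * (η ^ 40) ^ 2 * refBreg f B L y h u) := by linarith
        _ ≤ _ := by gcongr
    have h8 : η ^ 40 * -auxDer f B L y h u ≤ η ^ 40 * (1001 * P ^ 3 * η ^ (39 + 1)) := by
      have e2 : (1 : ℝ) ≤ P ^ 3 := one_le_pow₀ (by linarith)
      have e4 := mul_le_mul_of_nonneg_left e2 (by positivity : 0 ≤ η ^ 80)
      have e5 : 2 * (10 * (η ^ 40) ^ 2 * (50 * P ^ 3)) = 1000 * (η ^ 80 * P ^ 3) := by ring
      have e6 : η ^ 40 * (1001 * P ^ 3 * η ^ (39 + 1)) = 1001 * (η ^ 80 * P ^ 3) := by ring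
      rw [e6]
      rw [e5] at h7
      linarith
    have h9 := le_of_mul_le_mul_left h8 (by positivity)
    exact h9.trans ((hs.absorb 3 39 (by norm_num) (by norm_num)).trans
      (hs.pow_le_pow (by norm_num)))
  intro u
  by_cases hu : u = 0
  · simp [hu, auxDer, snd, tri, ipB, normB_zero]
  have hpu := normB_pos hB hu
  have hone : ∀ s : ℝ, |s| = 1 → normB B ((s * (normB B u)⁻¹) • u) ≤ 1 := by
    intro s hs1
    rw [normB_smul, abs_mul, hs1, one_mul, abs_of_pos (inv_pos.2 hpu), inv_mul_cancel₀ hpu.ne']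
  have k1 := hlow _ (hone 1 (by norm_num))
  have k2 := hlow _ (hone (-1) (by norm_num))
  rw [auxDer_smul] at k1 k2
  have e : normB B u * ((normB B u)⁻¹ * auxDer f B L y h u) = auxDer f B L y h u :=
    mul_inv_cancel_left₀ hpu.ne' _
  have k3 := mul_le_mul_of_nonneg_left k1 hpu.le
  have k4 := mul_le_mul_of_nonneg_left k2 hpu.le
  rw [abs_le]
  constructor <;> linarith

end AuxMin

/-! ### Trials and the search for `ρ` -/

section Search

/-- The step `a` of a trial of `ρ`. -/
noncomputable def stepOf (L A ρ : ℝ) : ℝ := (1 + √(1 + 4 * L * A * ρ)) / (2 * L * ρ)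

/-- The weight `τ` of a trial of `ρ`. -/
noncomputable def tauOf (L A ρ : ℝ) : ℝ := stepOf L A ρ / (A + stepOf L A ρ)

/-! ### The step and the weight as functions of ρ -/

section Step

variable {L A ρ : ℝ} (hL : 0 < L) (hA : 0 ≤ A) (hρ : 0 < ρ)
include hL hA hρ

theorem stepOf_pos : 0 < stepOf L A ρ := by
  unfold stepOf; positivity

theorem stepOf_sq : L * ρ * stepOf L A ρ ^ 2 = A + stepOf L A ρ := by
  have hs : √(1 + 4 * L * A * ρ) ^ 2 = 1 + 4 * L * A * ρ := Real.sq_sqrt (by positivity)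
  unfold stepOf
  generalize √(1 + 4 * L * A * ρ) = s at hs ⊢
  field_simp
  linarith

theorem tauOf_eq : tauOf L A ρ = 2 / (1 + √(1 + 4 * L * A * ρ)) := by
  have h1 := stepOf_pos hL hA hρ
  rw [tauOf, ← stepOf_sq hL hA hρ]
  have h2 : L * ρ * stepOf L A ρ = (1 + √(1 + 4 * L * A * ρ)) / 2 := by
    unfold stepOf; field_simp
  have h3 : L * ρ * stepOf L A ρ ^ 2 = (L * ρ * stepOf L A ρ) * stepOf L A ρ := by ring
  rw [h3, h2]
  field_simp

theorem tauOf_nonneg : 0 ≤ tauOf L A ρ := by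
  rw [tauOf_eq hL hA hρ]; positivity

theorem tauOf_le_one : tauOf L A ρ ≤ 1 := by
  have h := stepOf_pos hL hA hρ
  rw [tauOf]
  exact div_le_one_of_le₀ (by linarith) (by linarith)

/-- Computed from τ = 2/(1 + √(1 + 4LAρ)). The bound does not involve A, so nearby values of ρ have
nearby points y in every iteration. -/
theorem tauOf_sub_le {ρ' : ℝ} (h : ρ ≤ ρ') :
    |tauOf L A ρ - tauOf L A ρ'| ≤ (ρ' - ρ) / ρ := by
  have hρ' := hρ.trans_le h
  rw [tauOf_eq hL hA hρ, tauOf_eq hL hA hρ']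
  have hs : √(1 + 4 * L * A * ρ) ^ 2 = 1 + 4 * L * A * ρ := Real.sq_sqrt (by positivity)
  have hs' : √(1 + 4 * L * A * ρ') ^ 2 = 1 + 4 * L * A * ρ' := Real.sq_sqrt (by positivity)
  have h1 : 1 ≤ √(1 + 4 * L * A * ρ) := Real.one_le_sqrt.2 (by
    have : 0 ≤ 4 * L * A * ρ := by positivity
    linarith)
  have h2 : √(1 + 4 * L * A * ρ) ≤ √(1 + 4 * L * A * ρ') := by gcongr
  set s := √(1 + 4 * L * A * ρ)
  set s' := √(1 + 4 * L * A * ρ')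
  have e : 2 / (1 + s) - 2 / (1 + s') = 2 * (s' - s) / ((1 + s) * (1 + s')) := by
    have : 1 + s ≠ 0 := by linarith
    have : 1 + s' ≠ 0 := by linarith
    field_simp; ring
  rw [e, abs_of_nonneg (by apply div_nonneg <;> nlinarith), div_le_div_iff₀ (by nlinarith) hρ]
  have e2 : (s' - s) * ρ * (s' + s) = (s - 1) * (s + 1) * (ρ' - ρ) := by
    linear_combination ρ * hs' - ρ' * hs
  have h3 : 0 < s' + s := by linarith
  refine le_of_mul_le_mul_right ?_ h3
  have h4 : 0 ≤ ρ' - ρ := by linarith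
  calc 2 * (s' - s) * ρ * (s' + s) = 2 * ((s' - s) * ρ * (s' + s)) := by ring
    _ = (ρ' - ρ) * ((1 + s) * (2 * (s - 1))) := by rw [e2]; ring
    _ ≤ (ρ' - ρ) * ((1 + s) * ((1 + s') * (s' + s))) := by
        gcongr <;> linarith
    _ = _ := by ring

end Step

/-- The inputs of the method in terms of the scales. -/
structure GoodParams (Q : FQParams) (L η Z : ℝ) : Prop where
  L_eq : Q.L = L
  rhoMinus : Q.rhoMinus = η
  rhoPlus : Q.rhoPlus = Z
  epsFs : 0 ≤ Q.epsFs
  epsAam : Q.epsAam = η ^ 16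
  lamMax : Q.lamMax = Z
  dual : (1 / 2 : ℝ) ^ Q.dualSteps ≤ η ^ 100
  aux : (99 / 100 : ℝ) ^ Q.auxSteps ≤ η ^ 100
  rho : (1 / 2 : ℝ) ^ Q.rhoSteps ≤ η ^ 100

/-! ### Sizes of the tolerances δ and Qε_aam^{1/4} -/

section Tolerances

variable {L P η Z : ℝ} {Q : FQParams} (hs : Scales L P η Z) (hQ : GoodParams Q L η Z)
include hs hQ

/-- When the stopping test fails at ρ⁻, this inequality places ρ⁻ on the correct side of the search
with margin δ. -/
theorem rhoTol_le_qConst : rhoTol Q ≤ qConst Q * Q.epsAam ^ (1 / 4 : ℝ) := by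
  have hη := hs.η_pos
  have hL := hs.L_pos
  have hZ := hs.Z_pos
  rw [rhoTol, qConst, hQ.L_eq, hQ.rhoPlus, hQ.epsAam, Real.div_rpow (by positivity) hL.le,
    ← Real.sqrt_eq_rpow (12 * η ^ 16 / L), Real.sqrt_div (by positivity),
    Real.sqrt_mul (by positivity), ← Real.sqrt_eq_rpow L]
  have h1 : √(η ^ 16) = η ^ 8 := by
    rw [show η ^ 16 = (η ^ 8) ^ 2 by ring]; exact Real.sqrt_sq (by positivity)
  have h2 : (η ^ 16) ^ (1 / 4 : ℝ) = η ^ 4 := by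
    rw [show η ^ 16 = (η ^ 4) ^ 4 by ring, one_div]
    exact_mod_cast Real.pow_rpow_inv_natCast (by positivity : 0 ≤ η ^ 4) four_ne_zero
  have h3 : √12 ≤ 5 := Real.sqrt_le_iff.2 (by norm_num)
  have h4 : √12 * η ^ 8 / √L ≤ 5 / √L * η ^ 4 := by
    rw [div_mul_eq_mul_div]
    have := hs.pow_le_pow (m := 4) (n := 8) (by norm_num)
    gcongr
  rw [h1, h2, add_mul]
  refine add_le_add (le_of_eq ?_) h4
  ring

theorem qConst_le : qConst Q * Q.epsAam ^ (1 / 4 : ℝ) ≤ η ^ 2 := by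
  have hη := hs.η_pos
  have hL := hs.L_pos
  have hZ := hs.Z_pos
  have hP := hs.P_pos
  have hP1 : 1 ≤ P := by linarith [hs.le_P]
  rw [qConst, hQ.L_eq, hQ.rhoPlus, hQ.epsAam]
  have h2 : (η ^ 16) ^ (1 / 4 : ℝ) = η ^ 4 := by
    rw [show η ^ 16 = (η ^ 4) ^ 4 by ring, one_div]
    exact_mod_cast Real.pow_rpow_inv_natCast (by positivity : 0 ≤ η ^ 4) four_ne_zero
  have hLP : 1 / P ≤ L := by rw [div_le_iff₀ hP]; linarith [hs.one_le]
  have hroot : ∀ t : ℝ, 0 < t → t ≤ 1 → 1 / L ^ t ≤ P := by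
    intro t h0 h1
    have : 1 / P ≤ L ^ t := by
      calc 1 / P = (1 / P) ^ (1 : ℝ) := (Real.rpow_one _).symm
        _ ≤ (1 / P) ^ t := Real.rpow_le_rpow_of_exponent_ge (by positivity)
            ((div_le_one hP).2 hP1) h1
        _ ≤ L ^ t := Real.rpow_le_rpow (by positivity) hLP h0.le
    rw [div_le_iff₀ (by positivity)]
    rw [div_le_iff₀ hP] at this
    linarith
  have hZr : Z ^ (1 / 2 : ℝ) ≤ P / η := by
    rw [← Real.sqrt_eq_rpow]
    refine Real.sqrt_le_iff.2 ⟨by positivity, ?_⟩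
    have h3 : Z ≤ P / η := by rw [le_div_iff₀ hη]; exact hs.Z_le
    have h4 : 1 ≤ P / η := by rw [le_div_iff₀ hη]; linarith [hs.η_le_one]
    nlinarith
  rw [h2]
  have e1 : 6 * Z ^ (1 / 2 : ℝ) / L ^ (1 / 4 : ℝ) ≤ 6 * (P / η) * P := by
    rw [← mul_one_div]
    have := hroot (1 / 4) (by norm_num) (by norm_num)
    gcongr
  have e2 : 5 / L ^ (1 / 2 : ℝ) ≤ 5 * P := by
    rw [← mul_one_div]
    have := hroot (1 / 2) (by norm_num) (by norm_num)
    gcongr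
  calc _ ≤ (6 * (P / η) * P + 5 * P) * η ^ 4 := by gcongr
    _ = (12 * P ^ 2 * η ^ (2 + 1) + 10 * P ^ 1 * η ^ (3 + 1)) / 2 := by field_simp; ring
    _ ≤ (η ^ 2 + η ^ 3) / 2 := by
        have := hs.absorb (C := 12) 2 2 (by norm_num) (by norm_num)
        have := hs.absorb (C := 10) 1 3 (by norm_num) (by norm_num)
        gcongr
    _ ≤ η ^ 2 := by have := hs.pow_le_pow (m := 2) (n := 3) (by norm_num); linarith

theorem rhoTol_le : rhoTol Q ≤ η ^ 2 := (rhoTol_le_qConst hs hQ).trans (qConst_le hs hQ)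

/-- The tolerance must also not be too small: it has to exceed the variation of ‖h‖² over the final
interval of the search. -/
theorem le_rhoTol : η ^ 8 / P ≤ rhoTol Q := by
  have hη := hs.η_pos
  have hL := hs.L_pos
  have hZ := hs.Z_pos
  have hP := hs.P_pos
  have hP1 := hs.le_P
  rw [rhoTol, hQ.L_eq, hQ.rhoPlus, hQ.epsAam, ← Real.sqrt_eq_rpow (12 * η ^ 16 / L)]
  have h1 : η ^ 8 / P ≤ √(12 * η ^ 16 / L) := by
    apply Real.le_sqrt_of_sq_le
    rw [div_pow, div_le_div_iff₀ (by positivity) hL, ← pow_mul]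
    have : L ≤ 12 * P ^ 2 := by nlinarith [hs.L_le]
    calc η ^ 16 * L ≤ η ^ 16 * (12 * P ^ 2) := by gcongr
      _ = _ := by ring
  have h2 : 0 ≤ 6 * (η ^ 16 / L) ^ (1 / 4 : ℝ) * Z ^ (1 / 2 : ℝ) := by positivity
  linarith

end Tolerances

variable {d : ℕ} {B : Matrix (Fin d) (Fin d) ℝ} {f : Vec d → ℝ} {L μ : ℝ}
  {xs x v : Vec d} {R P η Z A : ℝ} {Q : FQParams}

/-- The outcome `t` of the trial of `ρ`, with the point `y` and the displacement `h = x' - y`. -/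
structure TrialSpec (f : Vec d → ℝ) (B : Matrix (Fin d) (Fin d) ℝ) (L P η A : ℝ) (xs x v : Vec d)
    (R ρ : ℝ) (t : Trial d) (y h : Vec d) : Prop where
  a_eq : t.a = stepOf L A ρ
  y_eq : y = (1 - tauOf L A ρ) • x + tauOf L A ρ • v
  x_eq : t.x = y + h
  zeta_eq : t.zeta = normSqB B h
  h_le : normB B h ≤ 5 * P
  der : ∀ u, |auxDer f B L y h u| ≤ η ^ 30 * normB B u
  y_le : normB B (y - xs) ≤ R

variable (hB : B.PosDef) (hμ : 0 < μ) (hf : IsSmoothOfDegree 3 B L f)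
  (hc : IsUniformlyConvexOfDegree 4 B μ f) (hs : Scales L P η Z)
  (hD : DiffBounds f B xs R P) (hx : normB B (x - xs) ≤ R) (hv : normB B (v - xs) ≤ R)
  (hA : 0 ≤ A) (hQ : GoodParams Q L η Z) (hR : R ≤ P)

include hB hμ hf hc hs hD hx hv hA hQ in
theorem tryRho_spec {ρ : ℝ} (hρ : 0 < ρ) :
    ∃ y h, TrialSpec f B L P η A xs x v R ρ ((tryRho B Q x v A ρ).run f B).1 y h := by
  set y := (1 - tauOf L A ρ) • x + tauOf L A ρ • v with hydef
  have hy : normB B (y - xs) ≤ R := normB_lineMap_sub_le hB hx hv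
    (tauOf_nonneg hs.L_pos hA hρ) (tauOf_le_one hs.L_pos hA hρ)
  obtain ⟨h, h1, h2, h3⟩ := approxAuxMin_spec hB hμ hf hc hs hD hy hQ.L_eq hQ.lamMax hQ.dual hQ.aux
  have hrun : ((tryRho B Q x v A ρ).run f B).1 = ⟨stepOf L A ρ, ((approxAuxMin B Q y).run f B).1,
      normSqB B (((approxAuxMin B Q y).run f B).1 - y)⟩ := by
    rw [tryRho, OracleProg.run_bind, OracleProg.run_pure]
    simp only [hQ.L_eq, hydef, tauOf, stepOf]
  refine ⟨y, h, ?_⟩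
  rw [hrun]
  exact ⟨rfl, hydef, h1, by simp [h1], h2, h3, hy⟩

include hB hμ hf hc hs hD hx hv hA hR in
/-- Trials of close values have close outcomes. -/
theorem TrialSpec.abs_zeta_sub_le {ρ ρ' : ℝ} {t t' : Trial d} {y h y' h' : Vec d}
    (ht : TrialSpec f B L P η A xs x v R ρ t y h)
    (ht' : TrialSpec f B L P η A xs x v R ρ' t' y' h') (hρ : η ≤ ρ) (hρρ' : ρ ≤ ρ')
    (hclose : ρ' - ρ ≤ η ^ 50) : |t.zeta - t'.zeta| ≤ 10 * P * η ^ 9 := by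
  have hη := hs.η_pos
  have hL := hs.L_pos
  have hP := hs.P_pos
  have hP1 := hs.le_P
  have hρ0 : 0 < ρ := hη.trans_le hρ
  have hdy : normB B (y - y') ≤ η ^ 40 := by
    have e : y - y' = (tauOf L A ρ - tauOf L A ρ') • (v - x) := by
      rw [ht.y_eq, ht'.y_eq]; module
    have h1 : normB B (v - x) ≤ 2 * P := by
      have := normB_sub_le_add hB v xs x
      rw [normB_sub_comm xs x] at this
      linarith
    have h2 : (ρ' - ρ) / ρ ≤ η ^ 49 := by
      rw [div_le_iff₀ hρ0]
      calc ρ' - ρ ≤ η ^ 49 * η := hclose.trans (le_of_eq (by ring))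
        _ ≤ η ^ 49 * ρ := by gcongr
    rw [e, normB_smul]
    calc _ ≤ η ^ 49 * (2 * P) := by
          gcongr
          · exact normB_nonneg _
          · exact (tauOf_sub_le hL hA hρ0 hρρ').trans h2
      _ = 2 * P ^ 1 * η ^ (48 + 1) := by ring
      _ ≤ η ^ 48 := hs.absorb 1 48 (by norm_num) (by norm_num)
      _ ≤ η ^ 40 := hs.pow_le_pow (by norm_num)
  set w := h - h' with hw
  have hm1 := le_auxFun_add hB hμ hL hf hc y h' w
  have hm2 := le_auxFun_add hB hμ hL hf hc y h ((-1 : ℝ) • w)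
  rw [show h' + w = h by rw [hw]; abel] at hm1
  rw [show h + (-1 : ℝ) • w = h' by rw [hw]; module, auxDer_smul] at hm2
  have hb1 := normB_pow_four_le_refBreg hB hμ hL hf hc y h' w
  have hb2 := normB_pow_four_le_refBreg hB hμ hL hf hc y h ((-1 : ℝ) • w)
  rw [normB_smul, abs_neg, abs_one, one_mul] at hb2
  have hr := relSmooth_bounds
  have hw0 := normB_nonneg (B := B) w
  have hh0 := normB_nonneg (B := B) h'
  have hdy0 := normB_nonneg (B := B) (y - y')
  -- Strong monotonicity of ∇Γ at the common point y: the sum of the two convexity inequalities has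
  -- coefficient 2(2 - M)/16 > 1/28, where M is `relSmooth`, and L ≥ 1/P.
  have hmono : normB B w ^ 4 ≤ 28 * P * (auxDer f B L y h w - auxDer f B L y h' w) := by
    have k0 : 0 ≤ normB B w ^ 4 := by positivity
    have k1 : L / 28 * normB B w ^ 4 ≤ auxDer f B L y h w - auxDer f B L y h' w := by
      have k2 : 0 ≤ L / 16 * normB B w ^ 4 := by positivity
      nlinarith
    have k3 : normB B w ^ 4 ≤ P * L * normB B w ^ 4 := le_mul_of_one_le_left k0 hs.one_le
    have k4 := mul_le_mul_of_nonneg_left k1 (by positivity : 0 ≤ 28 * P)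
    linarith
  have hdiff : |auxDer f B L y h' w - auxDer f B L y' h' w| ≤
      20 * P ^ 3 * η ^ 40 * normB B w := by
    have d1 := hD.abs_fderiv_sub_le hB hf ht'.y_le ht.y_le w
    have d2 := hD.abs_snd_sub_le hB hf ht'.y_le ht.y_le h' w
    have d3 := hf.abs_tri_sub_le hB y' y w h'
    rw [hf.tri_swap_left y, hf.tri_swap_right y, hf.tri_swap_left y', hf.tri_swap_right y'] at d3
    have d1' : P * normB B (y - y') * normB B w ≤ P ^ 3 * η ^ 40 * normB B w := by
      have : P ≤ P ^ 3 := le_self_pow₀ (by linarith) (by norm_num)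
      gcongr
    have d2' : P * normB B (y - y') * normB B h' * normB B w ≤
        5 * (P ^ 3 * η ^ 40 * normB B w) := by
      calc _ ≤ P * η ^ 40 * (5 * P) * normB B w := by gcongr; exact ht'.h_le
        _ = 5 * (P ^ 2 * η ^ 40 * normB B w) := by ring
        _ ≤ _ := by
          have : P ^ 2 ≤ P ^ 3 := pow_le_pow_right₀ (by linarith) (by norm_num)
          gcongr
    have d3' : L * normB B (y - y') * normB B w * normB B h' ^ 2 ≤
        25 * (P ^ 3 * η ^ 40 * normB B w) := by
      calc _ ≤ P * η ^ 40 * normB B w * (5 * P) ^ 2 := by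
            gcongr
            · exact hs.L_le
            · exact ht'.h_le
        _ = _ := by ring
    have e : auxDer f B L y h' w - auxDer f B L y' h' w = (fderiv ℝ f y w - fderiv ℝ f y' w)
        + (snd f y h' w - snd f y' h' w) + (tri f y h' h' w - tri f y' h' h' w) / 2 := by
      simp only [auxDer]; ring
    rw [e]
    rw [abs_le] at *
    constructor <;> linarith
  have ha1 := (abs_le.1 (ht.der w)).2
  have ha2 := (abs_le.1 (ht'.der w)).1
  have ha3 := (abs_le.1 hdiff).1
  have hw4 : normB B w ^ 4 ≤ η ^ 28 * normB B w := by
    have h40 : η ^ 40 ≤ η ^ 30 := hs.pow_le_pow (by norm_num)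
    have hP3 : 1 ≤ P ^ 3 := one_le_pow₀ (by linarith)
    calc normB B w ^ 4 ≤ 28 * P * (auxDer f B L y h w - auxDer f B L y h' w) := hmono
      _ ≤ 28 * P * (2 * (η ^ 30 * normB B w) + 20 * P ^ 3 * η ^ 40 * normB B w) := by
          gcongr; linarith
      _ ≤ 28 * P * (2 * (P ^ 3 * η ^ 30 * normB B w) + 20 * P ^ 3 * η ^ 30 * normB B w) := by
          gcongr
          exact le_mul_of_one_le_left (by positivity) hP3
      _ = 616 * P ^ 4 * η ^ (29 + 1) * normB B w := by ring
      _ ≤ η ^ 29 * normB B w :=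
          mul_le_mul_of_nonneg_right (hs.absorb 4 29 (by norm_num) (by norm_num)) hw0
      _ ≤ η ^ 28 * normB B w :=
          mul_le_mul_of_nonneg_right (hs.pow_le_pow (by norm_num)) hw0
  have hw9 : normB B w ≤ η ^ 9 := by
    by_contra! hlt
    have p9 : 0 < η ^ 9 := by positivity
    have k1 : normB B w ^ 3 ≤ η ^ 28 := by
      refine le_of_mul_le_mul_right ?_ (p9.trans hlt)
      linarith
    have k2 : (η ^ 9) ^ 3 < normB B w ^ 3 := pow_lt_pow_left₀ hlt p9.le (by norm_num)
    have k3 : η ^ 28 ≤ η ^ 27 := hs.pow_le_pow (by norm_num)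
    have k4 : (η ^ 9) ^ 3 = η ^ 27 := by ring
    linarith
  rw [ht.zeta_eq, ht'.zeta_eq, ← normB_sq hB, ← normB_sq hB]
  have f1 : normB B h ≤ normB B h' + normB B w := by
    simpa [hw] using normB_add_le hB h' w
  have f2 : normB B h' ≤ normB B h + normB B w := by
    simpa [hw] using normB_sub_le hB h w
  have f3 := ht.h_le
  have f4 := ht'.h_le
  have f5 := normB_nonneg (B := B) h
  have f6 : |normB B h - normB B h'| ≤ η ^ 9 := by rw [abs_le]; constructor <;> linarith
  rw [sq_sub_sq, abs_mul, abs_of_nonneg (by linarith : 0 ≤ normB B h + normB B h')]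
  calc _ ≤ (10 * P) * η ^ 9 := by gcongr; linarith
    _ = _ := rfl

-- The ends always satisfy ζ(lo) ≥ lo + δ and ζ(hi) + δ < hi, where ζ is the squared displacement of
-- a trial. Exhausting the steps would leave an interval of width at most η⁵⁰ on which ζ varies by
-- more than 2δ - η⁵⁰, against its near continuity; so an accepted trial is found.
include hB hμ hf hc hs hD hx hv hA hQ hR in
theorem rhoSearch_spec (n : ℕ) : ∀ lo hi : ℝ, η ≤ lo → lo < hi → hi ≤ Z →
    lo + rhoTol Q ≤ ((tryRho B Q x v A lo).run f B).1.zeta →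
    ((tryRho B Q x v A hi).run f B).1.zeta + rhoTol Q < hi →
    (hi - lo) * (1 / 2) ^ n ≤ η ^ 50 →
    ∃ ρ, η ≤ ρ ∧ ρ ≤ Z ∧
      ((rhoSearch B Q x v A n lo hi).run f B).1 = ((tryRho B Q x v A ρ).run f B).1 ∧
      |((tryRho B Q x v A ρ).run f B).1.zeta - ρ| ≤ rhoTol Q := by
  induction n with
  | zero =>
    intro lo hi hlo hlt hhi h1 h2 h3
    exfalso
    have hη := hs.η_pos
    have hP := hs.P_pos
    obtain ⟨y, h, ht⟩ := tryRho_spec hB hμ hf hc hs hD hx hv hA hQ (hη.trans_le hlo)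
    obtain ⟨y', h', ht'⟩ := tryRho_spec hB hμ hf hc hs hD hx hv hA hQ
      ((hη.trans_le hlo).trans hlt)
    rw [pow_zero, mul_one] at h3
    have h4 := (abs_le.1 (ht.abs_zeta_sub_le hB hμ hf hc hs hD hx hv hA hR ht' hlo hlt.le h3)).2
    have h5 := le_rhoTol hs hQ
    have h6 : 10 * P * η ^ 9 ≤ η ^ 8 / P := by
      rw [le_div_iff₀ hP]
      calc 10 * P * η ^ 9 * P = 10 * P ^ 2 * η ^ (8 + 1) := by ring
        _ ≤ η ^ 8 := hs.absorb 2 8 (by norm_num) (by norm_num)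
    have h7 : η ^ 50 ≤ η ^ 9 := hs.pow_le_pow (by norm_num)
    have h8 : 1 * η ^ 9 ≤ 10 * P * η ^ 9 := by
      gcongr
      linarith [hs.le_P]
    linarith
  | succ n ih =>
    intro lo hi hlo hlt hhi h1 h2 h3
    have h3' : (hi - lo) / 2 * (1 / 2) ^ n ≤ η ^ 50 := by
      rw [pow_succ] at h3
      linarith
    rw [rhoSearch, OracleProg.run_bind]
    simp only
    by_cases c1 : ((tryRho B Q x v A ((lo + hi) / 2)).run f B).1.zeta + rhoTol Q < (lo + hi) / 2
    · rw [if_pos c1]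
      exact ih lo ((lo + hi) / 2) hlo (by linarith) (by linarith) h1 c1
        (le_trans (le_of_eq (by ring)) h3')
    rw [if_neg c1]
    by_cases c2 : (lo + hi) / 2 < ((tryRho B Q x v A ((lo + hi) / 2)).run f B).1.zeta - rhoTol Q
    · rw [if_pos c2]
      exact ih ((lo + hi) / 2) hi (by linarith) (by linarith) hhi (by linarith) h2
        (le_trans (le_of_eq (by ring)) h3')
    rw [if_neg c2]
    refine ⟨(lo + hi) / 2, by linarith, by linarith, rfl, ?_⟩
    rw [abs_le]
    constructor <;> linarith

end Search

/-! ### The accelerated outer iteration -/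

section Outer

variable {d : ℕ} {B : Matrix (Fin d) (Fin d) ℝ} {f : Vec d → ℝ} {L μ : ℝ}
  {xs x v : Vec d} {R P η Z A : ℝ} {Q : FQParams}

/-- With A' = A + a, the relation Lρa² = A' gives √A' = a√(Lρ), and a = A' - A ≤ 4A'^{3/4}(A'^{1/4}
- A^{1/4}). So the increase of A^{1/4} is at least 1/(4X), where X⁴ = L²A'ρ². As a function of X⁴
this is convex, and the left side is its tangent at X₀⁴. Being affine in X⁴, the bound can be summed
over the iterations. -/
theorem le_fourth_root_add {L A a ρ X₀ : ℝ} (hL : 0 < L) (hA : 0 ≤ A) (ha : 0 < a) (hρ : 0 < ρ)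
    (h : L * ρ * a ^ 2 = A + a) (hX₀ : 0 < X₀) :
    √√A + 1 / (4 * X₀) * (5 / 4 - L ^ 2 * (A + a) * ρ ^ 2 / (4 * X₀ ^ 4)) ≤ √√(A + a) := by
  have hb' : √√(A + a) ^ 2 = √(A + a) := Real.sq_sqrt (Real.sqrt_nonneg _)
  have hb : √√A ^ 2 = √A := Real.sq_sqrt (Real.sqrt_nonneg _)
  have hc' : √(A + a) ^ 2 = A + a := Real.sq_sqrt (by positivity)
  have hc : √A ^ 2 = A := Real.sq_sqrt hA
  have hk : √(L * ρ) ^ 2 = L * ρ := Real.sq_sqrt (by positivity)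
  have hk0 : 0 < √(L * ρ) := Real.sqrt_pos.2 (by positivity)
  have hle : √√A ≤ √√(A + a) := Real.sqrt_le_sqrt (Real.sqrt_le_sqrt (by linarith))
  have hb0 : 0 ≤ √√A := Real.sqrt_nonneg _
  have hbp : 0 < √√(A + a) := Real.sqrt_pos.2 (Real.sqrt_pos.2 (by positivity))
  have hak : √(A + a) = a * √(L * ρ) := by
    rw [← h, Real.sqrt_mul (by positivity), Real.sqrt_sq ha.le, mul_comm]
  rw [← hb'] at hc' hak
  rw [← hb] at hc
  generalize √√(A + a) = b' at *
  generalize √√A = b at *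
  generalize √(L * ρ) = k at *
  have h1 : a ≤ 4 * b' ^ 3 * (b' - b) := by
    have e : 4 * b' ^ 3 * (b' - b) - (b' ^ 4 - b ^ 4) =
      (b' - b) ^ 2 * (3 * b' ^ 2 + 2 * b' * b + b ^ 2) := by ring
    have : 0 ≤ (b' - b) ^ 2 * (3 * b' ^ 2 + 2 * b' * b + b ^ 2) := by positivity
    have : b' ^ 4 - b ^ 4 = a := by linear_combination hc' - hc
    linarith
  have h2 : 1 ≤ 4 * (b' * k) * (b' - b) := by
    refine le_of_mul_le_mul_left ?_ (by positivity : 0 < b' ^ 2)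
    calc b' ^ 2 * 1 = a * k := by rw [mul_one, hak]
      _ ≤ 4 * b' ^ 3 * (b' - b) * k := by gcongr
      _ = _ := by ring
  have hX : L ^ 2 * (A + a) * ρ ^ 2 = (b' * k) ^ 4 := by
    rw [← hc']
    linear_combination -b' ^ 4 * (k ^ 2 + L * ρ) * hk
  rw [hX]
  have hXp : 0 < b' * k := by positivity
  generalize b' * k = X at *
  have h3 : 1 / (4 * X) ≤ b' - b := by
    rw [div_le_iff₀ (by positivity)]; linarith
  have h4 : 1 / (4 * X₀) * (5 / 4 - X ^ 4 / (4 * X₀ ^ 4)) ≤ 1 / (4 * X) := by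
    have e : 1 / (4 * X) - 1 / (4 * X₀) * (5 / 4 - X ^ 4 / (4 * X₀ ^ 4)) =
        (X - X₀) ^ 2 * (X ^ 3 + 2 * X ^ 2 * X₀ + 3 * X * X₀ ^ 2 + 4 * X₀ ^ 3)
          / (16 * X * X₀ ^ 5) := by
      field_simp
      ring
    have : 0 ≤ (X - X₀) ^ 2 * (X ^ 3 + 2 * X ^ 2 * X₀ + 3 * X * X₀ ^ 2 + 4 * X₀ ^ 3)
          / (16 * X * X₀ ^ 5) := by positivity
    linarith
  linarith

theorem ipB_inv_mulVec_gradVec (hB : B.PosDef) (z u : Vec d) :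
    ipB B (B⁻¹ *ᵥ gradVec f z) u = fderiv ℝ f z u := by
  have hu := (Matrix.isUnit_iff_isUnit_det B).1 hB.isUnit
  rw [ipB_comm hB, ipB, mulVec_mulVec, Matrix.mul_nonsing_inv _ hu, one_mulVec, dotProduct_comm,
    gradVec_dotProduct]

/-- Decrease of the potential in an accelerated proximal step with relative error. -/
theorem potential_decrease (hB : B.PosDef) (hμ : 0 < μ)
    (hc : IsUniformlyConvexOfDegree 4 B μ f) {a k : ℝ} (hA : 0 ≤ A) (ha : 0 < a) (hk : 0 < k)
    (hak : k * a ^ 2 = A + a) {h y : Vec d} (hy : y = (1 - a / (A + a)) • x + (a / (A + a)) • v)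
    (hg : ∀ u, |fderiv ℝ f (y + h) u + k * ipB B h u| ≤ k / 2 * normB B h * normB B u) :
    (A + a) * (f (y + h) - f xs)
        + normSqB B (v - a • (B⁻¹ *ᵥ gradVec f (y + h)) - xs) / 2
        + 3 / 8 * ((A + a) * k * normSqB B h)
      ≤ A * (f x - f xs) + normSqB B (v - xs) / 2 := by
  set g := fderiv ℝ f (y + h) with hgdef
  set w := B⁻¹ *ᵥ gradVec f (y + h) with hw
  have hwg : ∀ u, ipB B w u = g u := ipB_inv_mulVec_gradVec hB (y + h)
  have h1 := hc.apply_add_fderiv_le hμ (y + h) xs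
  have h2 := hc.apply_add_fderiv_le hμ (y + h) x
  rw [← hgdef] at h1 h2
  have hAa : 0 < A + a := by linarith
  -- The linear terms of the convexity inequalities at x and of the update of v combine into one
  -- term at y.
  have e1 : (A + a) • y = A • x + a • v := by
    rw [hy, smul_add, smul_smul, smul_smul]
    congr 2 <;> field_simp
    ring
  have e2 : (A + a) * g y = A * g x + a * g v := by
    have := congrArg g e1
    simpa using this
  have e3 : normSqB B (v - a • w - xs) =
      normSqB B (v - xs) - 2 * a * (g v - g xs) + a ^ 2 * normSqB B w := by
    have : v - a • w - xs = (v - xs) + (-a) • w := by module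
    rw [this, normSqB_add hB, ipB_smul_right, ipB_comm hB, hwg, normSqB_smul, map_sub]
    ring
  -- Testing the error bound with w + kh itself gives ‖w + kh‖ ≤ (k/2)‖h‖. Multiplied by a², with
  -- ka² = A + a, its square leaves a surplus of ¾(A + a)k‖h‖², half of which enters the potential.
  have h3 : normSqB B (w + k • h) ≤ (k / 2) ^ 2 * normSqB B h := by
    have h4 := hg (w + k • h)
    rw [← hwg, ← ipB_smul_left, ← ipB_add_left, ← normSqB_eq_ipB,
      abs_of_nonneg (normSqB_nonneg hB _), ← normB_sq hB] at h4
    have h5 := normB_nonneg (B := B) (w + k • h)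
    have h6 := normB_nonneg (B := B) h
    have h7 : normB B (w + k • h) ≤ k / 2 * normB B h := by
      by_contra! hlt
      have : 0 ≤ k / 2 * normB B h := by positivity
      nlinarith
    rw [← normB_sq hB, ← normB_sq hB, ← mul_pow]
    exact pow_le_pow_left₀ h5 h7 2
  rw [normSqB_add hB, ipB_smul_right, normSqB_smul, hwg] at h3
  have h8 := mul_le_mul_of_nonneg_left h3 (by positivity : 0 ≤ a ^ 2)
  simp only [map_sub, map_add] at h1 h2
  have h9 := mul_le_mul_of_nonneg_left h1 ha.le
  have h10 := mul_le_mul_of_nonneg_left h2 hA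
  rw [e3]
  have e4 : a ^ 2 * (normSqB B w + 2 * (k * g h) + k ^ 2 * normSqB B h) =
      a ^ 2 * normSqB B w + 2 * (A + a) * g h + (A + a) * k * normSqB B h := by
    rw [← hak]; ring
  have e5 : a ^ 2 * ((k / 2) ^ 2 * normSqB B h) = (A + a) * k * normSqB B h / 4 := by
    rw [← hak]; ring
  rw [e4, e5] at h8
  linarith

variable (hB : B.PosDef) (hμ : 0 < μ) (hf : IsSmoothOfDegree 3 B L f)
  (hc : IsUniformlyConvexOfDegree 4 B μ f) (hs : Scales L P η Z)

/-- At an almost stationary h only -L‖h‖²Bh and the Taylor remainder survive, so a tensor step is an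
inexact proximal step of weight L‖h‖². -/
theorem fderiv_eq_auxDer_add (y h u : Vec d) : fderiv ℝ f (y + h) u =
    auxDer f B L y h u - L * normSqB B h * ipB B h u + (fderiv ℝ f (y + h) u - fderiv ℝ f y u
      - snd f y h u - tri f y h h u / 2) := by
  rw [auxDer]; ring

include hB hf hs in
/-- The relative error of an accepted trial. -/
theorem TrialSpec.abs_fderiv_add_le {ρ : ℝ} {t : Trial d} {y h : Vec d}
    (ht : TrialSpec f B L P η A xs x v R ρ t y h) (hρ : η ≤ ρ) (hζ : |t.zeta - ρ| ≤ η ^ 2)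
    (u : Vec d) : ρ / 2 ≤ t.zeta ∧
      |fderiv ℝ f (y + h) u + L * ρ * ipB B h u| ≤ L * ρ / 2 * normB B h * normB B u := by
  have hη := hs.η_pos
  have hL := hs.L_pos
  have hP := hs.P_pos
  have hη1 : 100 * η ≤ 1 := by
    simpa using hs.absorb (C := 100) 0 0 (by norm_num) (by norm_num)
  have hη2 : η ^ 2 ≤ ρ / 100 := by nlinarith
  have hρ0 : 0 < ρ := hη.trans_le hρ
  rw [abs_le] at hζ
  refine ⟨by linarith, ?_⟩
  rw [ht.zeta_eq, ← normB_sq hB] at hζ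
  have hr0 := normB_nonneg (B := B) h
  have hu0 := normB_nonneg (B := B) u
  have hru := abs_ipB_le hB h u
  have hT := hf.abs_fderiv_add_sub_le hB y h u
  have hd := ht.der u
  rw [fderiv_eq_auxDer_add (B := B) (L := L), ← normB_sq hB]
  set T := fderiv ℝ f (y + h) u - fderiv ℝ f y u - snd f y h u - tri f y h h u / 2
  set r := normB B h
  set n := normB B u
  have hr : η ≤ r := by
    by_contra! hlt
    nlinarith
  -- The errors from ρ ≠ ‖h‖², from the Taylor remainder and from inexact stationarity are at most
  -- 1/100, 1/5 and 1/5 of Lρ‖h‖‖u‖, together less than one half.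
  have k1 : |L * (ρ - r ^ 2) * ipB B h u| ≤ L * (ρ / 100) * (r * n) := by
    rw [abs_mul, abs_mul, abs_of_pos hL]
    gcongr
    rw [abs_le]; constructor <;> linarith
  have k2 : L / 6 * r ^ 3 * n ≤ L * ρ / 5 * r * n := by
    have : L / 6 * r ^ 2 ≤ L * ρ / 5 := by nlinarith
    calc L / 6 * r ^ 3 * n = L / 6 * r ^ 2 * r * n := by ring
      _ ≤ _ := by gcongr
  have k3 : η ^ 30 * n ≤ L * ρ / 5 * r * n := by
    have l1 : η ^ 30 ≤ L * ρ / 5 * r := by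
      have l2 : 5 * P ^ 1 * η ^ (29 + 1) ≤ η ^ 29 := hs.absorb 1 29 (by norm_num) (by norm_num)
      have l3 : η ^ 29 ≤ η ^ 2 := hs.pow_le_pow (by norm_num)
      have l4 : η ^ 2 ≤ P * L * (ρ * r) := by
        calc η ^ 2 = 1 * (η * η) := by ring
          _ ≤ P * L * (ρ * r) := by gcongr; exact hs.one_le
      refine le_of_mul_le_mul_left ?_ (by positivity : 0 < 5 * P)
      calc 5 * P * η ^ 30 = 5 * P ^ 1 * η ^ (29 + 1) := by ring
        _ ≤ P * L * (ρ * r) := l2.trans (l3.trans l4)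
        _ = _ := by ring
    gcongr
  have e : auxDer f B L y h u - L * r ^ 2 * ipB B h u + T + L * ρ * ipB B h u
      = auxDer f B L y h u + T + L * (ρ - r ^ 2) * ipB B h u := by ring
  rw [e]
  have k4 : 0 ≤ L * ρ * r * n := by positivity
  rw [abs_le] at *
  constructor <;> linarith

include hB hμ hf hc hs in
/-- A trial with a small displacement is almost optimal. -/
theorem TrialSpec.sub_le_of_zeta_le {ρ : ℝ} {t : Trial d} {y h : Vec d}
    (ht : TrialSpec f B L P η A xs x v R ρ t y h) (hζ : t.zeta ≤ 2 * η) (hR : R ≤ P) :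
    f t.x - f xs ≤ Z * η := by
  have hη := hs.η_pos
  have hL := hs.L_pos
  have hP := hs.P_pos
  have hP1 := hs.le_P
  rw [ht.zeta_eq, ← normB_sq hB] at hζ
  have h1 := hc.apply_add_fderiv_le hμ (y + h) xs
  have hT := hf.abs_fderiv_add_sub_le hB y h (xs - (y + h))
  have hd := ht.der (xs - (y + h))
  have hi := abs_ipB_le hB h (xs - (y + h))
  rw [fderiv_eq_auxDer_add (B := B) (L := L), ← normB_sq hB] at h1
  rw [ht.x_eq]
  have hn : normB B (xs - (y + h)) ≤ 6 * P := by
    have k1 := normB_add_le hB (y - xs) h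
    rw [normB_sub_comm, show y + h - xs = (y - xs) + h by abel]
    linarith [ht.y_le, ht.h_le]
  set u := xs - (y + h)
  set T := fderiv ℝ f (y + h) u - fderiv ℝ f y u - snd f y h u - tri f y h h u / 2
  have hr0 := normB_nonneg (B := B) h
  have hu0 := normB_nonneg (B := B) u
  have hr1 := ht.h_le
  set r := normB B h
  set n := normB B u
  have k1 : |L * r ^ 2 * ipB B h u| ≤ 60 * P ^ 3 * η := by
    rw [abs_mul, abs_of_nonneg (by positivity)]
    calc L * r ^ 2 * |ipB B h u| ≤ P * (2 * η) * (5 * P * (6 * P)) := by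
          gcongr
          · exact hs.L_le
          · exact hi.trans (by gcongr)
      _ = _ := by ring
  have k2 : L / 6 * r ^ 3 * n ≤ 60 * P ^ 3 * η := by
    calc L / 6 * r ^ 3 * n ≤ L * (r ^ 2) * (r * n) := by
          have : 0 ≤ L * r ^ 3 * n := by positivity
          linarith
      _ ≤ P * (2 * η) * (5 * P * (6 * P)) := by gcongr; exact hs.L_le
      _ = _ := by ring
  have k3 : η ^ 30 * n ≤ 6 * P ^ 3 * η := by
    calc η ^ 30 * n ≤ η ^ 1 * (6 * P) :=
          mul_le_mul (hs.pow_le_pow (by norm_num)) hn hu0 (pow_pos hη 1).le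
      _ ≤ η ^ 1 * (6 * P ^ 3) := by
          have : P ≤ P ^ 3 := le_self_pow₀ (by linarith) (by norm_num)
          gcongr
      _ = _ := by ring
  have k4 : 126 * P ^ 3 * η ≤ Z * η := by
    gcongr
    exact (hs.mul_pow_le (by linarith) (by norm_num)).trans hs.le_Z
  rw [abs_le] at *
  linarith

/-- The point `v = x₀ - B⁻¹ G` of a state. -/
noncomputable def FQState.dualPt (B : Matrix (Fin d) (Fin d) ℝ) (x₀ : Vec d) (S : FQState d) : Vec d :=
  x₀ - B⁻¹ *ᵥ S.G

/-- The potential `A (f(x) - f(x*)) + ½ ‖v - x*‖²` of a state. -/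
noncomputable def FQState.potential (f : Vec d → ℝ) (B : Matrix (Fin d) (Fin d) ℝ)
    (x₀ xs : Vec d) (S : FQState d) : ℝ :=
  S.A * (f S.x - f xs) + normSqB B (S.dualPt B x₀ - xs) / 2

theorem run_fastQuarticStep (f : Vec d → ℝ) (B : Matrix (Fin d) (Fin d) ℝ) (Q : FQParams)
    (x₀ : Vec d) (S : FQState d) (v : Vec d) (t u : Trial d)
    (hv : v = x₀ - B⁻¹ *ᵥ S.G)
    (ht : t = ((tryRho B Q S.x v S.A Q.rhoMinus).run f B).1)
    (hu : u = ((rhoSearch B Q S.x v S.A Q.rhoSteps Q.rhoMinus Q.rhoPlus).run f B).1) :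
    ((fastQuarticStep B Q x₀ S).run f B).1 =
      if (1 + Q.epsFs) * t.zeta < Q.rhoMinus
          ∨ t.zeta - qConst Q * Q.epsAam ^ (1 / 4 : ℝ) < Q.rhoMinus then
        Sum.inl t.x
      else Sum.inr ⟨u.x, S.A + u.a, S.G + u.a • gradVec f u.x⟩ := by
  subst hv ht hu
  rw [fastQuarticStep, OracleProg.run_bind, run_askMetric]
  simp only
  rw [OracleProg.run_bind]
  simp only
  set t := ((tryRho B Q S.x (x₀ - B⁻¹ *ᵥ S.G) S.A Q.rhoMinus).run f B).1
  by_cases hcond : (1 + Q.epsFs) * t.zeta < Q.rhoMinus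
      ∨ t.zeta - qConst Q * Q.epsAam ^ (1 / 4 : ℝ) < Q.rhoMinus
  · rw [if_pos hcond, if_pos hcond, OracleProg.run_pure]
  · rw [if_neg hcond, if_neg hcond, OracleProg.run_bind]
    rfl

variable (hD : DiffBounds f B xs R P) (hR : R ≤ P) (hQ : GoodParams Q L η Z)
  (hxs : ∀ x, f xs ≤ f x)

/-- The effect of an iteration which does not end the method. -/
structure Progress (f : Vec d → ℝ) (B : Matrix (Fin d) (Fin d) ℝ) (L : ℝ) (x₀ xs : Vec d) (r : ℝ)
    (S S' : FQState d) (ρ : ℝ) : Prop where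
  rho_pos : 0 < ρ
  A_lt : S.A < S'.A
  A_eq : L * ρ * (S'.A - S.A) ^ 2 = S'.A
  potential_le : S'.potential f B x₀ xs + 3 / 16 * (S'.A * L * ρ ^ 2) ≤ S.potential f B x₀ xs
  x_le : ∀ M, r ≤ M → normB B (S.x - xs) ≤ M → normB B (S'.x - xs) ≤ M + 2 * r

-- The bound on the potential keeps v within r of x*, so the trials take place in the ball where P
-- is valid. Failure of the stopping test and the size of Z provide the two ends needed by the
-- search.
include hB hμ hf hc hs hD hR hQ hxs in
theorem fastQuarticStep_spec {x₀ : Vec d} {S : FQState d} {r : ℝ} (hr : 0 ≤ r) (hrR : r ≤ R)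
    (hA : 0 ≤ S.A) (hx : normB B (S.x - xs) ≤ R) (hpot : S.potential f B x₀ xs ≤ r ^ 2 / 2) :
    match ((fastQuarticStep B Q x₀ S).run f B).1 with
    | Sum.inl x => f x - f xs ≤ Z * η
    | Sum.inr S' => ∃ ρ, Progress f B L x₀ xs r S S' ρ := by
  have hη := hs.η_pos
  have hL := hs.L_pos
  have hP := hs.P_pos
  have hP1 := hs.le_P
  have hvr : normB B (S.dualPt B x₀ - xs) ≤ r := by
    apply le_of_sq_le_sq _ hr
    rw [normB_sq hB]
    have := mul_nonneg hA (sub_nonneg.2 (hxs S.x))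
    rw [FQState.potential] at hpot
    linarith
  have hv := hvr.trans hrR
  obtain ⟨y, h, ht⟩ := tryRho_spec hB hμ hf hc hs hD hx hv hA hQ hη
  rw [run_fastQuarticStep f B Q x₀ S (S.dualPt B x₀) _ _ rfl rfl rfl, hQ.rhoMinus, hQ.rhoPlus]
  have hq := qConst_le hs hQ
  have hη2 : η ^ 2 ≤ η ^ 1 := hs.pow_le_pow (by norm_num)
  set t := ((tryRho B Q S.x (S.dualPt B x₀) S.A η).run f B).1 with htdef
  split_ifs with hcond
  · refine ht.sub_le_of_zeta_le hB hμ hf hc hs ?_ hR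
    -- Either stopping test gives a squared displacement of at most 2η.
    have hz : 0 ≤ t.zeta := by rw [ht.zeta_eq]; exact normSqB_nonneg hB h
    have := hQ.epsFs
    rcases hcond with h1 | h1
    · nlinarith
    · linarith
  push Not at hcond
  have hZ : 26 * P ^ 2 ≤ Z := (hs.mul_pow_le (by linarith) (by norm_num)).trans hs.le_Z
  have hηZ : η < Z := by nlinarith [hs.η_le_one]
  obtain ⟨y₁, h₁, ht₁⟩ := tryRho_spec hB hμ hf hc hs hD hx hv hA hQ hs.Z_pos
  obtain ⟨ρ, hρη, hρZ, hrun, hζ⟩ := rhoSearch_spec hB hμ hf hc hs hD hx hv hA hQ hR Q.rhoSteps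
    η Z le_rfl hηZ le_rfl
    (by have := rhoTol_le_qConst hs hQ; linarith [hcond.2])
    (by
      have k1 := rhoTol_le hs hQ
      have k2 : normSqB B h₁ ≤ (5 * P) ^ 2 := by
        rw [← normB_sq hB]
        exact pow_le_pow_left₀ (normB_nonneg _) ht₁.h_le 2
      rw [ht₁.zeta_eq]
      nlinarith [hs.η_le_one])
    (by
      calc (Z - η) * (1 / 2) ^ Q.rhoSteps ≤ Z * η ^ 100 := by
            gcongr
            · exact hs.Z_pos.le
            · linarith
            · exact hQ.rho
        _ = Z * η * η ^ 99 := by ring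
        _ ≤ P * η ^ 99 := by gcongr; exact hs.Z_le
        _ = 1 * P ^ 1 * η ^ (98 + 1) := by ring
        _ ≤ η ^ 98 := hs.absorb 1 98 (by norm_num) (by norm_num)
        _ ≤ η ^ 50 := hs.pow_le_pow (by norm_num))
  rw [hrun]
  have hρ0 := hη.trans_le hρη
  obtain ⟨y₂, h₂, ht₂⟩ := tryRho_spec hB hμ hf hc hs hD hx hv hA hQ hρ0
  set u := ((tryRho B Q S.x (S.dualPt B x₀) S.A ρ).run f B).1
  have hacc := ht₂.abs_fderiv_add_le hB hf hs hρη (hζ.trans (rhoTol_le hs hQ))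
  have ha := stepOf_pos hL hA hρ0
  have hsq := stepOf_sq hL hA hρ0
  have hdec := potential_decrease (xs := xs) hB hμ hc hA ha (by positivity : 0 < L * ρ) hsq
    ht₂.y_eq fun w => (hacc w).2
  rw [← ht₂.a_eq] at ha hsq hdec
  have hx' : u.x = y₂ + h₂ := ht₂.x_eq
  rw [← hx'] at hdec
  have hv' : FQState.dualPt B x₀ ⟨u.x, S.A + u.a, S.G + u.a • gradVec f u.x⟩ =
      S.dualPt B x₀ - u.a • (B⁻¹ *ᵥ gradVec f u.x) := by
    simp only [FQState.dualPt, mulVec_add, mulVec_smul]; abel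
  have hhalf := (hacc 0).1
  rw [ht₂.zeta_eq] at hhalf
  have hA' : 0 < S.A + u.a := by linarith
  refine ⟨ρ, hρ0, by simpa using ha, ?_, ?_, ?_⟩
  · simpa using hsq
  · rw [FQState.potential, hv', FQState.potential]
    have : (S.A + u.a) * L * ρ * (ρ / 2) ≤ (S.A + u.a) * L * ρ * normSqB B h₂ := by gcongr
    simp only
    linarith
  · intro M hrM hxM
    have hy₂ : normB B (y₂ - xs) ≤ M := by
      rw [ht₂.y_eq]
      exact normB_lineMap_sub_le hB hxM (hvr.trans hrM) (tauOf_nonneg hL hA hρ0)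
        (tauOf_le_one hL hA hρ0)
    -- From A' ≥ a and Lρa² = A' one gets A'Lρ ≥ 1. The decrease of the potential then bounds the
    -- displacement by 2r, so the iterates cannot leave the ball.
    have k1 : 1 ≤ (S.A + u.a) * (L * ρ) := by
      refine le_of_mul_le_mul_right ?_ (by positivity : 0 < u.a ^ 2)
      calc 1 * u.a ^ 2 ≤ (S.A + u.a) ^ 2 := by nlinarith
        _ = (S.A + u.a) * (L * ρ) * u.a ^ 2 := by rw [mul_assoc, hsq]; ring
    have k2 : normSqB B h₂ ≤ (2 * r) ^ 2 := by
      have l1 := mul_nonneg hA'.le (sub_nonneg.2 (hxs u.x))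
      have l2 := normSqB_nonneg hB (S.dualPt B x₀ - u.a • (B⁻¹ *ᵥ gradVec f u.x) - xs)
      have l3 : 1 * normSqB B h₂ ≤ (S.A + u.a) * (L * ρ) * normSqB B h₂ :=
        mul_le_mul_of_nonneg_right k1 (normSqB_nonneg hB _)
      rw [FQState.potential] at hpot
      nlinarith
    have k3 : normB B h₂ ≤ 2 * r := by
      apply le_of_sq_le_sq _ (by linarith)
      rwa [normB_sq hB]
    change normB B (u.x - xs) ≤ _
    rw [hx', show y₂ + h₂ - xs = (y₂ - xs) + h₂ by abel]
    exact (normB_add_le hB _ _).trans (add_le_add hy₂ k3)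

end Outer

/-! ### One run and the restarted method -/

section Run

variable {d : ℕ} {B : Matrix (Fin d) (Fin d) ℝ} {f : Vec d → ℝ} {L μ : ℝ}
  {xs x₀ : Vec d} {R P η Z : ℝ} {Q : FQParams}

/-- The invariant of a run after `k` iterations. -/
structure LoopInvariant (f : Vec d → ℝ) (B : Matrix (Fin d) (Fin d) ℝ) (L : ℝ) (x₀ xs : Vec d)
    (r X₀ : ℝ) (k : ℕ) (S : FQState d) (W : ℝ) : Prop where
  A_nonneg : 0 ≤ S.A
  W_nonneg : 0 ≤ W
  potential_le : S.potential f B x₀ xs + 3 / 16 * (W / L) ≤ r ^ 2 / 2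
  x_le : normB B (S.x - xs) ≤ r * (1 + 2 * k)
  growth : 1 / (4 * X₀) * (5 / 4 * k - W / (4 * X₀ ^ 4)) ≤ √√S.A

/-- W accumulates the quantities X⁴ = L²A'ρ². The potential pays for each of them, and each lowers
the guaranteed growth of A^{1/4} by its share. -/
theorem LoopInvariant.step {r X₀ : ℝ} {k : ℕ} {S S' : FQState d} {W ρ : ℝ} (hL : 0 < L)
    (hr : 0 ≤ r) (hX₀ : 0 < X₀) (hI : LoopInvariant f B L x₀ xs r X₀ k S W)
    (hp : Progress f B L x₀ xs r S S' ρ) :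
    LoopInvariant f B L x₀ xs r X₀ (k + 1) S' (W + L ^ 2 * S'.A * ρ ^ 2) := by
  have hA := hI.A_nonneg
  have hA' : 0 < S'.A := hA.trans_lt hp.A_lt
  have hρ := hp.rho_pos
  refine ⟨hA'.le, add_nonneg hI.W_nonneg (by positivity), ?_, ?_, ?_⟩
  · have e : (W + L ^ 2 * S'.A * ρ ^ 2) / L = W / L + S'.A * L * ρ ^ 2 := by field_simp
    rw [e]
    linarith [hI.potential_le, hp.potential_le]
  · have hk : r ≤ r * (1 + 2 * k) := le_mul_of_one_le_right hr (by
      have : (0 : ℝ) ≤ k := Nat.cast_nonneg k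
      linarith)
    refine (hp.x_le _ hk hI.x_le).trans (le_of_eq ?_)
    push_cast; ring
  · have h := le_fourth_root_add hL hA (sub_pos.2 hp.A_lt) hρ
      (by rw [hp.A_eq]; ring) hX₀
    rw [add_sub_cancel] at h
    refine le_trans (le_of_eq ?_) ((add_le_add_left hI.growth _).trans h)
    push_cast; ring

/-- X₀ is chosen so that X₀⁴N is the whole budget (8/3)Lr² available to W. The loss is then at most
N/4, which leaves A_N^{1/4} ≥ N/(4X₀). With A_N(f(x_N) - f*) ≤ r²/2 this gives N⁵(f(x_N) - f*) ≤
(1024/3)Lr⁴ = 4096κ₄Δ/3, which explains the constant 4096. -/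
theorem LoopInvariant.sub_le {r X₀ Δ : ℝ} {N : ℕ} {S : FQState d} {W : ℝ} (hB : B.PosDef)
    (hμ : 0 < μ) (hL : 0 < L) (hr : 0 < r) (hX₀ : 0 < X₀) (hN : 0 < N)
    (hX : X₀ ^ 4 * N = 8 / 3 * L * r ^ 2) (hr4 : μ * r ^ 4 = 4 * Δ)
    (hN5 : 4096 * (L / μ) ≤ (N : ℝ) ^ 5) (hxs : ∀ x, f xs ≤ f x)
    (hI : LoopInvariant f B L x₀ xs r X₀ N S W) : f S.x - f xs ≤ Δ / 2 := by
  have hNR : (0 : ℝ) < N := Nat.cast_pos.2 hN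
  have hg := sub_nonneg.2 (hxs S.x)
  have hv := normSqB_nonneg hB (S.dualPt B x₀ - xs)
  have hpot := hI.potential_le
  rw [FQState.potential] at hpot
  have hA := hI.A_nonneg
  have hgA := mul_nonneg hA hg
  have hWL : 0 ≤ W / L := div_nonneg hI.W_nonneg hL.le
  have h1 : S.A * (f S.x - f xs) ≤ r ^ 2 / 2 := by linarith
  have h2 : W ≤ X₀ ^ 4 * N := by
    have : W / L ≤ 8 / 3 * r ^ 2 := by linarith
    rw [div_le_iff₀ hL] at this
    linarith
  have h3 : N / (4 * X₀) ≤ √√S.A := by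
    refine le_trans ?_ hI.growth
    have : W / (4 * X₀ ^ 4) ≤ N / 4 := by
      rw [div_le_div_iff₀ (by positivity) (by norm_num)]; linarith
    calc N / (4 * X₀) = 1 / (4 * X₀) * (5 / 4 * N - N / 4) := by field_simp; ring
      _ ≤ _ := by gcongr
  have h4 : (N / (4 * X₀)) ^ 4 ≤ S.A := by
    calc (N / (4 * X₀)) ^ 4 ≤ (√√S.A) ^ 4 := pow_le_pow_left₀ (by positivity) h3 4
      _ = ((√√S.A) ^ 2) ^ 2 := by ring
      _ = S.A := by rw [Real.sq_sqrt (Real.sqrt_nonneg _), Real.sq_sqrt hA]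
  rw [div_pow, div_le_iff₀ (by positivity)] at h4
  set g := f S.x - f xs
  have h5 : (N : ℝ) ^ 5 * g ≤ 1024 / 3 * L * r ^ 4 := by
    calc (N : ℝ) ^ 5 * g = N ^ 4 * (N * g) := by ring
      _ ≤ S.A * (4 * X₀) ^ 4 * (N * g) := by gcongr
      _ = 256 * (X₀ ^ 4 * N) * (S.A * g) := by ring
      _ ≤ 256 * (X₀ ^ 4 * N) * (r ^ 2 / 2) := by gcongr
      _ = _ := by rw [hX]; ring
  have h6 : 1024 / 3 * L * r ^ 4 = 4096 * (L / μ) * (Δ / 3) := by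
    have : r ^ 4 = 4 * Δ / μ := by rw [eq_div_iff hμ.ne']; linarith
    rw [this]; ring
  have hΔ : 0 < Δ := by
    have : 0 < μ * r ^ 4 := by positivity
    linarith
  have h7 : (N : ℝ) ^ 5 * g ≤ N ^ 5 * (Δ / 3) := by
    rw [h6] at h5
    exact h5.trans (mul_le_mul_of_nonneg_right hN5 (by positivity))
  have h8 := le_of_mul_le_mul_left h7 (by positivity)
  linarith

variable (hB : B.PosDef) (hμ : 0 < μ) (hf : IsSmoothOfDegree 3 B L f)
  (hc : IsUniformlyConvexOfDegree 4 B μ f) (hs : Scales L P η Z)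
  (hD : DiffBounds f B xs R P) (hR : R ≤ P) (hQ : GoodParams Q L η Z)
  (hxs : ∀ x, f xs ≤ f x)
include hB hμ hf hc hs hD hR hQ hxs

theorem fastQuarticLoop_spec {r X₀ Δ : ℝ} {N : ℕ} (hr : 0 < r) (hX₀ : 0 < X₀) (hN : 0 < N)
    (hX : X₀ ^ 4 * N = 8 / 3 * L * r ^ 2) (hr4 : μ * r ^ 4 = 4 * Δ)
    (hN5 : 4096 * (L / μ) ≤ (N : ℝ) ^ 5) (hrR : r * (1 + 2 * N) ≤ R) (n : ℕ) :
    ∀ (k : ℕ) (S : FQState d) (W : ℝ), k + n = N → LoopInvariant f B L x₀ xs r X₀ k S W →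
      f (fastQuarticLoop f B Q x₀ n S).1 - f xs ≤ max (Z * η) (Δ / 2) := by
  have hL := hs.L_pos
  induction n with
  | zero =>
    intro k S W hk hI
    obtain rfl : k = N := by omega
    exact (hI.sub_le hB hμ hL hr hX₀ hN hX hr4 hN5 hxs).trans (le_max_right _ _)
  | succ n ih =>
    intro k S W hk hI
    have hkN : (k : ℝ) ≤ N := by exact_mod_cast (by omega : k ≤ N)
    have hpot : S.potential f B x₀ xs ≤ r ^ 2 / 2 := by
      have := div_nonneg hI.W_nonneg hL.le
      linarith [hI.potential_le]
    have hrR1 : r ≤ R := by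
      refine le_trans (le_mul_of_one_le_right hr.le ?_) hrR
      have : (0 : ℝ) ≤ N := Nat.cast_nonneg N
      linarith
    have hxR : normB B (S.x - xs) ≤ R :=
      hI.x_le.trans (le_trans (by gcongr) hrR)
    have hstep := fastQuarticStep_spec hB hμ hf hc hs hD hR hQ hxs hr.le hrR1 hI.A_nonneg hxR hpot
    rw [fastQuarticLoop]
    generalize (fastQuarticStep B Q x₀ S).run f B = out at hstep
    rcases out with ⟨x | S', c⟩
    · exact hstep.trans (le_max_left _ _)
    · obtain ⟨ρ, hp⟩ := hstep
      exact ih (k + 1) S' _ (by omega) (hI.step hL hr.le hX₀ hp)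

/-- Uniform convexity places x₀ within r = (4Δ/μ)^{1/4} of x*. An iterate moves away by at most 2r
per iteration, hence the radius r(1 + 2N). -/
theorem fastQuartic_spec {Δ : ℝ} (hΔ : 0 < Δ) (hN : 0 < Q.iters)
    (hN5 : 4096 * (L / μ) ≤ (Q.iters : ℝ) ^ 5)
    (hrR : √√(4 * Δ / μ) * (1 + 2 * Q.iters) ≤ R) (hx₀ : f x₀ - f xs ≤ Δ) :
    f (fastQuartic f B Q x₀).1 - f xs ≤ max (Z * η) (Δ / 2) := by
  have hL := hs.L_pos
  have hNR : (0 : ℝ) < Q.iters := Nat.cast_pos.2 hN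
  have h4 : ∀ t : ℝ, 0 ≤ t → (√√t) ^ 4 = t := fun t ht => by
    rw [show (√√t) ^ 4 = ((√√t) ^ 2) ^ 2 by ring, Real.sq_sqrt (Real.sqrt_nonneg _),
      Real.sq_sqrt ht]
  set r := √√(4 * Δ / μ) with hrdef
  have hr : 0 < r := Real.sqrt_pos.2 (Real.sqrt_pos.2 (by positivity))
  have hr4 : r ^ 4 = 4 * Δ / μ := h4 _ (by positivity)
  have hX₀ : 0 < √√(8 / 3 * L * r ^ 2 / Q.iters) :=
    Real.sqrt_pos.2 (Real.sqrt_pos.2 (by positivity))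
  have hdist : normB B (x₀ - xs) ≤ r := by
    refine le_of_pow_le_pow_left₀ four_ne_zero hr.le ?_
    rw [hr4]
    refine (hc.normB_pow_four_le hμ hxs x₀).trans ?_
    rw [div_mul_eq_mul_div]
    gcongr
  refine fastQuarticLoop_spec hB hμ hf hc hs hD hR hQ hxs hr hX₀ hN ?_ ?_ hN5 hrR Q.iters 0
    ⟨x₀, 0, 0⟩ 0 (by omega) ⟨le_rfl, le_rfl, ?_, ?_, ?_⟩
  · rw [h4 _ (by positivity)]; field_simp
  · rw [hr4]; field_simp
  · have : normSqB B (x₀ - xs) ≤ r ^ 2 := by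
      rw [← normB_sq hB]; exact pow_le_pow_left₀ (normB_nonneg _) hdist 2
    simp [FQState.potential, FQState.dualPt]
    linarith
  · simpa using hdist
  · simp

/-- Each run halves the bound 2ˢε on the gap. A run that stops early already ends below ε, hence
below the halved bound. The ball belonging to the first bound serves all runs. -/
theorem restartedFastQuartic_spec {Δ₀ : ℝ} (hN : 0 < Q.iters)
    (hN5 : 4096 * (L / μ) ≤ (Q.iters : ℝ) ^ 5)
    (hrR : √√(4 * Δ₀ / μ) * (1 + 2 * Q.iters) ≤ R) (s : ℕ) :
    ∀ x : Vec d, f x - f xs ≤ 2 ^ s * (Z * η) → 2 ^ s * (Z * η) ≤ Δ₀ →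
      f (restartedFastQuartic f B Q s x).1 - f xs ≤ Z * η := by
  have hε : 0 < Z * η := mul_pos hs.Z_pos hs.η_pos
  induction s with
  | zero => intro x h _; simpa [restartedFastQuartic] using h
  | succ s ih =>
    intro x h h'
    have hle : √√(4 * (2 ^ (s + 1) * (Z * η)) / μ) ≤ √√(4 * Δ₀ / μ) := by gcongr
    have h1 := fastQuartic_spec hB hμ hf hc hs hD hR hQ hxs (by positivity) hN hN5
      (le_trans (mul_le_mul_of_nonneg_right hle (by positivity)) hrR) h
    have h2 : (2 : ℝ) ^ (s + 1) * (Z * η) / 2 = 2 ^ s * (Z * η) := by rw [pow_succ]; ring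
    have h3 : Z * η ≤ 2 ^ s * (Z * η) := le_mul_of_one_le_left hε.le (one_le_pow₀ (by norm_num))
    rw [h2, max_eq_right h3] at h1
    refine ih _ h1 (le_trans ?_ h')
    rw [pow_succ]
    nlinarith

end Run

/-! ### Numbers of calls and iterations -/

section Counts

variable {d : ℕ} (f : Vec d → ℝ) (B : Matrix (Fin d) (Fin d) ℝ) (Q : FQParams)

theorem calls_dualBisection (y c : Vec d) (n : ℕ) : ∀ lo hi : ℝ,
    ((dualBisection B Q y c n lo hi).run f B).2 = ⟨0, n + 1⟩ := by
  induction n with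
  | zero =>
    intro lo hi
    rw [dualBisection, OracleProg.run_bind, run_askSolve, OracleProg.run_pure]
    rfl
  | succ n ih =>
    intro lo hi
    rw [dualBisection, OracleProg.run_bind, run_askSolve]
    simp only
    split_ifs
    · simp only [ih]; congr 1; omega
    · simp only [ih]; congr 1; omega

theorem calls_auxStep (y h : Vec d) :
    ((auxStep B Q y h).run f B).2 = ⟨1, Q.dualSteps + 1⟩ := by
  rw [auxStep, OracleProg.run_bind, run_askGrad]
  simp only [calls_dualBisection]
  congr 1; omega

theorem calls_auxLoop (y : Vec d) (n : ℕ) : ∀ h : Vec d,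
    ((auxLoop B Q y n h).run f B).2 = ⟨n, n * (Q.dualSteps + 1)⟩ := by
  induction n with
  | zero => intro h; rw [auxLoop, OracleProg.run_pure, zero_mul]
  | succ n ih =>
    intro h
    rw [auxLoop, OracleProg.run_bind]
    simp only [ih, calls_auxStep]
    congr 1
    · omega
    · ring

theorem calls_tryRho (x v : Vec d) (A ρ : ℝ) : ((tryRho B Q x v A ρ).run f B).2 =
    ⟨Q.auxSteps, Q.auxSteps * (Q.dualSteps + 1)⟩ := by
  rw [tryRho, OracleProg.run_bind, OracleProg.run_pure, approxAuxMin]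
  simp only [OracleProg.run_bind, OracleProg.run_pure, calls_auxLoop, add_zero]

theorem calls_rhoSearch_le (x v : Vec d) (A : ℝ) (n : ℕ) : ∀ lo hi : ℝ,
    ((rhoSearch B Q x v A n lo hi).run f B).2.grad ≤ (n + 1) * Q.auxSteps ∧
    ((rhoSearch B Q x v A n lo hi).run f B).2.solver ≤
      (n + 1) * (Q.auxSteps * (Q.dualSteps + 1)) := by
  induction n with
  | zero =>
    intro lo hi
    rw [rhoSearch, calls_tryRho]
    simp
  | succ n ih =>
    intro lo hi
    rw [rhoSearch, OracleProg.run_bind]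
    simp only [calls_tryRho]
    rw [show (n + 1 + 1) * Q.auxSteps = Q.auxSteps + (n + 1) * Q.auxSteps by ring,
      show (n + 1 + 1) * (Q.auxSteps * (Q.dualSteps + 1)) = Q.auxSteps * (Q.dualSteps + 1) +
        (n + 1) * (Q.auxSteps * (Q.dualSteps + 1)) by ring]
    split_ifs
    · exact ⟨Nat.add_le_add_left (ih _ _).1 _, Nat.add_le_add_left (ih _ _).2 _⟩
    · exact ⟨Nat.add_le_add_left (ih _ _).1 _, Nat.add_le_add_left (ih _ _).2 _⟩
    · rw [OracleProg.run_pure]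
      exact ⟨Nat.add_le_add_left (Nat.zero_le _) _, Nat.add_le_add_left (Nat.zero_le _) _⟩

/-- The bound on the calls made in one iteration. -/
def CallsBounded (Q : FQParams) (c : Calls) : Prop :=
  c.grad ≤ (Q.rhoSteps + 2) * Q.auxSteps + 1 ∧
    c.solver ≤ (Q.rhoSteps + 2) * (Q.auxSteps * (Q.dualSteps + 1)) + 1

theorem callsBounded_fastQuarticStep (x₀ : Vec d) (S : FQState d) :
    CallsBounded Q ((fastQuarticStep B Q x₀ S).run f B).2 := by
  -- One trial at ρ⁻ and at most M + 1 in the search, plus one gradient at the new point and one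
  -- solve with B.
  have e1 : (Q.rhoSteps + 2) * Q.auxSteps = Q.auxSteps + (Q.rhoSteps + 1) * Q.auxSteps := by ring
  have e2 : (Q.rhoSteps + 2) * (Q.auxSteps * (Q.dualSteps + 1)) =
    Q.auxSteps * (Q.dualSteps + 1) + (Q.rhoSteps + 1) * (Q.auxSteps * (Q.dualSteps + 1)) := by ring
  rw [CallsBounded, e1, e2, fastQuarticStep, OracleProg.run_bind, run_askMetric]
  simp only
  rw [OracleProg.run_bind]
  simp only [calls_tryRho]
  split_ifs
  · rw [OracleProg.run_pure]
    constructor <;> simp only <;> omega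
  · rw [OracleProg.run_bind]
    have := calls_rhoSearch_le f B Q S.x (x₀ - B⁻¹ *ᵥ S.G) S.A Q.rhoSteps Q.rhoMinus Q.rhoPlus
    simp only [OracleProg.run_bind, run_askGrad, OracleProg.run_pure]
    constructor <;> omega

theorem fastQuarticLoop_calls (x₀ : Vec d) (n : ℕ) : ∀ S : FQState d,
    (fastQuarticLoop f B Q x₀ n S).2.length ≤ n ∧
      ∀ c ∈ (fastQuarticLoop f B Q x₀ n S).2, CallsBounded Q c := by
  induction n with
  | zero => intro S; simp [fastQuarticLoop]
  | succ n ih =>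
    intro S
    have hb := callsBounded_fastQuarticStep f B Q x₀ S
    rw [fastQuarticLoop]
    generalize (fastQuarticStep B Q x₀ S).run f B = out at hb
    rcases out with ⟨x | S', c⟩
    · simpa using hb
    · simpa using ⟨(ih S').1, hb, (ih S').2⟩

theorem restartedFastQuartic_calls (s : ℕ) : ∀ x : Vec d,
    (restartedFastQuartic f B Q s x).2.length ≤ s * Q.iters ∧
      ∀ c ∈ (restartedFastQuartic f B Q s x).2, CallsBounded Q c := by
  induction s with
  | zero => intro x; simp [restartedFastQuartic]
  | succ s ih =>
    intro x
    have h1 := fastQuarticLoop_calls f B Q x Q.iters ⟨x, 0, 0⟩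
    have h2 := ih (fastQuartic f B Q x).1
    simp only [restartedFastQuartic, List.length_append, List.mem_append]
    refine ⟨?_, fun c hc => hc.elim (h1.2 c) (h2.2 c)⟩
    rw [add_mul, one_mul, add_comm (s * Q.iters)]
    exact Nat.add_le_add h1.1 h2.1

end Counts

/-! ### The initialization and the main theorem -/

/-- Nothing fixes the sign of L in dimension 0. For a negative base the real power carries the
factor cos(π/5), which is still nonnegative. -/
theorem rpow_one_fifth_nonneg (x : ℝ) : 0 ≤ x ^ (1 / 5 : ℝ) := by
  rcases le_or_gt 0 x with hx | hx
  · exact Real.rpow_nonneg hx _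
  · rw [Real.rpow_def_of_neg hx]
    refine mul_nonneg (Real.exp_pos _).le (Real.cos_nonneg_of_neg_pi_div_two_le_of_le ?_ ?_)
    all_goals linarith [Real.pi_pos]

/-- As 99/100 ≤ exp(-1/100), each factor 100 in 10000 has its role: one for this rate, one for the
exponent 100. -/
theorem pow_le_inv_pow_of_log_le {u b : ℝ} {n : ℕ} (hu : 0 < u) (hb : 0 ≤ b) (hb' : b ≤ 99 / 100)
    (hn : 10000 * Real.log u ≤ n) : b ^ n ≤ u⁻¹ ^ 100 := by
  have h1 : b ≤ Real.exp (-(1 / 100)) := by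
    have := Real.add_one_le_exp (-(1 / 100) : ℝ)
    linarith
  calc b ^ n ≤ Real.exp (-(1 / 100)) ^ n := by gcongr
    _ = Real.exp (-(n / 100)) := by rw [← Real.exp_nat_mul]; congr 1; ring
    _ ≤ Real.exp (100 * -Real.log u) := Real.exp_le_exp.2 (by linarith)
    _ = u⁻¹ ^ 100 := by
      rw [← Real.log_inv, ← Real.exp_log (inv_pos.2 hu), Real.log_exp, ← Real.exp_nat_mul]
      norm_num

theorem goodParams_initParams {L μ Z ε : ℝ} (hZ : 0 < Z) (hε : 0 < ε) :
    GoodParams (initParams 10000 1 16 L μ Z ε) L (ε / Z) Z := by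
  have hn : 10000 * Real.log (Z / ε) ≤ ⌈10000 * Real.log (Z / ε)⌉₊ := Nat.le_ceil _
  have hu : 0 < Z / ε := by positivity
  have key {b : ℝ} (hb : 0 ≤ b) (hb' : b ≤ 99 / 100) :
      b ^ ⌈10000 * Real.log (Z / ε)⌉₊ ≤ (ε / Z) ^ 100 := by
    simpa only [inv_div] using pow_le_inv_pow_of_log_le hu hb hb' hn
  exact
    { L_eq := rfl
      rhoMinus := rfl
      rhoPlus := rfl
      epsFs := by simp only [initParams]; positivity
      epsAam := rfl
      lamMax := rfl
      dual := key (by norm_num) (by norm_num)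
      aux := key (by norm_num) (by norm_num)
      rho := key (by norm_num) (by norm_num) }

theorem CallsBounded.le_log_pow {L μ Z ε : ℝ} {c : Calls} (hℓ : 1 ≤ Real.log (Z / ε))
    (hc : CallsBounded (initParams 10000 1 16 L μ Z ε) c) :
    (c.grad : ℝ) ≤ 10 ^ 13 * Real.log (Z / ε) ^ 3 ∧
      (c.solver : ℝ) ≤ 10 ^ 13 * Real.log (Z / ε) ^ 3 := by
  set ℓ := Real.log (Z / ε) with hdef
  obtain ⟨h1, h2⟩ := hc
  simp only [initParams, ← hdef] at h1 h2
  have hn : (⌈10000 * ℓ⌉₊ : ℝ) ≤ 10001 * ℓ := by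
    linarith [Nat.ceil_lt_add_one (by linarith : (0 : ℝ) ≤ 10000 * ℓ)]
  set n := ⌈10000 * ℓ⌉₊
  have h12 : (n + 2) * n + 1 ≤ (n + 2) * (n * (n + 1)) + 1 := by
    gcongr
    exact Nat.le_mul_of_pos_right _ n.succ_pos
  have hs : (c.solver : ℝ) ≤ (n + 2) * (n * (n + 1)) + 1 := by exact_mod_cast h2
  have hg : (c.grad : ℝ) ≤ (n + 2) * (n * (n + 1)) + 1 := by exact_mod_cast h1.trans h12
  have hb : ((n : ℝ) + 2) * (n * (n + 1)) + 1 ≤ 10 ^ 13 * ℓ ^ 3 := by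
    have e : ((n : ℝ) + 2) * (n * (n + 1)) ≤ (10003 * ℓ) * ((10001 * ℓ) * (10002 * ℓ)) := by
      gcongr <;> linarith
    have h1 : 1 ≤ ℓ ^ 3 := one_le_pow₀ hℓ
    calc ((n : ℝ) + 2) * (n * (n + 1)) + 1
        ≤ (10003 * ℓ) * ((10001 * ℓ) * (10002 * ℓ)) + ℓ ^ 3 := by linarith
      _ = (10003 * 10001 * 10002 + 1) * ℓ ^ 3 := by ring
      _ ≤ 10 ^ 13 * ℓ ^ 3 := by gcongr; norm_num
  exact ⟨hg.trans hb, hs.trans hb⟩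

theorem ceil_logb_eq_zero {t : ℝ} (h0 : 0 ≤ t) (h1 : t ≤ 1) : ⌈Real.logb 2 t⌉₊ = 0 :=
  Nat.ceil_eq_zero.2 (Real.logb_nonpos (by norm_num) h0 h1)

theorem le_two_pow_ceil_logb {t : ℝ} (h : 0 < t) : t ≤ 2 ^ ⌈Real.logb 2 t⌉₊ := by
  have h1 := (Real.logb_le_iff_le_rpow (by norm_num : (1 : ℝ) < 2) h).1 (Nat.le_ceil _)
  rwa [Real.rpow_natCast] at h1

theorem two_pow_ceil_logb_le {t : ℝ} (h : 1 ≤ t) : (2 : ℝ) ^ ⌈Real.logb 2 t⌉₊ ≤ 2 * t := by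
  have h0 : 0 < t := by linarith
  have h1 := (Nat.ceil_lt_add_one (Real.logb_nonneg (by norm_num : (1 : ℝ) < 2) h)).le
  calc (2 : ℝ) ^ ⌈Real.logb 2 t⌉₊ = (2 : ℝ) ^ (⌈Real.logb 2 t⌉₊ : ℝ) := (Real.rpow_natCast _ _).symm
    _ ≤ (2 : ℝ) ^ (Real.logb 2 t + 1) := Real.rpow_le_rpow_of_exponent_le (by norm_num) h1
    _ = 2 * t := by
      rw [Real.rpow_add (by norm_num), Real.rpow_one,
        Real.rpow_logb (by norm_num) (by norm_num) h0, mul_comm]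

theorem ceil_logb_le_posLog {t : ℝ} (h : 1 ≤ t) :
    (⌈Real.logb 2 t⌉₊ : ℝ) ≤ 2 * (1 + Real.posLog t) := by
  have h1 := (Nat.ceil_lt_add_one (Real.logb_nonneg (by norm_num : (1 : ℝ) < 2) h)).le
  have h2 : Real.logb 2 t ≤ 2 * Real.log t := by
    have hl := Real.log_two_gt_d9
    rw [Real.logb, div_le_iff₀ (by linarith)]
    nlinarith [Real.log_nonneg h]
  have h3 : Real.log t ≤ Real.posLog t := le_max_right _ _
  linarith

theorem initParams_iters {L μ Z ε : ℝ} (hκ : 1 ≤ L / μ) :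
    0 < (initParams 10000 1 16 L μ Z ε).iters ∧
      4096 * (L / μ) ≤ ((initParams 10000 1 16 L μ Z ε).iters : ℝ) ^ 5 ∧
      ((initParams 10000 1 16 L μ Z ε).iters : ℝ) ≤ 10001 * (L / μ) ^ (1 / 5 : ℝ) := by
  have h1 : 1 ≤ (L / μ) ^ (1 / 5 : ℝ) := Real.one_le_rpow hκ (by norm_num)
  have h5 : ((L / μ) ^ (1 / 5 : ℝ)) ^ 5 = L / μ := by
    rw [← Real.rpow_natCast, ← Real.rpow_mul (by linarith)]; norm_num
  simp only [initParams]
  set k := (L / μ) ^ (1 / 5 : ℝ)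
  have hle : 10000 * k ≤ ⌈10000 * k⌉₊ := Nat.le_ceil _
  refine ⟨Nat.ceil_pos.2 (by linarith), ?_, ?_⟩
  · calc 4096 * (L / μ) ≤ 10000 ^ 5 * (L / μ) := by gcongr; norm_num
      _ = (10000 * k) ^ 5 := by rw [mul_pow, h5]
      _ ≤ _ := by gcongr
  · linarith [Nat.ceil_lt_add_one (by linarith : (0 : ℝ) ≤ 10000 * k)]

/-! ### Choice of the scale and the accuracy guarantee -/

section Main

variable {d : ℕ} {B : Matrix (Fin d) (Fin d) ℝ} {f : Vec d → ℝ} {L μ : ℝ} {xs x₀ : Vec d}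

theorem exists_scale (hB : B.PosDef) (hf : IsSmoothOfDegree 3 B L f) (hL : 0 < L) (Δ R : ℝ) :
    ∃ P : ℝ, 10 ^ 4 ≤ P ∧ L ≤ P ∧ 1 ≤ P * L ∧ Δ ≤ P ∧ R ≤ P ∧ DiffBounds f B xs R P := by
  obtain ⟨P₀, hP₀⟩ := hf.exists_diffBounds hB xs R
  refine ⟨10 ^ 4 + L + 1 / L + |Δ| + |R| + |P₀|, ?_⟩
  have hi : 0 < 1 / L := by positivity
  have a1 := abs_nonneg Δ
  have a2 := abs_nonneg R
  have a3 := abs_nonneg P₀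
  have b1 := le_abs_self Δ
  have b2 := le_abs_self R
  have b3 := le_abs_self P₀
  refine ⟨by linarith, by linarith, ?_, by linarith, by linarith, hP₀ _ (by linarith)⟩
  rw [← div_le_iff₀ hL]
  linarith

/-- With P dominating L, 1/L, the gap, the radius and the differentials, Z₀ = P²¹ works: since ε ≤
P, the ratio η = ε/Z satisfies P²⁰η ≤ 1 and Zη = ε ≤ P. -/
theorem restartedFastQuartic_guarantee (hB : B.PosDef) (hμ : 0 < μ)
    (hf : IsSmoothOfDegree 3 B L f) (hc : IsUniformlyConvexOfDegree 4 B μ f)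
    (hxs : ∀ x, f xs ≤ f x) (h0 : f xs < f x₀) :
    ∃ Z₀ : ℝ, 0 < Z₀ ∧ ∀ Z, Z₀ ≤ Z → ∀ ε, 0 < ε → ε ≤ f x₀ - f xs →
      let Q := initParams 10000 1 16 L μ Z ε
      let S := ⌈Real.logb 2 ((f x₀ - f xs) / ε)⌉₊
      1 ≤ L / μ ∧ 1 ≤ Real.log (Z / ε) ∧ f (restartedFastQuartic f B Q S x₀).1 - f xs ≤ ε := by
  have hne : x₀ - xs ≠ 0 := fun h => h0.ne (by rw [sub_eq_zero.1 h])
  have hL3 := hc.three_mul_le hB hf hne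
  have hL : 0 < L := by linarith
  have hκ : 1 ≤ L / μ := by rw [le_div_iff₀ hμ]; linarith
  set Δ := f x₀ - f xs with hΔ
  have hΔ0 : 0 < Δ := by linarith
  obtain ⟨P, hP4, hLP, hPL, hΔP, hRP, hD⟩ := exists_scale (xs := xs) hB hf hL Δ
    (√√(4 * (2 * Δ) / μ) * (1 + 2 * (⌈10000 * (L / μ) ^ (1 / 5 : ℝ)⌉₊ : ℕ)))
  have hP : 0 < P := by linarith
  have hP1 : 1 ≤ P := by linarith
  refine ⟨P ^ 21, by positivity, fun Z hZ ε hε hεΔ => ?_⟩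
  have hZ0 : 0 < Z := lt_of_lt_of_le (by positivity) hZ
  have hη : Z * (ε / Z) = ε := by field_simp
  have hs : Scales L P (ε / Z) Z :=
    { le_P := hP4
      L_le := hLP
      one_le := hPL
      η_pos := by positivity
      η_le := by
        rw [mul_div_assoc', div_le_one hZ0]
        calc P ^ 20 * ε ≤ P ^ 20 * P := by gcongr; linarith
          _ = P ^ 21 := by ring
          _ ≤ Z := hZ
      le_Z := (pow_le_pow_right₀ hP1 (by norm_num)).trans hZ
      Z_le := by rw [hη]; linarith }
  obtain ⟨hN, hN5, -⟩ := initParams_iters (Z := Z) (ε := ε) hκ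
  have ht : 1 ≤ Δ / ε := by rwa [one_le_div hε]
  refine ⟨hκ, ?_, ?_⟩
  · have h3 : Real.exp 1 ≤ Z / ε := by
      rw [le_div_iff₀ hε]
      calc Real.exp 1 * ε ≤ P * P := by
            gcongr
            · linarith [Real.exp_one_lt_d9]
            · linarith
        _ = P ^ 2 := by ring
        _ ≤ P ^ 21 := pow_le_pow_right₀ hP1 (by norm_num)
        _ ≤ Z := hZ
    exact (Real.le_log_iff_exp_le (by positivity)).2 h3
  -- Rounding S up may double the initial bound, 2ˢε ≤ 2Δ; the radius was therefore chosen for 2Δ.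
  · have key := restartedFastQuartic_spec hB hμ hf hc hs hD hRP
      (goodParams_initParams (L := L) (μ := μ) hZ0 hε) hxs (Δ₀ := 2 * Δ) hN hN5 le_rfl
      ⌈Real.logb 2 (Δ / ε)⌉₊ x₀
    rw [hη] at key
    refine key ?_ ?_
    · rw [← div_le_iff₀ hε]
      exact le_two_pow_ceil_logb (by positivity)
    · have := two_pow_ceil_logb_le ht
      calc _ ≤ 2 * (Δ / ε) * ε := by gcongr
        _ = 2 * Δ := by field_simp

end Main

theorem mainTheorem3 :
    ∃ (c C : ℝ) (p q r : ℕ), 0 < c ∧ 0 < C ∧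
      ∀ (d : ℕ) (B : Matrix (Fin d) (Fin d) ℝ) (f : Vec d → ℝ) (L μ : ℝ) (x₀ : Vec d),
        B.PosDef → 0 < μ →
        IsSmoothOfDegree 3 B L f → IsUniformlyConvexOfDegree 4 B μ f →
        ∃ xs : Vec d, (∀ x, f xs ≤ f x) ∧
          ∃ Z₀ : ℝ, 0 < Z₀ ∧ ∀ Z : ℝ, Z₀ ≤ Z → ∀ ε : ℝ, 0 < ε →
            ∀ out : Vec d × List Calls,
              out = restartedFastQuartic f B (initParams c p q L μ Z ε)
                ⌈Real.logb 2 ((f x₀ - f xs) / ε)⌉₊ x₀ →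
              f out.1 - f xs ≤ ε ∧
              (out.2.length : ℝ)
                ≤ C * (L / μ) ^ (1 / 5 : ℝ) * (1 + Real.posLog ((f x₀ - f xs) / ε)) ∧
              ∀ calls ∈ out.2,
                (calls.grad : ℝ) ≤ C * Real.log (Z / ε) ^ r ∧
                (calls.solver : ℝ) ≤ C * Real.log (Z / ε) ^ r := by
  refine ⟨10000, 10 ^ 13, 1, 16, 3, by norm_num, by norm_num, ?_⟩
  intro d B f L μ x₀ hB hμ hf hc
  obtain ⟨xs, hxs⟩ := hc.exists_minimizer hB hμ
  refine ⟨xs, hxs, ?_⟩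
  -- If ε is at least the initial gap, S = 0 and nothing is run. This includes f(x₀) = f(x*), where
  -- `Real.logb 2 0 = 0`, and so dimension 0.
  have trivialCase : ∀ Z ε : ℝ, 0 < ε → f x₀ - f xs ≤ ε → ∀ out : Vec d × List Calls,
      out = restartedFastQuartic f B (initParams 10000 1 16 L μ Z ε)
        ⌈Real.logb 2 ((f x₀ - f xs) / ε)⌉₊ x₀ →
      f out.1 - f xs ≤ ε ∧ (out.2.length : ℝ)
        ≤ 10 ^ 13 * (L / μ) ^ (1 / 5 : ℝ) * (1 + Real.posLog ((f x₀ - f xs) / ε)) ∧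
      ∀ calls ∈ out.2, (calls.grad : ℝ) ≤ 10 ^ 13 * Real.log (Z / ε) ^ 3 ∧
        (calls.solver : ℝ) ≤ 10 ^ 13 * Real.log (Z / ε) ^ 3 := by
    intro Z ε hε hle out ho
    rw [ceil_logb_eq_zero (div_nonneg (sub_nonneg.2 (hxs x₀)) hε.le) ((div_le_one hε).2 hle),
      restartedFastQuartic] at ho
    subst ho
    have h1 := rpow_one_fifth_nonneg (L / μ)
    have h2 := Real.posLog_nonneg (x := (f x₀ - f xs) / ε)
    refine ⟨hle, ?_, by simp⟩
    simp only [List.length_nil, Nat.cast_zero]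
    positivity
  rcases (hxs x₀).eq_or_lt with h0 | h0
  · exact ⟨1, one_pos, fun Z _ ε hε => trivialCase Z ε hε (by linarith)⟩
  obtain ⟨Z₀, hZ₀, H⟩ := restartedFastQuartic_guarantee hB hμ hf hc hxs h0
  refine ⟨Z₀, hZ₀, fun Z hZ ε hε => ?_⟩
  rcases le_total (f x₀ - f xs) ε with hle | hle
  · exact trivialCase Z ε hε hle
  rintro out rfl
  obtain ⟨hκ, hℓ, hfin⟩ := H Z hZ ε hε hle
  obtain ⟨hlen, hcalls⟩ := restartedFastQuartic_calls f B (initParams 10000 1 16 L μ Z ε)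
    ⌈Real.logb 2 ((f x₀ - f xs) / ε)⌉₊ x₀
  refine ⟨hfin, ?_, fun c hcm => (hcalls c hcm).le_log_pow hℓ⟩
  have hS := ceil_logb_le_posLog ((one_le_div hε).2 hle)
  have hN := (initParams_iters (Z := Z) (ε := ε) hκ).2.2
  have h1 := rpow_one_fifth_nonneg (L / μ)
  have h2 := Real.posLog_nonneg (x := (f x₀ - f xs) / ε)
  have hlen' := (Nat.cast_le (α := ℝ)).2 hlen
  rw [Nat.cast_mul] at hlen'
  refine hlen'.trans ?_
  calc _ ≤ 2 * (1 + Real.posLog ((f x₀ - f xs) / ε)) * (10001 * (L / μ) ^ (1 / 5 : ℝ)) := by gcongr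
    _ = 20002 * ((L / μ) ^ (1 / 5 : ℝ) * (1 + Real.posLog ((f x₀ - f xs) / ε))) := by ring
    _ ≤ 10 ^ 13 * ((L / μ) ^ (1 / 5 : ℝ) * (1 + Real.posLog ((f x₀ - f xs) / ε))) := by
      gcongr; norm_num
    _ = _ := by ring
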